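/- Let $(\Gamma,d)$ be a countable metric space, and let $F:[0,\infty)\to(0,\infty)$ be a non-increasing function with $$\sup_{x\in\Gamma}\sum_{y\in\Gamma}F(d(x,y))<\infty,\qquad \sup_{x,y\in\Gamma}\sum_{z\in\Gamma}\frac{F(d(x,z))F(d(y,z))}{F(d(x,y))}<\infty .$$ For $\mu>0$ put $F_\mu(r)=e^{-\mu r}F(r)$. To every $x\in\Gamma$ a non-zero complex Hilbert space $\mathcal H_x$ is assigned. For finite $\Lambda\subset\Gamma$ let $\mathcal A_\Lambda=\bigotimes_{x\in\Lambda}\mathcal B(\mathcal H_x)$ (spatial $C^*$-tensor product, acting on $\bigotimes_{x\in\Lambda}\mathcal H_x$), with $\mathcal A_{\Lambda_1}\cong\mathcal A_{\Lambda_1}\otimes 1\subset\mathcal A_{\Lambda_2}$ for $\Lambda_1\subset\Lambda_2$, and let the quasi-local algebra $\mathcal A_\Gamma$ be the norm completion of $\bigcup_\Lambda\mathcal A_\Lambda$. For every $t\in\mathbb R$ and every finite $Z\subset\Gamma$ let $\Phi(t,Z)=\Phi(t,Z)^*\in\mathcal A_Z$ and $L_a(t,Z)\in\mathcal A_Z$,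 $a=1,\dots,N(Z)\le\infty$, where, if $N(Z)=\infty$, $\sum_aL_a(t,Z)^*L_a(t,Z)$ converges weakly to a bounded operator, and suppose that $$\Psi_Z(t)(A)=i[\Phi(t,Z),A]+\sum_{a=1}^{N(Z)}\Big(L_a(t,Z)^*AL_a(t,Z)-\tfrac12\{L_a(t,Z)^*L_a(t,Z),A\}\Big)$$ maps $\mathcal A_Z$ to itself. For finite $\Lambda$ let $\mathcal L_\Lambda(t)=\sum_{Z\subset\Lambda}\Psi_Z(t)$. Assume that 1. for every finite $\Lambda$, $t\mapsto\mathcal L_\Lambda(t)\in\mathcal B(\mathcal A_\Lambda,\mathcal A_\Lambda)$ is continuous in the operator norm; 2. there is $\mu>0$ such that for every $t\in\mathbb R$ $$\sup_{s\in[0,t]}\ \sup_{x,y\in\Gamma}\ \sum_{Z\ni x,y}\frac{\|\Psi_Z(s)\|_{\rm cb}}{F_\mu(d(x,y))}<\infty,$$ where $Z$ runs over the finite subsets of $\Gamma$ and $\|\Psi\|_{\rm cb}=\sup_n\|\Psi\otimes{\rm id}_{M_n}\|$ is the completely bounded norm of maps on $\mathcal A_Z$. For finite $\Lambda$ and $0\le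 s\le t$ let $\gamma^\Lambda_{t,s}(A)=A(t)$, where $A(\cdot)$ is the solution on $[s,\infty)$ of $\frac{d}{dt}A(t)=\mathcal L_\Lambda(t)A(t)$, $A(s)=A$; it exists and leaves $\mathcal A_\Lambda$ invariant, and for $A\in\mathcal A_\Gamma$ it is $\gamma^\Lambda_{t,s}\otimes{\rm id}$. Then there is a family of unit-preserving completely positive maps $\gamma^\Gamma_{t,s}$, $0\le s\le t$, on $\mathcal A_\Gamma$ which is a strongly continuous cocycle ($\gamma^\Gamma_{s,s}={\rm id}$, $\gamma^\Gamma_{t,r}\gamma^\Gamma_{r,s}=\gamma^\Gamma_{t,s}$ for $0\le s\le r\le t$, and $(t,s)\mapsto\gamma^\Gamma_{t,s}(A)$ is norm-continuous for every $A\in\mathcal A_\Gamma$) such that for all $0\le s\le t$, every increasing sequence of finite subsets $\Lambda_n$ with $\bigcup_n\Lambda_n=\Gamma$, and all $A\in\mathcal A_\Gamma$, $$\lim_{n\to\infty}\|\gamma^{\Lambda_n}_{t,s}(A)-\gamma^\Gamma_{t,s}(A)\|=0 .$$ -/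

import Mathlib

open Filter Topology
open scoped NNReal ENNReal InnerProductSpace Matrix

namespace QuantumLattice

section L2
variable {α : Type*}

theorem memlp_two_iff (g : α → ℂ) : Memℓp g 2 ↔ ∑' a, ‖g a‖ₑ ^ 2 ≠ ∞ := by
  rw [memℓp_gen_iff (by norm_num)]
  have h : ∀ a, ‖g a‖ₑ ^ 2 = ((‖g a‖₊ ^ 2 : ℝ≥0) : ℝ≥0∞) := fun a => by
    simp [enorm_eq_nnnorm]
  simp_rw [h]
  rw [ENNReal.tsum_coe_ne_top_iff_summable, ← NNReal.summable_coe]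
  simp

theorem enorm_sq_eq_tsum (f : lp (fun _ : α => ℂ) 2) : ‖f‖ₑ ^ 2 = ∑' a, ‖f a‖ₑ ^ 2 := by
  have h := lp.norm_rpow_eq_tsum (p := 2) (by norm_num) f
  have hs := (memℓp_gen_iff (p := 2) (by norm_num)).1 (lp.memℓp f)
  simp only [ENNReal.toReal_ofNat, Real.rpow_ofNat] at h hs
  have e : ∀ z : ℝ, 0 ≤ z → ENNReal.ofReal z ^ 2 = ENNReal.ofReal (z ^ 2) := fun z hz => by
    rw [ENNReal.ofReal_pow hz]
  rw [← ofReal_norm, e _ (norm_nonneg _), h,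
    ENNReal.ofReal_tsum_of_nonneg (fun _ => by positivity) hs]
  refine tsum_congr fun a => ?_
  rw [← ofReal_norm, e _ (norm_nonneg _)]

end L2

section QuasiLocalAlgebra

universe u v w

variable {Γ : Type u} {H : Γ → Type v} [∀ x, NormedAddCommGroup (H x)]
  [∀ x, InnerProductSpace ℂ (H x)] {ι : Γ → Type w}

/-- The Hilbert space carrying all local algebras. The space `H x` at the site `x` has the orthonormal
basis `b x`, indexed by `ι x`, and `Rep ι` has an orthonormal basis `e_σ` indexed by all
configurations `σ` (a basis label at every site); `e_σ` plays the role of the product vector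
`⨂ₓ b x (σ x)`. For every finite `Λ` it is `(⨂_{x ∈ Λ} H x) ⊗ ℓ²(configurations off Λ)`, so operators on
`⨂_{x ∈ Λ} H x` act on it faithfully (hence isometrically) as `A ⊗ 1`, compatibly for
`Λ₁ ⊆ Λ₂`. -/
abbrev Rep (ι : Γ → Type w) : Type _ := lp (fun _ : ((x : Γ) → ι x) => ℂ) 2

open Classical in
theorem memlp_slice (f : Rep ι) (x : Γ) (σ : (y : Γ) → ι y) :
    Memℓp (fun i : ι x => f (Function.update σ x i)) 2 := by
  have hf := (memlp_two_iff _).1 (lp.memℓp f)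
  rw [memlp_two_iff]
  refine ne_top_of_le_ne_top hf ?_
  exact ENNReal.tsum_comp_le_tsum_of_injective (Function.update_injective σ x)
    (fun τ => ‖f τ‖ₑ ^ 2)

open Classical in
/-- The `H x`-valued slice `∑ᵢ f (σ with σ x := i) • b x i` of `f` at the site `x`; it depends on `σ`
only off `x`. -/
noncomputable def slice (b : ∀ x, HilbertBasis (ι x) ℂ (H x)) (x : Γ) (f : Rep ι)
    (σ : (y : Γ) → ι y) : H x :=
  (b x).repr.symm ⟨fun i => f (Function.update σ x i), memlp_slice f x σ⟩

/-- The coordinates of `(T ⊗ 1) f`, where `T` acts at the site `x`. -/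
noncomputable def siteFun (b : ∀ x, HilbertBasis (ι x) ℂ (H x)) (x : Γ) (T : H x →L[ℂ] H x)
    (f : Rep ι) (σ : (y : Γ) → ι y) : ℂ :=
  ⟪b x (σ x), T (slice b x f σ)⟫_ℂ

open Classical in
theorem enorm_slice_sq (b : ∀ x, HilbertBasis (ι x) ℂ (H x)) (x : Γ) (f : Rep ι)
    (σ : (y : Γ) → ι y) :
    ‖slice b x f σ‖ₑ ^ 2 = ∑' i, ‖f (Function.update σ x i)‖ₑ ^ 2 := by
  rw [slice, LinearIsometryEquiv.enorm_map, enorm_sq_eq_tsum]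

open Classical in
theorem tsum_siteFun_le (b : ∀ x, HilbertBasis (ι x) ℂ (H x)) (x : Γ) (T : H x →L[ℂ] H x)
    (f : Rep ι) : ∑' σ, ‖siteFun b x T f σ‖ₑ ^ 2 ≤ (‖T‖ₑ * ‖f‖ₑ) ^ 2 := by
  let e := Equiv.piSplitAt x ι
  have upd : ∀ (ρ : (y : {y // y ≠ x}) → ι y) (i j : ι x),
      Function.update (e.symm (j, ρ)) x i = e.symm (i, ρ) := by
    intro ρ i j
    funext y
    by_cases hy : y = x
    · subst hy; simp [e]
    · simp [e, hy]
  have atx : ∀ (ρ : (y : {y // y ≠ x}) → ι y) (j : ι x), e.symm (j, ρ) x = j := by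
    intro ρ j; simp [e]
  have split : ∀ h : ((y : Γ) → ι y) → ℝ≥0∞, ∑' σ, h σ = ∑' ρ, ∑' j, h (e.symm (j, ρ)) := by
    intro h
    rw [← e.symm.tsum_eq h, ← ENNReal.tsum_comm, ← ENNReal.tsum_prod]
  rw [mul_pow, enorm_sq_eq_tsum f, split, split, ← ENNReal.tsum_mul_left]
  refine ENNReal.tsum_le_tsum fun ρ => ?_
  rcases isEmpty_or_nonempty (ι x) with hi | ⟨⟨i₀⟩⟩
  · simp
  have hs : ∀ j, slice b x f (e.symm (j, ρ)) = slice b x f (e.symm (i₀, ρ)) := by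
    intro j
    simp only [slice, upd]
  set u := slice b x f (e.symm (i₀, ρ)) with hu
  have h1 : ∑' j, ‖siteFun b x T f (e.symm (j, ρ))‖ₑ ^ 2 = ‖T u‖ₑ ^ 2 := by
    rw [← LinearIsometryEquiv.enorm_map (b x).repr (T u), enorm_sq_eq_tsum]
    refine tsum_congr fun j => ?_
    rw [siteFun, hs, atx, HilbertBasis.repr_apply_apply]
  have h2 : ∑' j, ‖f (e.symm (j, ρ))‖ₑ ^ 2 = ‖u‖ₑ ^ 2 := by
    rw [hu, enorm_slice_sq]
    simp only [upd]
  rw [h1, h2, ← mul_pow]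
  gcongr
  exact T.le_opENorm u

/-- The observable `T ∈ B(H x)` at the site `x`, as the operator `T ⊗ 1` on `Rep ι`:
`⟨e_σ, (T ⊗ 1) e_τ⟩` is `⟨b x (σ x), T (b x (τ x))⟩` if `σ = τ` off `x`, and `0` otherwise. -/
noncomputable def siteOp (b : ∀ x, HilbertBasis (ι x) ℂ (H x)) (x : Γ) (T : H x →L[ℂ] H x) :
    Rep ι →L[ℂ] Rep ι :=
  LinearMap.mkContinuous
    { toFun := fun f => ⟨siteFun b x T f, (memlp_two_iff _).2
        (ne_top_of_le_ne_top (by finiteness) (tsum_siteFun_le b x T f))⟩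
      map_add' := fun f g => by
        have hs : ∀ σ, slice b x (f + g) σ = slice b x f σ + slice b x g σ := by
          intro σ
          rw [slice, slice, slice, ← map_add]
          rfl
        ext σ
        change siteFun b x T (f + g) σ = siteFun b x T f σ + siteFun b x T g σ
        simp [siteFun, hs]
      map_smul' := fun c f => by
        have hs : ∀ σ, slice b x (c • f) σ = c • slice b x f σ := by
          intro σ
          rw [slice, slice, ← map_smul]
          rfl
        ext σ
        change siteFun b x T (c • f) σ = c • siteFun b x T f σ
        simp [siteFun, hs] }
    ‖T‖ (fun f => by
      have h := tsum_siteFun_le b x T f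
      have h' := enorm_sq_eq_tsum (⟨siteFun b x T f, (memlp_two_iff _).2
        (ne_top_of_le_ne_top (by finiteness) (tsum_siteFun_le b x T f))⟩ : Rep ι)
      have h2 := h'.le.trans h
      rw [ENNReal.pow_le_pow_left_iff (by norm_num)] at h2
      have h3 := ENNReal.toReal_mono (by finiteness) h2
      simpa [ENNReal.toReal_mul] using h3)

/-- The local algebra `𝒜_X = ⨂_{x ∈ X} B(H x)` (tensor product of C⋆-algebras), realised as
`𝒜_X ⊗ 1`: the C⋆-algebra generated by the one-site observables at the sites of `X`. With this
realisation `𝒜_X ⊆ 𝒜_Y` for `X ⊆ Y`. -/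
noncomputable def localAlgebra (b : ∀ x, HilbertBasis (ι x) ℂ (H x)) (X : Finset Γ) :
    StarSubalgebra ℂ (Rep ι →L[ℂ] Rep ι) :=
  (StarAlgebra.adjoin ℂ {S | ∃ x ∈ X, ∃ T : H x →L[ℂ] H x, siteOp b x T = S}).topologicalClosure

/-- The algebra `𝒜_Γ` of quasi-local observables: the norm closure of the union of the (directed
family of) local algebras. -/
noncomputable def quasiLocalAlgebra (b : ∀ x, HilbertBasis (ι x) ℂ (H x)) :
    StarSubalgebra ℂ (Rep ι →L[ℂ] Rep ι) :=
  (⨆ X : Finset Γ, localAlgebra b X).topologicalClosure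

end QuasiLocalAlgebra

section Maps

variable {K : Type*} [NormedAddCommGroup K] [InnerProductSpace ℂ K] [CompleteSpace K]

/-- The sum of a family of operators in the weak operator topology. -/
noncomputable def weakSum (T : ℕ → K →L[ℂ] K) : K →L[ℂ] K :=
  (∑' a, ContinuousLinearMapWOT.ofCLM (T a) : K →WOT[ℂ] K).toCLM

/-- The map in Lindblad form with Hamiltonian part `Φ` and dissipative terms `L a`:
`A ↦ i[Φ, A] + ∑ₐ (Lₐ* A Lₐ - ½{Lₐ* Lₐ, A})`. -/
noncomputable def lindbladMap (Φ : K →L[ℂ] K) (L : ℕ → K →L[ℂ] K) (A : K →L[ℂ] K) : K →L[ℂ] K :=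
  Complex.I • (Φ * A - A * Φ) +
    weakSum fun a => star (L a) * A * L a -
      (1 / 2 : ℂ) • (star (L a) * L a * A + A * (star (L a) * L a))

/-- The cb-norm `sup_n ‖Ψ ⊗ id_{M_n}‖` of the restriction of `Ψ` to the algebra `S` of operators;
it is `∞` if the restriction is not completely bounded. -/
noncomputable def cbNorm (S : StarSubalgebra ℂ (K →L[ℂ] K)) (Ψ : (K →L[ℂ] K) → (K →L[ℂ] K)) :
    ℝ≥0∞ :=
  ⨆ (n : ℕ) (M : CStarMatrix (Fin n) (Fin n) (K →L[ℂ] K)) (_ : ∀ i j, M i j ∈ S) (_ : ‖M‖ ≤ 1),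
    ‖M.map Ψ‖ₑ

/-- Complete positivity: for every `n`, the map `γ ⊗ id_{M_n}` sends elements of the form `M* M` of
`A ⊗ M_n` to elements of this form. -/
def IsCompletelyPositive {A : Type*} [Ring A] [StarRing A] (γ : A → A) : Prop :=
  ∀ (n : ℕ) (M : Matrix (Fin n) (Fin n) A),
    ∃ N : Matrix (Fin n) (Fin n) A, (Mᴴ * M).map γ = Nᴴ * N

/-- A strongly continuous cocycle of bounded maps `γ t s`, `0 ≤ s ≤ t`. -/
structure IsStronglyContinuousCocycle {A : Type*} [NormedAddCommGroup A] [NormedSpace ℂ A]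
    (γ : ℝ → ℝ → A →L[ℂ] A) : Prop where
  self : ∀ s, 0 ≤ s → γ s s = ContinuousLinearMap.id ℂ A
  comp : ∀ s r t, 0 ≤ s → s ≤ r → r ≤ t → (γ t r).comp (γ r s) = γ t s
  continuousOn : ∀ a : A,
    ContinuousOn (fun p : ℝ × ℝ => γ p.1 p.2 a) {p : ℝ × ℝ | 0 ≤ p.2 ∧ p.2 ≤ p.1}

end Maps

section Dynamics

universe u v w

variable {Γ : Type u} {H : Γ → Type v} [∀ x, NormedAddCommGroup (H x)]
  [∀ x, InnerProductSpace ℂ (H x)] {ι : Γ → Type w}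

/-- The conditions on the function `F` on the lattice `Γ`. -/
structure IsDecayFunction (Γ : Type u) [MetricSpace Γ] (F : ℝ≥0 → ℝ≥0) : Prop where
  antitone : Antitone F
  pos : ∀ r, 0 < F r
  sum_lt_top : ⨆ x : Γ, ∑' y : Γ, (F (nndist x y) : ℝ≥0∞) < ∞
  convolution_lt_top : ⨆ (x : Γ) (y : Γ), ∑' z : Γ,
    (F (nndist x z) : ℝ≥0∞) * (F (nndist y z) : ℝ≥0∞) / (F (nndist x y) : ℝ≥0∞) < ∞

/-- The time-dependent interactions: Hamiltonian terms `Φ(t, Z) = Φ(t, Z)* ∈ 𝒜_Z` and dissipative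
terms `L_a(t, Z) ∈ 𝒜_Z`, for every finite `Z`. There may be infinitely many `a` (if there are
finitely many, the others are `0`); the sum `∑ₐ L_a* L_a` has to converge to a bounded operator, and
the resulting map `Ψ_Z(t)` has to be a map on `𝒜_Z`. -/
structure Interaction (b : ∀ x, HilbertBasis (ι x) ℂ (H x)) where
  Φ : ℝ → Finset Γ → Rep ι →L[ℂ] Rep ι
  L : ℝ → Finset Γ → ℕ → Rep ι →L[ℂ] Rep ι
  Φ_mem : ∀ t Z, Φ t Z ∈ localAlgebra b Z
  Φ_star : ∀ t Z, star (Φ t Z) = Φ t Z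
  L_mem : ∀ t Z a, L t Z a ∈ localAlgebra b Z
  L_summable : ∀ t Z,
    Summable fun a => ContinuousLinearMapWOT.ofCLM (star (L t Z a) * L t Z a)
  map_mem : ∀ t Z, ∀ A ∈ localAlgebra b Z, lindbladMap (Φ t Z) (L t Z) A ∈ localAlgebra b Z

namespace Interaction

variable {b : ∀ x, HilbertBasis (ι x) ℂ (H x)} (D : Interaction b)

/-- The map `Ψ_Z(t)`. On `𝒜_Γ` it is `Ψ_Z(t) ⊗ id`, since observables supported off `Z` commute with
`Φ(t, Z)` and `L_a(t, Z)`. -/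
noncomputable def psi (t : ℝ) (Z : Finset Γ) : (Rep ι →L[ℂ] Rep ι) → (Rep ι →L[ℂ] Rep ι) :=
  lindbladMap (D.Φ t Z) (D.L t Z)

/-- The generator `ℒ_Λ(t) = ∑_{Z ⊆ Λ} Ψ_Z(t)`. -/
noncomputable def generator (t : ℝ) (Λ : Finset Γ) (A : Rep ι →L[ℂ] Rep ι) : Rep ι →L[ℂ] Rep ι :=
  ∑ Z ∈ Λ.powerset, D.psi t Z A

/-- For every finite `Λ`, the generator `ℒ_Λ(t)` is a bounded operator on `𝒜_Λ` and depends
continuously on `t` in the operator norm of `B(𝒜_Λ, 𝒜_Λ)`. -/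
def NormContinuous : Prop :=
  ∀ Λ : Finset Γ, ∃ 𝓛 : ℝ → localAlgebra b Λ →L[ℂ] localAlgebra b Λ,
    Continuous 𝓛 ∧
      ∀ (t : ℝ) (A : localAlgebra b Λ), (𝓛 t A : Rep ι →L[ℂ] Rep ι) = D.generator t Λ A

/-- `‖Ψ‖_{t,μ} = sup_{s ∈ [0,t]} sup_{x,y ∈ Γ} ∑_{Z ∋ x,y} ‖Ψ_Z(s)‖_cb / F_μ(d(x,y))`, where `Z` runs over
the finite subsets of `Γ` and `F_μ(r) = exp(-μ r) F(r)`. -/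
noncomputable def decayNorm [MetricSpace Γ] (F : ℝ≥0 → ℝ≥0) (t μ : ℝ) : ℝ≥0∞ :=
  ⨆ (s : ℝ) (_ : s ∈ Set.Icc 0 t) (x : Γ) (y : Γ), ∑' Z : {Z : Finset Γ // x ∈ Z ∧ y ∈ Z},
    cbNorm (localAlgebra b Z) (D.psi s Z) /
      ENNReal.ofReal (Real.exp (-μ * dist x y) * F (nndist x y))

/-- The exponential decay of the interactions, uniformly on the whole lattice. -/
def UniformDecay [MetricSpace Γ] (F : ℝ≥0 → ℝ≥0) : Prop :=
  ∃ μ : ℝ, 0 < μ ∧ ∀ t : ℝ, D.decayNorm F t μ < ∞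

/-- `g t s`, `0 ≤ s ≤ t`, are the propagators of the finite-volume dynamics `γ^Λ_{t,s}`: for every
observable `A`, `t ↦ g t s A` is the solution on `[s, ∞)` of `d/dt A(t) = ℒ_Λ(t) A(t)`, `A(s) = A`.
They are taken on all of `𝒜_Γ`, where they are `γ^Λ_{t,s} ⊗ id`. -/
structure IsFiniteVolumeDynamics (Λ : Finset Γ)
    (g : ℝ → ℝ → quasiLocalAlgebra b →L[ℂ] quasiLocalAlgebra b) : Prop where
  initial : ∀ s, 0 ≤ s → ∀ A, g s s A = A
  hasDeriv : ∀ s t, 0 ≤ s → s ≤ t → ∀ A : quasiLocalAlgebra b,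
    HasDerivWithinAt (fun r => (g r s A : Rep ι →L[ℂ] Rep ι))
      (D.generator t Λ (g t s A : Rep ι →L[ℂ] Rep ι)) (Set.Ici s) t

end Interaction

end Dynamics

end QuantumLattice

/-! Contraction. With `G = iΦ - ½ ∑ L* L` a Lindblad map reads `A ↦ G A + A G* + ∑ L* A L`. For `D =
1 + h G*` one has `D* D + h ∑ L* L = 1 + h² G G*`, so the Euler step `A + h Ψ(A)` has norm at most
`(1 + O(h²)) ‖A‖` (`norm_lindblad_step_le`). Averaging extends this to finite sums of generators
(`seminorm_add_smul_sum_le`). Without first-order growth, a Grönwall argument makes every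
finite-volume solution a contraction (`seminorm_le_gronwallBound`). Amplified by matrices, a
Lindblad map keeps its form, so the flow is completely contractive. It is also unital and preserves
adjoints, hence it is completely positive (`isCompletelyPositive_of_contractive`), and all of this
survives limits.

Locality. Let `v` be a summable weight on the lattice, at least 1 on the support of the initial
observable, and multiplied by at most `κ` when the interaction acts on it; sums of translates of
`F_μ` have this property by the convolution condition (`exists_weight`). Measure an observable by
the supremum over `Z` of `‖Ψ_Z(A)‖ / (c(Z) ∑_{z ∈ Z} v z)`, where `c(Z)` bounds `Ψ_Z`. Generators
with support disjoint from `Z` commute with `Ψ_Z` and contract; those meeting `Z` make this seminorm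
grow at rate at most `κ`. This is a Lieb–Robinson bound (`IsSolution.norm_apply_le`). By Duhamel's
principle the dynamics in `Λ ⊆ Λ'` differ by at most a constant times `∑_{w ∈ Λ' \ Λ} v w`
(`IsSolution.norm_sub_le`), a tail of a convergent series. So the propagators form a Cauchy net on
local observables, uniformly for `s ≤ t ≤ T`, and by density and contractivity on all of `𝒜_Γ`
(`exists_limit`).

From local to quasi-local. The hypotheses control `Ψ_Z` only on `𝒜_Z`. An element of `𝒜_Γ`,
compressed to finitely many configurations off `Z`, is a matrix over `𝒜_Z`, on which `Ψ_Z` acts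
entrywise; this is why the cb-norm bounds `Ψ_Z` on `𝒜_Γ` (`norm_psi_le`). -/

namespace QuantumLattice

/-! ### Grönwall's inequality for seminorms, from Euler steps. -/

section Gronwall

variable {E : Type*} [NormedAddCommGroup E] [NormedSpace ℝ E]

/-- A Grönwall estimate for a continuous seminorm `p` along a curve `x`, in terms of one-sided Euler
steps `x t + h • x' t`. -/
theorem seminorm_le_gronwallBound (p : Seminorm ℝ E) {C : ℝ} (hp : ∀ a, p a ≤ C * ‖a‖)
    {x x' : ℝ → E} {s T κ ε : ℝ}
    (hx : ∀ t, s ≤ t → HasDerivWithinAt x (x' t) (Set.Ici s) t)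
    (hstep : ∀ t, s ≤ t → t < T → ∃ c, ∀ h, 0 < h →
      p (x t + h • x' t) ≤ (1 + h * κ + h ^ 2 * c) * p (x t) + h * ε) :
    ∀ t, s ≤ t → t ≤ T → p (x t) ≤ gronwallBound (p (x s)) κ ε (t - s) := by
  have hC : ∀ a b, |p a - p b| ≤ C * ‖a - b‖ := fun a b =>
    (abs_sub_map_le_sub p a b).trans (hp _)
  have hcontp : Continuous p := by
    refine (LipschitzWith.of_dist_le_mul (K := ⟨|C|, abs_nonneg C⟩) fun a b => ?_).continuous
    rw [Real.dist_eq, dist_eq_norm]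
    exact (hC a b).trans (by gcongr; exact le_abs_self C)
  intro t hst htT
  refine le_gronwallBound_of_liminf_deriv_right_le (f := fun t => p (x t))
    (f' := fun t => κ * p (x t) + ε) (a := s) (b := T) ?_ ?_ le_rfl (fun _ _ => le_rfl) t ⟨hst, htT⟩
  · exact hcontp.comp_continuousOn fun u hu =>
      (hx u hu.1).continuousWithinAt.mono fun _ h => h.1
  · intro u hu r hr
    obtain ⟨c, hc⟩ := hstep u hu.1 hu.2
    apply Eventually.frequently
    have hd : HasDerivWithinAt x (x' u) (Set.Ioi u) u :=
      (hx u hu.1).mono fun y hy => hu.1.trans (le_of_lt hy)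
    have hslope := (hasDerivWithinAt_iff_tendsto_slope' (by simp)).1 hd
    -- The difference quotient of `p` is bounded by the error of the slope, the rate and a quadratic
    -- term. Only the rate survives as `z ↓ u`, so `c` may depend on `u` without any uniformity.
    have hlim : Tendsto (fun z => C * ‖slope x u z - x' u‖ + (κ * p (x u) + ε) +
        (z - u) * c * p (x u)) (𝓝[>] u) (𝓝 (κ * p (x u) + ε)) := by
      have h1 : Tendsto (fun z => C * ‖slope x u z - x' u‖) (𝓝[>] u) (𝓝 0) := by
        have := (tendsto_iff_norm_sub_tendsto_zero.1 hslope).const_mul C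
        simpa using this
      have h2 : Tendsto (fun z : ℝ => (z - u) * c * p (x u)) (𝓝[>] u) (𝓝 0) := by
        have : Continuous fun z : ℝ => (z - u) * c * p (x u) := by fun_prop
        have h := this.tendsto u
        simp only [sub_self, zero_mul] at h
        exact h.mono_left nhdsWithin_le_nhds
      simpa using (h1.add tendsto_const_nhds).add h2
    filter_upwards [hlim.eventually_lt_const hr, self_mem_nhdsWithin] with z hz hzu
    refine lt_of_le_of_lt ?_ hz
    have hpos : 0 < z - u := sub_pos.2 hzu
    have e1 : x z = (x u + (z - u) • x' u) + (z - u) • (slope x u z - x' u) := by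
      rw [smul_sub, sub_smul_slope]
      simp only [vsub_eq_sub]
      abel
    have e2 : p (x z) ≤ (1 + (z - u) * κ + (z - u) ^ 2 * c) * p (x u) + (z - u) * ε
        + (z - u) * (C * ‖slope x u z - x' u‖) := by
      rw [e1]
      refine (map_add_le_add p _ _).trans (add_le_add (hc _ hpos) ?_)
      rw [map_smul_eq_mul, Real.norm_of_nonneg hpos.le]
      gcongr
      exact hp _
    rw [inv_mul_le_iff₀ hpos]
    nlinarith [e2]

end Gronwall

/-! ### Euler steps of sums of generators. -/

section Averaging

variable {E : Type*} [AddCommGroup E] [Module ℝ E]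

/-- First-order growth bounds of several generators add up. -/
theorem seminorm_add_smul_sum_le {J : Type*} (p : Seminorm ℝ E) (S : Finset J) (Ψ : J → E) (a : E)
    (c : J → ℝ) (hc : ∀ j ∈ S, ∀ h : ℝ, 0 < h → p (a + h • Ψ j) ≤ (1 + h ^ 2 * c j) * p a) {h : ℝ}
    (hh : 0 < h) :
    p (a + h • ∑ j ∈ S, Ψ j) ≤ (1 + h ^ 2 * (S.card * ∑ j ∈ S, c j)) * p a := by
  rcases S.eq_empty_or_nonempty with rfl | hS
  · simp
  have hN : 0 < (S.card : ℝ) := by exact_mod_cast hS.card_pos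
  -- An Euler step of size `h` for the sum is the mean of `N` Euler steps of size `h N` for the
  -- single generators, `N = S.card`; convexity of `p` does the rest. The enlarged step produces the
  -- factor `N² / N` in the quadratic term.
  have e : a + h • ∑ j ∈ S, Ψ j = (S.card : ℝ)⁻¹ • ∑ j ∈ S, (a + (h * S.card) • Ψ j) := by
    rw [Finset.sum_add_distrib, smul_add, Finset.sum_const, ← Nat.cast_smul_eq_nsmul ℝ,
      smul_smul, inv_mul_cancel₀ hN.ne', one_smul, ← Finset.smul_sum, smul_smul]
    congr 2
    field_simp
  rw [e, map_smul_eq_mul, norm_inv, Real.norm_of_nonneg hN.le, inv_mul_le_iff₀ hN]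
  calc p (∑ j ∈ S, (a + (h * S.card) • Ψ j))
      ≤ ∑ j ∈ S, p (a + (h * S.card) • Ψ j) :=
      Finset.le_sum_of_subadditive p (map_zero p).le (map_add_le_add p) _ _
    _ ≤ ∑ j ∈ S, (1 + (h * S.card) ^ 2 * c j) * p a :=
      Finset.sum_le_sum fun j hj => hc j hj _ (by positivity)
    _ = S.card * ((1 + h ^ 2 * (S.card * ∑ j ∈ S, c j)) * p a) := by
      rw [← Finset.sum_mul, Finset.sum_add_distrib, ← Finset.mul_sum]
      simp
      ring

end Averaging

/-! ### Linear differential equations with strongly continuous generators, by the Dyson series. -/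

section LinearODE

open MeasureTheory

variable {E : Type*} [NormedAddCommGroup E] [NormedSpace ℝ E]

/-- Strong continuity handles a fixed vector; the moving part `f t - f t₀` is controlled by the
local bound on the operator norms. -/
theorem continuous_clm_apply_of_bounded {L : ℝ → E →L[ℝ] E} (hL : ∀ a, Continuous fun t => L t a)
    (hb : ∀ T, ∃ C, ∀ t ≤ T, ‖L t‖ ≤ C) {f : ℝ → E} (hf : Continuous f) :
    Continuous fun t => L t (f t) := by
  refine continuous_iff_continuousAt.2 fun t₀ => ?_
  obtain ⟨C, hC⟩ := hb (t₀ + 1)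
  have h1 : Tendsto (fun t => L t (f t - f t₀)) (𝓝 t₀) (𝓝 0) := by
    have h2 : Tendsto (fun t => C * ‖f t - f t₀‖) (𝓝 t₀) (𝓝 0) := by
      have := (tendsto_iff_norm_sub_tendsto_zero.1 (hf.tendsto t₀)).const_mul C
      simpa using this
    refine squeeze_zero_norm' ?_ h2
    filter_upwards [Iic_mem_nhds (show t₀ < t₀ + 1 by linarith)] with t ht
    exact (L t).le_of_opNorm_le (hC t ht) _
  have h3 := h1.add ((hL (f t₀)).tendsto t₀)
  simpa [ContinuousAt] using h3

/-- The terms of the Dyson series of the equation `x' = L(t) x`, `x(s) = a`. -/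
noncomputable def dysonTerm (L : ℝ → E →L[ℝ] E) (s : ℝ) (a : E) : ℕ → ℝ → E
  | 0 => fun _ => a
  | k + 1 => fun t => ∫ r in s..t, L r (dysonTerm L s a k r)

theorem continuous_dysonTerm {L : ℝ → E →L[ℝ] E} (hL : ∀ a, Continuous fun t => L t a)
    (hb : ∀ T, ∃ C, ∀ t ≤ T, ‖L t‖ ≤ C) (s : ℝ) (a : E) (k : ℕ) :
    Continuous (dysonTerm L s a k) := by
  induction k with
  | zero => exact continuous_const
  | succ k ih =>
    have := continuous_clm_apply_of_bounded hL hb ih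
    exact intervalIntegral.continuous_primitive (fun _ _ => this.intervalIntegrable _ _) s

/-- Each integration raises the power of `|t - s|` by one and divides by the new exponent. The
resulting factorial makes the series converge for all times. -/
theorem norm_dysonTerm_le {L : ℝ → E →L[ℝ] E} {s T C : ℝ} (hsT : s ≤ T)
    (hC : ∀ t ≤ T, ‖L t‖ ≤ C) (a : E) (k : ℕ) :
    ∀ t ≤ T, ‖dysonTerm L s a k t‖ ≤ C ^ k * |t - s| ^ k / k.factorial * ‖a‖ := by
  have hC0 : 0 ≤ C := (norm_nonneg _).trans (hC T le_rfl)
  induction k with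
  | zero => intro t _; simp [dysonTerm]
  | succ k ih =>
    intro t ht
    have h1 : ∀ r ∈ Set.uIoc s t, ‖L r (dysonTerm L s a k r)‖ ≤
        C ^ (k + 1) / k.factorial * ‖a‖ * |r - s| ^ k := by
      intro r hr
      have hrT : r ≤ T := hr.2.trans (max_le hsT ht)
      refine ((L r).le_of_opNorm_le_of_le (hC r hrT) (ih r hrT)).trans (le_of_eq ?_)
      ring
    rw [dysonTerm, intervalIntegral.norm_intervalIntegral_eq]
    have hint : IntegrableOn (fun r => C ^ (k + 1) / k.factorial * ‖a‖ * |r - s| ^ k)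
        (Set.uIoc s t) := by
      have : Continuous fun r => C ^ (k + 1) / k.factorial * ‖a‖ * |r - s| ^ k := by fun_prop
      exact (this.intervalIntegrable s t).def'
    refine (norm_integral_le_of_norm_le hint
      ((ae_restrict_iff' measurableSet_uIoc).2 (ae_of_all _ h1))).trans (le_of_eq ?_)
    rw [integral_const_mul, integral_pow_abs_sub_uIoc, Nat.factorial_succ]
    push_cast
    field_simp

/-- Solvability of a linear differential equation with a strongly continuous, locally bounded family
of generators. -/
theorem exists_hasDerivAt_linear [CompleteSpace E] {L : ℝ → E →L[ℝ] E}
    (hL : ∀ a, Continuous fun t => L t a) (hb : ∀ T, ∃ C, ∀ t ≤ T, ‖L t‖ ≤ C) (s : ℝ) (a : E) :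
    ∃ x : ℝ → E, x s = a ∧ ∀ t, HasDerivAt x (L t (x t)) t := by
  have hsummable : ∀ C M : ℝ, Summable fun k : ℕ => C ^ k * M ^ k / k.factorial * ‖a‖ := by
    intro C M
    simp_rw [← mul_pow]
    exact (Real.summable_pow_div_factorial _).mul_right _
  have hbd : ∀ R, ∃ C, ∀ k, ∀ t ∈ Set.Icc (s - R) (s + R),
      ‖dysonTerm L s a k t‖ ≤ C ^ k * |R| ^ k / k.factorial * ‖a‖ := by
    intro R
    obtain ⟨C, hC⟩ := hb (s + |R|)
    have hC0 : 0 ≤ C := (norm_nonneg _).trans (hC _ le_rfl)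
    refine ⟨C, fun k t ht => ?_⟩
    have htR : |t - s| ≤ |R| := by
      rw [abs_le]
      constructor <;> linarith [ht.1, ht.2, le_abs_self R]
    refine (norm_dysonTerm_le (by linarith [abs_nonneg R]) hC a k t
      (by linarith [ht.2, le_abs_self R])).trans ?_
    gcongr
  set x : ℝ → E := fun t => ∑' k, dysonTerm L s a k t with hxdef
  have hxc : Continuous x := by
    refine continuous_iff_continuousAt.2 fun t => ?_
    obtain ⟨C, hC⟩ := hbd (|t - s| + 1)
    have hmem : Set.Icc (s - (|t - s| + 1)) (s + (|t - s| + 1)) ∈ 𝓝 t :=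
      Icc_mem_nhds (by linarith [neg_abs_le (t - s)]) (by linarith [le_abs_self (t - s)])
    exact (continuousOn_tsum (fun k => (continuous_dysonTerm hL hb s a k).continuousOn)
      (hsummable C _) hC).continuousAt hmem
  have hsum : ∀ t, Summable fun k => dysonTerm L s a k t := by
    intro t
    obtain ⟨C, hC⟩ := hbd |t - s|
    refine Summable.of_norm_bounded (hsummable C _) fun k => hC k t ?_
    constructor <;> linarith [neg_abs_le (t - s), le_abs_self (t - s)]
  have hLx : Continuous fun r => L r (x r) := continuous_clm_apply_of_bounded hL hb hxc
  -- Summation of the Dyson recursion under the integral sign yields the integral equation; its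
  -- integrand is continuous, so it can be differentiated.
  have hint : ∀ t, x t = a + ∫ r in s..t, L r (x r) := by
    intro t
    obtain ⟨C, hC⟩ := hbd |t - s|
    obtain ⟨D, hD⟩ := hb (max s t)
    have hD0 : 0 ≤ D := (norm_nonneg _).trans (hD _ le_rfl)
    have hs : HasSum (fun k => ∫ r in s..t, L r (dysonTerm L s a k r))
        (∫ r in s..t, L r (x r)) := by
      refine intervalIntegral.hasSum_integral_of_dominated_convergence
        (fun k _ => D * (C ^ k * |(|t - s|)| ^ k / k.factorial * ‖a‖)) (fun k => ?_)
        (fun k => ?_) ?_ ?_ ?_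
      · exact (continuous_clm_apply_of_bounded hL hb
          (continuous_dysonTerm hL hb s a k)).aestronglyMeasurable
      · refine ae_of_all _ fun r hr => ?_
        refine (L r).le_of_opNorm_le_of_le (hD r hr.2) (hC k r ?_)
        have h1 := hr.1
        have h2 := hr.2
        rcases le_total s t with h | h
        · rw [min_eq_left h] at h1
          rw [max_eq_right h] at h2
          constructor <;> linarith [le_abs_self (t - s)]
        · rw [min_eq_right h] at h1
          rw [max_eq_left h] at h2
          constructor <;> linarith [neg_abs_le (t - s), le_abs_self (t - s)]
      · exact ae_of_all _ fun r _ => (hsummable C _).mul_left D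
      · exact intervalIntegrable_const
      · exact ae_of_all _ fun r _ => (L r).hasSum (hsum r).hasSum
    have h0 := (hsum t).tsum_eq_zero_add
    rw [hxdef]
    simp only
    rw [h0, ← hs.tsum_eq]
    rfl
  refine ⟨x, by rw [hint]; simp, fun t => ?_⟩
  have hd := (intervalIntegral.integral_hasDerivAt_right (hLx.intervalIntegrable s t)
    hLx.aestronglyMeasurable.stronglyMeasurableAtFilter hLx.continuousAt).const_add a
  exact hd.congr_of_eventuallyEq (Eventually.of_forall hint)

end LinearODE
-- Finite-volume solutions in an abstract Banach space: contraction, Lieb–Robinson bound, comparison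
-- of volumes.
section AbstractDynamics

set_option linter.unusedSectionVars false

variable {Γ E : Type*} [DecidableEq Γ] [NormedAddCommGroup E] [NormedSpace ℂ E]

/-- A time-dependent family of dissipative generators `Ψ t Z`, localised at the finite sets `Z ⊆ Γ`,
with decaying norms `c t Z`, and a dense family `𝒜 X` of sets of local observables. -/
structure IsLocalGenerator (Ψ : ℝ → Finset Γ → E →L[ℂ] E) (c : ℝ → Finset Γ → ℝ)
    (𝒜 : Finset Γ → Set E) : Prop where
  nonneg : ∀ t Z, 0 ≤ c t Z
  norm_le : ∀ t Z a, 0 ≤ t → ‖Ψ t Z a‖ ≤ c t Z * ‖a‖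
  comm : ∀ r t Y Z a, Disjoint Y Z → Ψ r Z (Ψ t Y a) = Ψ t Y (Ψ r Z a)
  vanish : ∀ t X Z a, Disjoint X Z → a ∈ 𝒜 X → Ψ t Z a = 0
  -- Dissipativity without duality or resolvents: an Euler step costs nothing at first order in `h`.
  dissipative : ∀ t Z, ∃ k, 0 ≤ k ∧
    ∀ a, ∀ h : ℝ, 0 < h → ‖a + h • Ψ t Z a‖ ≤ (1 + h ^ 2 * k) * ‖a‖
  continuousOn : ∀ (Λ : Finset Γ) a,
    ContinuousOn (fun t => (∑ Z ∈ Λ.powerset, Ψ t Z) a) (Set.Ici 0)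
  dense : ∀ a, a ∈ closure (⋃ X, 𝒜 X)
  bounded : ∀ T Z, ∃ C, ∀ t ∈ Set.Icc 0 T, c t Z ≤ C
  -- The weight plays the role of a Lieb–Robinson kernel seen from `X`: summability gives
  -- convergence in the volume, and `κ` is the rate at which the interaction spreads it.
  weight : ∀ (T : ℝ) (X : Finset Γ), ∃ (v : Γ → ℝ) (κ : ℝ),
    (∀ z, 0 < v z) ∧ Summable v ∧ (∀ x ∈ X, 1 ≤ v x) ∧ 0 ≤ κ ∧
    ∀ t ∈ Set.Icc 0 T, ∀ z, ∀ S : Finset (Finset Γ),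
      ∑ Y ∈ S with z ∈ Y, c t Y * ∑ y ∈ Y, v y ≤ κ * v z

/-- A union bound, used for the sets meeting `Z` (`W = Z`) and for the sets not contained in the
smaller volume (`W = Λ' \ Λ`). -/
theorem sum_le_sum_sum_filter_mem (S : Finset (Finset Γ)) (W : Finset Γ) (g : Finset Γ → ℝ)
    (hg : ∀ Y, 0 ≤ g Y) (hS : ∀ Y ∈ S, ∃ w ∈ W, w ∈ Y) :
    ∑ Y ∈ S, g Y ≤ ∑ w ∈ W, ∑ Y ∈ S with w ∈ Y, g Y := by
  simp_rw [Finset.sum_filter]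
  rw [Finset.sum_comm]
  refine Finset.sum_le_sum fun Y hY => ?_
  obtain ⟨w, hw, hwY⟩ := hS Y hY
  refine le_trans (by simp [hwY]) (Finset.single_le_sum (f := fun w => if w ∈ Y then g Y else 0)
    (fun w _ => ?_) hw)
  split_ifs
  · exact hg Y
  · exact le_rfl

namespace IsLocalGenerator

variable {Ψ : ℝ → Finset Γ → E →L[ℂ] E} {c : ℝ → Finset Γ → ℝ} {𝒜 : Finset Γ → Set E}

/-- A solution on `[s, ∞)` of the differential equation generated by `∑_{Z ⊆ Λ} Ψ t Z`. -/
def IsSolution (Ψ : ℝ → Finset Γ → E →L[ℂ] E) (Λ : Finset Γ) (s : ℝ) (x : ℝ → E) : Prop :=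
  ∀ t, s ≤ t → HasDerivWithinAt x ((∑ Z ∈ Λ.powerset, Ψ t Z) (x t)) (Set.Ici s) t

theorem IsSolution.mono {Λ : Finset Γ} {s r : ℝ} {x : ℝ → E} (hx : IsSolution Ψ Λ s x)
    (hsr : s ≤ r) : IsSolution Ψ Λ r x := fun t ht =>
  (hx t (hsr.trans ht)).mono (Set.Ici_subset_Ici.2 hsr)

theorem exists_norm_add_smul_sum_le (hΨ : IsLocalGenerator Ψ c 𝒜) (Λ : Finset Γ) (t : ℝ) :
    ∃ k, 0 ≤ k ∧ ∀ S ⊆ Λ.powerset, ∀ a, ∀ h : ℝ, 0 < h →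
      ‖a + h • ∑ Z ∈ S, Ψ t Z a‖ ≤ (1 + h ^ 2 * k) * ‖a‖ := by
  choose k hk0 hk using hΨ.dissipative
  refine ⟨Λ.powerset.card * ∑ Z ∈ Λ.powerset, k t Z, by
    have := Finset.sum_nonneg fun Z (_ : Z ∈ Λ.powerset) => hk0 t Z
    positivity, fun S hS a h hh => ?_⟩
  refine (seminorm_add_smul_sum_le (normSeminorm ℝ E) S (fun Z => Ψ t Z a) a (k t)
    (fun Z _ h hh => hk t Z a h hh) hh).trans ?_
  have h1 : ∑ Z ∈ S, k t Z ≤ ∑ Z ∈ Λ.powerset, k t Z :=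
    Finset.sum_le_sum_of_subset_of_nonneg hS fun Z _ _ => hk0 t Z
  have h2 : (S.card : ℝ) ≤ Λ.powerset.card := by exact_mod_cast Finset.card_le_card hS
  have h3 := Finset.sum_nonneg fun Z (_ : Z ∈ S) => hk0 t Z
  simp only [coe_normSeminorm]
  gcongr

/-- Duhamel's estimate: the homogeneous flow contracts, so the perturbation contributes at most its
size times the elapsed time. It is the Grönwall bound with rate 0. -/
theorem norm_le_of_perturbed (hΨ : IsLocalGenerator Ψ c 𝒜) {Λ : Finset Γ} {s T ε : ℝ}
    {x R : ℝ → E}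
    (hx : ∀ t, s ≤ t → HasDerivWithinAt x ((∑ Z ∈ Λ.powerset, Ψ t Z) (x t) + R t) (Set.Ici s) t)
    (hR : ∀ t, s ≤ t → t < T → ‖R t‖ ≤ ε) {t : ℝ} (hst : s ≤ t) (htT : t ≤ T) :
    ‖x t‖ ≤ ‖x s‖ + ε * (t - s) := by
  have h := seminorm_le_gronwallBound (normSeminorm ℝ E) (C := 1) (by simp) (κ := 0) (ε := ε)
    (T := T) hx (fun t hst htT => ?_) t hst htT
  · simpa [gronwallBound_K0] using h
  · obtain ⟨k, hk0, hk⟩ := hΨ.exists_norm_add_smul_sum_le Λ t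
    refine ⟨k, fun h hh => ?_⟩
    have h1 := hk _ subset_rfl (x t) h hh
    rw [smul_add, ← add_assoc]
    refine (map_add_le_add _ _ _).trans (add_le_add ?_ ?_)
    · simpa [_root_.sum_apply] using h1
    · rw [map_smul_eq_mul, Real.norm_of_nonneg hh.le]
      exact mul_le_mul_of_nonneg_left (hR t hst htT) hh.le

theorem IsSolution.norm_le (hΨ : IsLocalGenerator Ψ c 𝒜) {Λ : Finset Γ} {s : ℝ} {x : ℝ → E}
    (hx : IsSolution Ψ Λ s x) {t : ℝ} (hst : s ≤ t) : ‖x t‖ ≤ ‖x s‖ := by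
  have := hΨ.norm_le_of_perturbed (x := x) (R := 0) (ε := 0) (T := t) (Λ := Λ)
    (fun t ht => by simpa using hx t ht) (by simp) hst le_rfl
  simpa using this

theorem IsSolution.add {Λ : Finset Γ} {s : ℝ} {x y : ℝ → E} (hx : IsSolution Ψ Λ s x)
    (hy : IsSolution Ψ Λ s y) : IsSolution Ψ Λ s (fun t => x t + y t) := fun t ht => by
  simpa only [map_add] using (hx t ht).fun_add (hy t ht)

theorem IsSolution.sub {Λ : Finset Γ} {s : ℝ} {x y : ℝ → E} (hx : IsSolution Ψ Λ s x)
    (hy : IsSolution Ψ Λ s y) : IsSolution Ψ Λ s (fun t => x t - y t) := fun t ht => by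
  simpa only [map_sub] using (hx t ht).fun_sub (hy t ht)

theorem IsSolution.smul {Λ : Finset Γ} {s : ℝ} {x : ℝ → E} (k : ℂ) (hx : IsSolution Ψ Λ s x) :
    IsSolution Ψ Λ s (fun t => k • x t) := fun t ht => by
  simpa only [map_smul] using (hx t ht).fun_const_smul k

theorem IsSolution.unique (hΨ : IsLocalGenerator Ψ c 𝒜) {Λ : Finset Γ} {s : ℝ} {x y : ℝ → E}
    (hx : IsSolution Ψ Λ s x) (hy : IsSolution Ψ Λ s y) (h : x s = y s) {t : ℝ} (hst : s ≤ t) :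
    x t = y t := by
  have := IsSolution.norm_le hΨ (hx.sub hy) hst
  rw [h, sub_self, norm_zero] at this
  exact sub_eq_zero.1 (norm_le_zero_iff.1 this)

theorem exists_generator_le (hΨ : IsLocalGenerator Ψ c 𝒜) (Λ : Finset Γ) (T : ℝ) :
    ∃ C, 0 ≤ C ∧ ∀ t ∈ Set.Icc 0 T, ∀ a, ‖(∑ Z ∈ Λ.powerset, Ψ t Z) a‖ ≤ C * ‖a‖ := by
  choose C hC using hΨ.bounded T
  refine ⟨∑ Z ∈ Λ.powerset, |C Z|, Finset.sum_nonneg fun _ _ => abs_nonneg _, fun t ht a => ?_⟩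
  rw [_root_.sum_apply, Finset.sum_mul]
  refine norm_sum_le_of_le _ fun Z _ => (hΨ.norm_le t Z a ht.1).trans ?_
  gcongr
  exact (hC Z t ht).trans (le_abs_self _)

theorem exists_isSolution [CompleteSpace E] (hΨ : IsLocalGenerator Ψ c 𝒜) (Λ : Finset Γ) {s : ℝ}
    (hs : 0 ≤ s) (a : E) : ∃ x, x s = a ∧ IsSolution Ψ Λ s x := by
  -- The generator is controlled for nonnegative times only. Replacing `t` by `max t 0` freezes it
  -- before time 0 and gives a bound on all of `(-∞, T]`.
  obtain ⟨x, hxs, hx⟩ := exists_hasDerivAt_linear (E := E)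
    (L := fun t => (∑ Z ∈ Λ.powerset, Ψ (max t 0) Z).restrictScalars ℝ)
    (fun a => by
      have := (hΨ.continuousOn Λ a).comp_continuous (f := fun t : ℝ => max t 0) (by fun_prop)
        (fun t => (le_max_right t 0 : (0 : ℝ) ≤ max t 0))
      exact this)
    (fun T => by
      obtain ⟨C, hC0, hC⟩ := hΨ.exists_generator_le Λ (max T 0)
      exact ⟨C, fun t ht => ContinuousLinearMap.opNorm_le_bound _ hC0
        fun a => hC _ ⟨le_max_right _ _, max_le_max_right 0 ht⟩ a⟩) s a
  refine ⟨x, hxs, fun t ht => ?_⟩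
  have := (hx t).hasDerivWithinAt (s := Set.Ici s)
  rwa [max_eq_left (hs.trans ht)] at this

/-- A Lieb–Robinson type bound: along a finite-volume solution, the generator `Ψ r Z` stays small on
observables that are initially localised away from `Z`. -/
theorem IsSolution.norm_apply_le (hΨ : IsLocalGenerator Ψ c 𝒜) {Λ Λ' X : Finset Γ}
    (hΛ : Λ ⊆ Λ') {s T : ℝ} (hs : 0 ≤ s) {x : ℝ → E} (hx : IsSolution Ψ Λ s x) (hX : x s ∈ 𝒜 X)
    {v : Γ → ℝ} {κ : ℝ} (hv0 : ∀ z, 0 < v z) (hvX : ∀ x ∈ X, 1 ≤ v x) (hκ : 0 ≤ κ)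
    (hv : ∀ t ∈ Set.Icc 0 T, ∀ z, ∀ S : Finset (Finset Γ),
      ∑ Y ∈ S with z ∈ Y, c t Y * ∑ y ∈ Y, v y ≤ κ * v z)
    {Z : Finset Γ} (hZ : Z ⊆ Λ') {r t : ℝ} (hr : r ∈ Set.Icc 0 T) (hst : s ≤ t) (htT : t ≤ T) :
    ‖Ψ r Z (x t)‖ ≤ c r Z * (∑ z ∈ Z, v z) * (‖x s‖ * Real.exp (κ * (t - s))) := by
  set V : Finset Γ → ℝ := fun Z => ∑ z ∈ Z, v z with hV
  have hV0 : ∀ Z, 0 ≤ V Z := fun Z => Finset.sum_nonneg fun z _ => (hv0 z).le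
  have hVpos : ∀ Z : Finset Γ, Z.Nonempty → 0 < V Z := fun Z hZ =>
    Finset.sum_pos (fun z _ => hv0 z) hZ
  -- on the empty set the generator vanishes
  have hempty : ∀ t, 0 ≤ t → ∀ a, Ψ t ∅ a = 0 := by
    intro t _ a
    have hcl : IsClosed {a | Ψ t ∅ a = 0} := isClosed_eq (Ψ t ∅).continuous continuous_const
    refine closure_minimal ?_ hcl (hΨ.dense a)
    rintro a ⟨_, ⟨X, rfl⟩, ha⟩
    exact hΨ.vanish t X ∅ a (Finset.disjoint_empty_right X) ha
  -- The seminorm `p` is the supremum of `‖Ψ r Z a‖ / (c r Z * V Z)`. The time `r` ranges over `[0,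
  -- T]` independently of the running time, so that `p` is constant along the flow. Where the
  -- denominator is 0, the inverse is 0 and the term drops out; nothing is lost, since `Ψ r Z`
  -- vanishes there.
  let I := {Z : Finset Γ // Z ∈ Λ'.powerset} × Set.Icc (0 : ℝ) T
  let w : I → ℝ := fun i => c i.2 i.1 * V i.1
  have hw0 : ∀ i, 0 ≤ w i := fun i => mul_nonneg (hΨ.nonneg _ _) (hV0 _)
  let m : I → ℝ≥0 := fun i => ⟨(w i)⁻¹, inv_nonneg.2 (hw0 i)⟩
  let q : I → Seminorm ℝ E := fun i => m i •
    (normSeminorm ℝ E).comp ((Ψ i.2 i.1).restrictScalars ℝ).toLinearMap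
  have hq : ∀ i a, q i a = (w i)⁻¹ * ‖Ψ i.2 i.1 a‖ := fun i a => rfl
  -- The factor `c` cancels, which makes the bound uniform in `r`; only finitely many `Z` are left.
  have hqle : ∀ i a, q i a ≤ (∑ Z ∈ Λ'.powerset, (V Z)⁻¹) * ‖a‖ := by
    intro i a
    have h1 : (w i)⁻¹ * ‖Ψ i.2 i.1 a‖ ≤ (V i.1)⁻¹ * ‖a‖ := by
      rcases (hw0 i).eq_or_lt with h | h
      · rw [← h, inv_zero, zero_mul]
        have := hV0 i.1
        positivity
      · have hVi : 0 < V i.1 := (hV0 _).lt_of_ne fun h' => by simp [w, ← h'] at h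
        rw [inv_mul_le_iff₀ h]
        refine (hΨ.norm_le _ _ a i.2.2.1).trans (le_of_eq ?_)
        simp only [w]
        field_simp
    rw [hq]
    refine h1.trans ?_
    gcongr
    exact Finset.single_le_sum (f := fun Z => (V Z)⁻¹) (fun Z _ => inv_nonneg.2 (hV0 Z)) i.1.2
  have hbdd : BddAbove (Set.range q) := Seminorm.bddAbove_range_iff.2 fun a =>
    ⟨_, by rintro _ ⟨i, rfl⟩; exact hqle i a⟩
  let p : Seminorm ℝ E := ⨆ i, q i
  have hp : ∀ a, p a = ⨆ i, q i a := fun a => Seminorm.iSup_apply hbdd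
  have hpnn : ∀ a, 0 ≤ p a := fun a => apply_nonneg p a
  have hqp : ∀ i a, q i a ≤ p a := fun i a => by
    rw [hp]
    exact le_ciSup (f := fun i => q i a) ⟨_, by rintro _ ⟨i, rfl⟩; exact hqle i a⟩ i
  have hpC : ∀ a, p a ≤ (∑ Z ∈ Λ'.powerset, (V Z)⁻¹) * ‖a‖ := fun a => by
    rw [hp]
    refine Real.iSup_le (fun i => hqle i a) (mul_nonneg ?_ (norm_nonneg _))
    exact Finset.sum_nonneg fun Z _ => inv_nonneg.2 (hV0 Z)
  have hΨp : ∀ Z ⊆ Λ', ∀ r ∈ Set.Icc 0 T, ∀ a, ‖Ψ r Z a‖ ≤ c r Z * V Z * p a := by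
    intro Z hZ r hr a
    let i : I := (⟨Z, Finset.mem_powerset.2 hZ⟩, ⟨r, hr⟩)
    rcases (hw0 i).eq_or_lt with h | h
    · rcases Z.eq_empty_or_nonempty with rfl | hne
      · rw [hempty r hr.1, norm_zero]
        exact mul_nonneg (mul_nonneg (hΨ.nonneg _ _) (hV0 _)) (hpnn a)
      · have hc : c r Z = 0 := by
          rcases mul_eq_zero.1 h.symm with h | h
          · exact h
          · exact absurd h (hVpos Z hne).ne'
        have := hΨ.norm_le r Z a hr.1
        rw [hc, zero_mul] at this
        rw [hc, zero_mul, zero_mul]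
        exact this
    · have := hqp i a
      rwa [hq, inv_mul_le_iff₀ h] at this
  have hstep : ∀ t, s ≤ t → t < T → ∃ k, ∀ h, 0 < h →
      p (x t + h • (∑ Z ∈ Λ.powerset, Ψ t Z) (x t)) ≤
        (1 + h * κ + h ^ 2 * k) * p (x t) + h * 0 := by
    intro t hst htT
    have htI : t ∈ Set.Icc 0 T := ⟨hs.trans hst, htT.le⟩
    obtain ⟨k, hk0, hk⟩ := hΨ.exists_norm_add_smul_sum_le Λ t
    refine ⟨k, fun h hh => ?_⟩
    set a := x t
    have hRHS : 0 ≤ (1 + h * κ + h ^ 2 * k) * p a + h * 0 := by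
      have := hpnn a
      positivity
    rw [hp]
    refine Real.iSup_le (fun i => ?_) hRHS
    obtain ⟨⟨Z, hZ⟩, ⟨r, hr⟩⟩ := i
    rw [hq]
    rcases (hw0 (⟨Z, hZ⟩, ⟨r, hr⟩)).eq_or_lt with hw | hw
    · rw [← hw, inv_zero, zero_mul]
      exact hRHS
    rw [inv_mul_le_iff₀ hw]
    simp only [w] at hw ⊢
    have hZ' := Finset.mem_powerset.1 hZ
    -- The sets `Y` disjoint from `Z` can be moved outside `Ψ r Z`, where they form a contracting
    -- Euler step. Only the sets meeting `Z` contribute at first order.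
    have hsplit : Ψ r Z (a + h • (∑ Y ∈ Λ.powerset, Ψ t Y) a) =
        (Ψ r Z a + h • ∑ Y ∈ Λ.powerset with Disjoint Y Z, Ψ t Y (Ψ r Z a)) +
          h • ∑ Y ∈ Λ.powerset with ¬ Disjoint Y Z, Ψ r Z (Ψ t Y a) := by
      rw [map_add, _root_.sum_apply,
        ← Finset.sum_filter_add_sum_filter_not Λ.powerset (fun Y => Disjoint Y Z), smul_add,
        map_add, ← add_assoc]
      congr 2
      · rw [← Complex.coe_smul, map_smul, Complex.coe_smul, map_sum]
        congr 1
        exact Finset.sum_congr rfl fun Y hY => hΨ.comm r t Y Z a (Finset.mem_filter.1 hY).2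
      · rw [← Complex.coe_smul, map_smul, Complex.coe_smul, map_sum]
    rw [hsplit]
    have h1 := hk _ (Finset.filter_subset (fun Y => Disjoint Y Z) _) (Ψ r Z a) h hh
    -- Each `Ψ t Y a` is again bounded through `p`, which closes the estimate. Summing over the
    -- points of `Z` that `Y` may contain turns the weight inequality into the factor `κ * V Z`.
    have h2 : ‖∑ Y ∈ Λ.powerset with ¬ Disjoint Y Z, Ψ r Z (Ψ t Y a)‖ ≤
        c r Z * (κ * V Z * p a) := by
      calc ‖∑ Y ∈ Λ.powerset with ¬ Disjoint Y Z, Ψ r Z (Ψ t Y a)‖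
          ≤ ∑ Y ∈ Λ.powerset with ¬ Disjoint Y Z, c r Z * (c t Y * V Y * p a) := by
            refine norm_sum_le_of_le _ fun Y hY => (hΨ.norm_le r Z _ hr.1).trans ?_
            have hY' := Finset.mem_powerset.1 (Finset.mem_filter.1 hY).1
            have := hΨp Y (hY'.trans hΛ) t htI a
            have := hΨ.nonneg r Z
            gcongr
        _ = c r Z * ((∑ Y ∈ Λ.powerset with ¬ Disjoint Y Z, c t Y * V Y) * p a) := by
            rw [Finset.sum_mul, Finset.mul_sum]
        _ ≤ c r Z * (κ * V Z * p a) := by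
            have hs1 := sum_le_sum_sum_filter_mem (Λ.powerset.filter fun Y => ¬ Disjoint Y Z) Z
              (fun Y => c t Y * V Y) (fun Y => mul_nonneg (hΨ.nonneg _ _) (hV0 _))
              (fun Y hY => by
                obtain ⟨w, hw1, hw2⟩ := Finset.not_disjoint_iff.1 (Finset.mem_filter.1 hY).2
                exact ⟨w, hw2, hw1⟩)
            have hs2 := hs1.trans (Finset.sum_le_sum fun z _ => hv t htI z _)
            rw [← Finset.mul_sum] at hs2
            have := hΨ.nonneg r Z
            have := hpnn a
            gcongr
    have h3 := hΨp Z hZ' r hr a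
    calc ‖(Ψ r Z a + h • ∑ Y ∈ Λ.powerset with Disjoint Y Z, Ψ t Y (Ψ r Z a)) +
          h • ∑ Y ∈ Λ.powerset with ¬ Disjoint Y Z, Ψ r Z (Ψ t Y a)‖
        ≤ (1 + h ^ 2 * k) * (c r Z * V Z * p a) + h * (c r Z * (κ * V Z * p a)) := by
          refine (norm_add_le _ _).trans (add_le_add (h1.trans ?_) ?_)
          · gcongr
          · rw [norm_smul, Real.norm_of_nonneg hh.le]
            gcongr
      _ = _ := by ring
  have hfin := seminorm_le_gronwallBound p hpC hx hstep t hst htT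
  rw [gronwallBound_ε0] at hfin
  -- A generator away from `X` annihilates the initial observable; any other `Z` contains a point of
  -- `X`, where `v` is at least 1, so `V Z` is at least 1.
  have hinit : p (x s) ≤ ‖x s‖ := by
    rw [hp]
    refine Real.iSup_le (fun i => ?_) (norm_nonneg _)
    rw [hq]
    obtain ⟨⟨Z, hZ⟩, ⟨r, hr⟩⟩ := i
    by_cases hd : Disjoint X Z
    · rw [hΨ.vanish _ _ _ _ hd hX, norm_zero, mul_zero]
      exact norm_nonneg _
    rcases (hw0 (⟨Z, hZ⟩, ⟨r, hr⟩)).eq_or_lt with hw | hw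
    · rw [← hw, inv_zero, zero_mul]
      exact norm_nonneg _
    rw [inv_mul_le_iff₀ hw]
    refine (hΨ.norm_le _ _ _ hr.1).trans ?_
    obtain ⟨z, hzX, hzZ⟩ := Finset.not_disjoint_iff.1 hd
    have h1V : 1 ≤ V Z := (hvX z hzX).trans
      (Finset.single_le_sum (f := v) (fun z _ => (hv0 z).le) hzZ)
    have := hΨ.nonneg r Z
    simp only [w]
    calc c r Z * ‖x s‖ = c r Z * 1 * ‖x s‖ := by ring
      _ ≤ c r Z * V Z * ‖x s‖ := by gcongr
  refine (hΨp Z hZ r hr (x t)).trans ?_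
  have := hΨ.nonneg r Z
  have := hV0 Z
  gcongr
  exact hfin.trans (by gcongr)

/-- Comparison of the dynamics in two volumes `Λ ⊆ Λ'`. -/
theorem IsSolution.norm_sub_le (hΨ : IsLocalGenerator Ψ c 𝒜) {Λ Λ' X : Finset Γ}
    (hΛ : Λ ⊆ Λ') {s T : ℝ} (hs : 0 ≤ s) {x y : ℝ → E} (hx : IsSolution Ψ Λ s x)
    (hy : IsSolution Ψ Λ' s y) (hxy : x s = y s) (hX : x s ∈ 𝒜 X)
    {v : Γ → ℝ} {κ : ℝ} (hv0 : ∀ z, 0 < v z) (hvX : ∀ x ∈ X, 1 ≤ v x) (hκ : 0 ≤ κ)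
    (hv : ∀ t ∈ Set.Icc 0 T, ∀ z, ∀ S : Finset (Finset Γ),
      ∑ Y ∈ S with z ∈ Y, c t Y * ∑ y ∈ Y, v y ≤ κ * v z)
    {t : ℝ} (hst : s ≤ t) (htT : t ≤ T) :
    ‖x t - y t‖ ≤ T * κ * (‖x s‖ * Real.exp (κ * T)) * ∑ w ∈ Λ' \ Λ, v w := by
  set V : Finset Γ → ℝ := fun Z => ∑ z ∈ Z, v z with hV
  have hV0 : ∀ Z, 0 ≤ V Z := fun Z => Finset.sum_nonneg fun z _ => (hv0 z).le
  have hT : 0 ≤ T := hs.trans (hst.trans htT)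
  -- The solution in `Λ` solves the equation in `Λ'` up to the missing terms `Z ⊄ Λ`. Each of these
  -- `Z` contains a point of `Λ' \ Λ`, so the Lieb–Robinson bound makes their sum at most a multiple
  -- of the weight of `Λ' \ Λ`.
  set R : ℝ → E := fun t => -∑ Z ∈ Λ'.powerset \ Λ.powerset, Ψ t Z (x t) with hRdef
  have hpow : Λ.powerset ⊆ Λ'.powerset := Finset.powerset_mono.2 hΛ
  have hd : ∀ t, s ≤ t → HasDerivWithinAt (fun t => x t - y t)
      ((∑ Z ∈ Λ'.powerset, Ψ t Z) (x t - y t) + R t) (Set.Ici s) t := by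
    intro t ht
    convert (hx t ht).fun_sub (hy t ht) using 1
    have := Finset.sum_sdiff (f := fun Z => Ψ t Z (x t)) hpow
    simp only [map_sub, _root_.sum_apply, hRdef, ← this]
    abel
  have hR : ∀ u, s ≤ u → u < T → ‖R u‖ ≤ κ * (‖x s‖ * Real.exp (κ * T)) * ∑ w ∈ Λ' \ Λ, v w := by
    intro u hsu huT
    have huI : u ∈ Set.Icc 0 T := ⟨hs.trans hsu, huT.le⟩
    rw [hRdef]
    simp only [norm_neg]
    calc ‖∑ Z ∈ Λ'.powerset \ Λ.powerset, Ψ u Z (x u)‖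
        ≤ ∑ Z ∈ Λ'.powerset \ Λ.powerset, c u Z * V Z * (‖x s‖ * Real.exp (κ * T)) := by
          refine norm_sum_le_of_le _ fun Z hZ => ?_
          have hZ' := Finset.mem_powerset.1 (Finset.mem_sdiff.1 hZ).1
          refine (IsSolution.norm_apply_le hΨ hΛ hs hx hX hv0 hvX hκ hv hZ' huI hsu huT.le).trans ?_
          have := hΨ.nonneg u Z
          have := hV0 Z
          gcongr
          linarith
      _ = (∑ Z ∈ Λ'.powerset \ Λ.powerset, c u Z * V Z) * (‖x s‖ * Real.exp (κ * T)) := by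
          rw [Finset.sum_mul]
      _ ≤ (κ * ∑ w ∈ Λ' \ Λ, v w) * (‖x s‖ * Real.exp (κ * T)) := by
          have hs1 := sum_le_sum_sum_filter_mem (Λ'.powerset \ Λ.powerset) (Λ' \ Λ)
            (fun Y => c u Y * V Y) (fun Y => mul_nonneg (hΨ.nonneg _ _) (hV0 _))
            (fun Y hY => by
              obtain ⟨h1, h2⟩ := Finset.mem_sdiff.1 hY
              rw [Finset.mem_powerset] at h1 h2
              obtain ⟨w, hwY, hwΛ⟩ := Finset.not_subset.1 h2
              exact ⟨w, Finset.mem_sdiff.2 ⟨h1 hwY, hwΛ⟩, hwY⟩)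
          have hs2 : ∑ w ∈ Λ' \ Λ, _ ≤ ∑ w ∈ Λ' \ Λ, κ * v w := Finset.sum_le_sum fun z _ =>
            hv u huI z (Λ'.powerset \ Λ.powerset)
          rw [← Finset.mul_sum] at hs2
          gcongr
          exact hs1.trans hs2
      _ = _ := by ring
  have h := hΨ.norm_le_of_perturbed hd hR hst htT
  rw [hxy, sub_self, norm_zero, zero_add] at h
  refine h.trans ?_
  have h0 : 0 ≤ ∑ w ∈ Λ' \ Λ, v w := Finset.sum_nonneg fun w _ => (hv0 w).le
  rw [show T * κ * (‖x s‖ * Real.exp (κ * T)) * ∑ w ∈ Λ' \ Λ, v w =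
    κ * (‖x s‖ * Real.exp (κ * T)) * (∑ w ∈ Λ' \ Λ, v w) * T by ring, ← hxy]
  gcongr
  linarith

end IsLocalGenerator

end AbstractDynamics
-- Propagators and their thermodynamic limit.
section AbstractLimit

set_option linter.unusedSectionVars false

variable {Γ E : Type*} [DecidableEq Γ] [NormedAddCommGroup E] [NormedSpace ℂ E]

namespace IsLocalGenerator

variable {Ψ : ℝ → Finset Γ → E →L[ℂ] E} {c : ℝ → Finset Γ → ℝ} {𝒜 : Finset Γ → Set E}

/-- `U t s`, `0 ≤ s ≤ t`, is the propagator generated by `∑_{Z ⊆ Λ} Ψ t Z`. -/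
structure IsPropagator (Ψ : ℝ → Finset Γ → E →L[ℂ] E) (Λ : Finset Γ) (U : ℝ → ℝ → E →L[ℂ] E) :
    Prop where
  initial : ∀ s, 0 ≤ s → ∀ a, U s s a = a
  isSolution : ∀ s, 0 ≤ s → ∀ a, IsSolution Ψ Λ s fun t => U t s a

theorem exists_isPropagator [CompleteSpace E] (hΨ : IsLocalGenerator Ψ c 𝒜) (Λ : Finset Γ) :
    ∃ U, IsPropagator Ψ Λ U := by
  choose! x hxs hx using fun (s : ℝ) (hs : 0 ≤ s) (a : E) => hΨ.exists_isSolution Λ hs a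
  have hU : ∀ t s, ∃ u : E →L[ℂ] E, 0 ≤ s → s ≤ t → ∀ a, u a = x s a t := by
    intro t s
    by_cases h : 0 ≤ s ∧ s ≤ t
    · obtain ⟨hs, hst⟩ := h
      refine ⟨LinearMap.mkContinuous
        { toFun := fun a => x s a t
          map_add' := fun a a' => (IsSolution.unique hΨ (hx s hs (a + a'))
            ((hx s hs a).add (hx s hs a')) (by simp only [hxs s hs]) hst)
          map_smul' := fun k a => (IsSolution.unique hΨ (hx s hs (k • a))
            ((hx s hs a).smul k) (by simp only [hxs s hs]) hst) } 1 (fun a => ?_),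
        fun _ _ a => rfl⟩
      have := (hx s hs a).norm_le hΨ hst
      rw [hxs s hs] at this
      simpa using this
    · exact ⟨0, fun h1 h2 => absurd ⟨h1, h2⟩ h⟩
  choose U hU using hU
  refine ⟨U, fun s hs a => by rw [hU s s hs le_rfl, hxs s hs], fun s hs a t ht => ?_⟩
  have := (hx s hs a t ht).congr (f₁ := fun t => U t s a) (fun r hr => hU r s hs hr a)
    (hU t s hs ht a)
  simpa only [hU t s hs ht] using this

namespace IsPropagator

variable {Λ : Finset Γ} {U : ℝ → ℝ → E →L[ℂ] E}

theorem norm_le (hU : IsPropagator Ψ Λ U) (hΨ : IsLocalGenerator Ψ c 𝒜) {s t : ℝ} (hs : 0 ≤ s)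
    (hst : s ≤ t) (a : E) : ‖U t s a‖ ≤ ‖a‖ := by
  have := (hU.isSolution s hs a).norm_le hΨ hst
  rwa [hU.initial s hs] at this

theorem comp (hU : IsPropagator Ψ Λ U) (hΨ : IsLocalGenerator Ψ c 𝒜) {s r t : ℝ} (hs : 0 ≤ s)
    (hsr : s ≤ r) (hrt : r ≤ t) (a : E) : U t r (U r s a) = U t s a :=
  IsSolution.unique hΨ (hU.isSolution r (hs.trans hsr) (U r s a))
    ((hU.isSolution s hs a).mono hsr) (hU.initial r (hs.trans hsr) _) hrt

theorem eq (hU : IsPropagator Ψ Λ U) (hΨ : IsLocalGenerator Ψ c 𝒜) {U' : ℝ → ℝ → E →L[ℂ] E}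
    (hU' : IsPropagator Ψ Λ U') {s t : ℝ} (hs : 0 ≤ s) (hst : s ≤ t) (a : E) :
    U t s a = U' t s a :=
  IsSolution.unique hΨ (hU.isSolution s hs a) (hU'.isSolution s hs a)
    (by simp only [hU.initial s hs, hU'.initial s hs]) hst

/-- The bounded generator makes `U t s a` Lipschitz in `t`; the cocycle identity and contractivity
transfer this to `s`. The result is a joint Lipschitz bound up to time `T`. -/
theorem continuousOn (hU : IsPropagator Ψ Λ U) (hΨ : IsLocalGenerator Ψ c 𝒜) (T : ℝ) (a : E) :
    ContinuousOn (fun p : ℝ × ℝ => U p.1 p.2 a) {p | 0 ≤ p.2 ∧ p.2 ≤ p.1 ∧ p.1 ≤ T} := by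
  obtain ⟨C, hC0, hC⟩ := hΨ.exists_generator_le Λ T
  have hlip : ∀ s t t', 0 ≤ s → s ≤ t → s ≤ t' → t ≤ T → t' ≤ T → ∀ a,
      ‖U t s a - U t' s a‖ ≤ C * ‖a‖ * |t - t'| := by
    intro s t t' hs ht ht' htT htT' a
    have := Convex.norm_image_sub_le_of_norm_hasDerivWithin_le (s := Set.Icc s T)
      (f := fun t => U t s a) (C := C * ‖a‖)
      (fun r hr => ((hU.isSolution s hs a) r hr.1).mono Set.Icc_subset_Ici_self)
      (fun r hr => (hC r ⟨hs.trans hr.1, hr.2⟩ _).trans (by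
        gcongr
        exact hU.norm_le hΨ hs hr.1 a)) (convex_Icc s T) ⟨ht', htT'⟩ ⟨ht, htT⟩
    simpa using this
  have key : ∀ t s t' s', 0 ≤ s → s ≤ t → t ≤ T → s ≤ s' → s' ≤ t' → t' ≤ T →
      ‖U t s a - U t' s' a‖ ≤ C * ‖a‖ * (|t - t'| + |s - s'|) := by
    intro t s t' s' hs hst htT hss' hst' htT'
    have hs' := hs.trans hss'
    rcases le_total s' t with h | h
    · have h1 : ‖U t s a - U t s' a‖ ≤ C * ‖a‖ * |s - s'| := by
        rw [← hU.comp hΨ hs hss' h a, ← map_sub]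
        refine (hU.norm_le hΨ hs' h _).trans ?_
        have := hlip s s' s hs hss' le_rfl (h.trans htT) (hst.trans htT) a
        rwa [hU.initial s hs, abs_sub_comm] at this
      have h2 := hlip s' t t' hs' h hst' htT htT' a
      calc ‖U t s a - U t' s' a‖ ≤ ‖U t s a - U t s' a‖ + ‖U t s' a - U t' s' a‖ :=
            norm_sub_le_norm_sub_add_norm_sub _ _ _
        _ ≤ C * ‖a‖ * (|t - t'| + |s - s'|) := by linarith
    -- Here the time intervals `[s, t]` and `[s', t']` follow one another, so both values are
    -- compared with `a`, and the lengths of the intervals are at most `|s - s'|` and `|t - t'|`.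
    · have h1 : ‖U t s a - a‖ ≤ C * ‖a‖ * |s - s'| := by
        have := hlip s t s hs hst le_rfl htT (hst.trans htT) a
        rw [hU.initial s hs] at this
        refine this.trans ?_
        gcongr 1
        rw [abs_of_nonneg (by linarith), abs_of_nonpos (by linarith)]
        linarith
      have h2 : ‖a - U t' s' a‖ ≤ C * ‖a‖ * |t - t'| := by
        have := hlip s' s' t' hs' le_rfl hst' (hst'.trans htT') htT' a
        rw [hU.initial s' hs'] at this
        refine this.trans ?_
        gcongr 1
        rw [abs_of_nonpos (by linarith), abs_of_nonpos (by linarith)]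
        linarith
      calc ‖U t s a - U t' s' a‖ ≤ ‖U t s a - a‖ + ‖a - U t' s' a‖ :=
            norm_sub_le_norm_sub_add_norm_sub _ _ _
        _ ≤ C * ‖a‖ * (|t - t'| + |s - s'|) := by linarith
  have key' : ∀ p ∈ {p : ℝ × ℝ | 0 ≤ p.2 ∧ p.2 ≤ p.1 ∧ p.1 ≤ T},
      ∀ q ∈ {p : ℝ × ℝ | 0 ≤ p.2 ∧ p.2 ≤ p.1 ∧ p.1 ≤ T},
      ‖U p.1 p.2 a - U q.1 q.2 a‖ ≤ C * ‖a‖ * (|p.1 - q.1| + |p.2 - q.2|) := by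
    rintro ⟨t, s⟩ ⟨h1, h2, h3⟩ ⟨t', s'⟩ ⟨h1', h2', h3'⟩
    rcases le_total s s' with h | h
    · exact key t s t' s' h1 h2 h3 h h2' h3'
    · rw [norm_sub_rev, abs_sub_comm, abs_sub_comm (s : ℝ)]
      exact key t' s' t s h1' h2' h3' h h2 h3
  intro q hq
  rw [ContinuousWithinAt, tendsto_iff_norm_sub_tendsto_zero]
  have hlim : Tendsto (fun p : ℝ × ℝ => C * ‖a‖ * (|p.1 - q.1| + |p.2 - q.2|))
      (𝓝[{p | 0 ≤ p.2 ∧ p.2 ≤ p.1 ∧ p.1 ≤ T}] q) (𝓝 0) := by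
    have : Continuous fun p : ℝ × ℝ => C * ‖a‖ * (|p.1 - q.1| + |p.2 - q.2|) := by fun_prop
    have h := this.tendsto q
    simp only [sub_self, abs_zero, add_zero, mul_zero] at h
    exact h.mono_left nhdsWithin_le_nhds
  refine squeeze_zero' (Eventually.of_forall fun _ => norm_nonneg _) ?_ hlim
  filter_upwards [self_mem_nhdsWithin] with p hp
  exact key' p hp q hq

end IsPropagator

variable {U : Finset Γ → ℝ → ℝ → E →L[ℂ] E}

/-- `Λ₀` is chosen so that the weight outside it is at most `ε / (|M| + 1)`, with `M` the constant
of the comparison of volumes; the summand 1 avoids a division by 0. `M` depends on `T` but not on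
`s` and `t`. -/
theorem exists_forall_norm_sub_le_of_mem (hΨ : IsLocalGenerator Ψ c 𝒜)
    (hU : ∀ Λ, IsPropagator Ψ Λ (U Λ)) (T : ℝ) {X : Finset Γ} {a : E} (ha : a ∈ 𝒜 X) {ε : ℝ}
    (hε : 0 < ε) :
    ∃ Λ₀, ∀ Λ, Λ₀ ⊆ Λ → ∀ s t, 0 ≤ s → s ≤ t → t ≤ T → ‖U Λ t s a - U Λ₀ t s a‖ ≤ ε := by
  obtain ⟨v, κ, hv0, hvs, hvX, hκ, hv⟩ := hΨ.weight T X
  set M := T * κ * (‖a‖ * Real.exp (κ * T)) with hM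
  obtain ⟨Λ₀, hΛ₀⟩ := summable_iff_vanishing_norm.1 hvs (ε / (|M| + 1)) (by positivity)
  refine ⟨Λ₀, fun Λ hΛ s t hs hst htT => ?_⟩
  have h := IsSolution.norm_sub_le hΨ hΛ hs ((hU Λ₀).isSolution s hs a)
    ((hU Λ).isSolution s hs a) (by simp only [(hU _).initial s hs])
    (by rwa [(hU _).initial s hs]) hv0 hvX hκ hv hst htT
  simp only [(hU _).initial s hs] at h
  rw [norm_sub_rev]
  refine h.trans ?_
  have h1 := (hΛ₀ (Λ \ Λ₀) Finset.sdiff_disjoint).le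
  have h2 : 0 ≤ ∑ w ∈ Λ \ Λ₀, v w := Finset.sum_nonneg fun w _ => (hv0 w).le
  rw [Real.norm_of_nonneg h2] at h1
  rw [← hM]
  calc M * ∑ w ∈ Λ \ Λ₀, v w ≤ (|M| + 1) * ∑ w ∈ Λ \ Λ₀, v w := by
        gcongr
        linarith [le_abs_self M]
    _ ≤ (|M| + 1) * (ε / (|M| + 1)) := by gcongr
    _ = ε := by field_simp

theorem exists_forall_norm_sub_le (hΨ : IsLocalGenerator Ψ c 𝒜)
    (hU : ∀ Λ, IsPropagator Ψ Λ (U Λ)) (T : ℝ) (a : E) {ε : ℝ} (hε : 0 < ε) :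
    ∃ Λ₀, ∀ Λ, Λ₀ ⊆ Λ → ∀ s t, 0 ≤ s → s ≤ t → t ≤ T → ‖U Λ t s a - U Λ₀ t s a‖ ≤ ε := by
  obtain ⟨a', ⟨_, ⟨X, rfl⟩, ha'⟩, haa'⟩ := Metric.mem_closure_iff.1 (hΨ.dense a) (ε / 3)
    (by positivity)
  obtain ⟨Λ₀, hΛ₀⟩ := hΨ.exists_forall_norm_sub_le_of_mem hU T ha' (ε := ε / 3) (by positivity)
  refine ⟨Λ₀, fun Λ hΛ s t hs hst htT => ?_⟩
  have h1 := hΛ₀ Λ hΛ s t hs hst htT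
  have h2 : ∀ Λ, ‖U Λ t s a - U Λ t s a'‖ ≤ ε / 3 := fun Λ => by
    rw [← map_sub]
    refine ((hU Λ).norm_le hΨ hs hst _).trans ?_
    rw [← dist_eq_norm]
    exact haa'.le
  have e : U Λ t s a - U Λ₀ t s a = (U Λ t s a - U Λ t s a') + (U Λ t s a' - U Λ₀ t s a') -
      (U Λ₀ t s a - U Λ₀ t s a') := by abel
  rw [e]
  have h3 := h2 Λ
  have h4 := h2 Λ₀
  exact (norm_sub_le _ _).trans (by
    linarith [norm_add_le (U Λ t s a - U Λ t s a') (U Λ t s a' - U Λ₀ t s a')])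

/-- The thermodynamic limit of the finite-volume propagators. -/
theorem exists_limit [CompleteSpace E] (hΨ : IsLocalGenerator Ψ c 𝒜)
    (hU : ∀ Λ, IsPropagator Ψ Λ (U Λ)) :
    ∃ γ : ℝ → ℝ → E →L[ℂ] E, IsStronglyContinuousCocycle γ ∧
      ∀ s t, 0 ≤ s → s ≤ t → ∀ a, Tendsto (fun Λ => U Λ t s a) atTop (𝓝 (γ t s a)) := by
  have hlim : ∀ s t, 0 ≤ s → s ≤ t → ∀ a, ∃ y, Tendsto (fun Λ => U Λ t s a) atTop (𝓝 y) := by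
    intro s t hs hst a
    refine cauchySeq_tendsto_of_complete (Metric.cauchySeq_iff'.2 fun ε hε => ?_)
    obtain ⟨Λ₀, hΛ₀⟩ := hΨ.exists_forall_norm_sub_le hU t a (half_pos hε)
    refine ⟨Λ₀, fun Λ hΛ => ?_⟩
    rw [dist_eq_norm]
    exact (hΛ₀ Λ hΛ s t hs hst le_rfl).trans_lt (half_lt_self hε)
  choose! y hy using hlim
  -- Outside `0 ≤ s ≤ t` the limit is given the value 0.
  have hγ : ∀ t s, ∃ u : E →L[ℂ] E, 0 ≤ s → s ≤ t → ∀ a, u a = y s t a := by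
    intro t s
    by_cases h : 0 ≤ s ∧ s ≤ t
    · obtain ⟨hs, hst⟩ := h
      refine ⟨LinearMap.mkContinuous
        { toFun := fun a => y s t a
          map_add' := fun a a' => tendsto_nhds_unique (hy s t hs hst (a + a')) (by
            simpa only [map_add] using (hy s t hs hst a).add (hy s t hs hst a'))
          map_smul' := fun k a => tendsto_nhds_unique (hy s t hs hst (k • a)) (by
            simpa only [map_smul, RingHom.id_apply] using (hy s t hs hst a).const_smul k) } 1 (fun a => ?_),
        fun _ _ a => rfl⟩
      rw [one_mul]
      exact le_of_tendsto (hy s t hs hst a).norm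
        (Eventually.of_forall fun Λ => (hU Λ).norm_le hΨ hs hst a)
    · exact ⟨0, fun h1 h2 => absurd ⟨h1, h2⟩ h⟩
  choose γ hγ using hγ
  have hγlim : ∀ s t, 0 ≤ s → s ≤ t → ∀ a, Tendsto (fun Λ => U Λ t s a) atTop (𝓝 (γ t s a)) :=
    fun s t hs hst a => by rw [hγ t s hs hst]; exact hy s t hs hst a
  refine ⟨γ, ⟨fun s hs => ?_, fun s r t hs hsr hrt => ?_, fun a => ?_⟩, hγlim⟩
  · ext a
    refine tendsto_nhds_unique (hγlim s s hs le_rfl a) ?_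
    simp only [(hU _).initial s hs]
    exact tendsto_const_nhds
  · ext a
    have hst := hsr.trans hrt
    have hr := hs.trans hsr
    refine tendsto_nhds_unique ?_ (hγlim s t hs hst a)
    have h1 := hγlim r t hr hrt (γ r s a)
    -- In the composition both the map and its argument vary with `Λ`; contractivity absorbs the
    -- error of the argument.
    have h2 : Tendsto (fun Λ => U Λ t r (U Λ r s a - γ r s a)) atTop (𝓝 0) :=
      squeeze_zero_norm (fun Λ => (hU Λ).norm_le hΨ hr hrt _)
        (tendsto_iff_norm_sub_tendsto_zero.1 (hγlim s r hs hsr a))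
    have h3 := h1.add h2
    simp only [map_sub, add_sub_cancel, add_zero, (hU _).comp hΨ hs hsr hrt] at h3
    exact h3
  -- For bounded times the limit is uniform, so joint continuity passes to it; continuity is local,
  -- so a bound `T` slightly beyond the given time suffices.
  · have hT : ∀ T, ContinuousOn (fun p : ℝ × ℝ => γ p.1 p.2 a)
        {p | 0 ≤ p.2 ∧ p.2 ≤ p.1 ∧ p.1 ≤ T} := by
      intro T
      refine TendstoUniformlyOn.continuousOn (F := fun Λ (p : ℝ × ℝ) => U Λ p.1 p.2 a)
        (p := atTop) ?_ (Frequently.of_forall fun Λ => (hU Λ).continuousOn hΨ T a)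
      refine Metric.tendstoUniformlyOn_iff.2 fun ε hε => ?_
      obtain ⟨Λ₀, hΛ₀⟩ := hΨ.exists_forall_norm_sub_le hU T a (ε := ε / 3) (by positivity)
      filter_upwards [eventually_ge_atTop Λ₀] with Λ hΛ
      rintro ⟨t, s⟩ ⟨hs, hst, htT⟩
      have h1 := hΛ₀ Λ hΛ s t hs hst htT
      have h2 : ‖γ t s a - U Λ₀ t s a‖ ≤ ε / 3 :=
        le_of_tendsto ((hγlim s t hs hst a).sub_const _).norm
          ((eventually_ge_atTop Λ₀).mono fun Λ' hΛ' => hΛ₀ Λ' hΛ' s t hs hst htT)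
      rw [dist_eq_norm]
      have h3 := norm_sub_le (γ t s a - U Λ₀ t s a) (U Λ t s a - U Λ₀ t s a)
      rw [sub_sub_sub_cancel_right] at h3
      simp only
      linarith
    intro q hq
    refine (hT (q.1 + 1) q ⟨hq.1, hq.2, by linarith⟩).mono_of_mem_nhdsWithin ?_
    have hnear : {p : ℝ × ℝ | p.1 < q.1 + 1} ∈ 𝓝 q :=
      (isOpen_lt continuous_fst continuous_const).mem_nhds (by simp)
    filter_upwards [self_mem_nhdsWithin, mem_nhdsWithin_of_mem_nhds hnear] with p hp hp'
    exact ⟨hp.1, hp.2, le_of_lt hp'⟩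

end IsLocalGenerator

end AbstractLimit
-- Kraus sums and the second-order contraction estimate.
section Lindblad

set_option linter.unusedSectionVars false

variable {K : Type*} [NormedAddCommGroup K] [InnerProductSpace ℂ K] [CompleteSpace K]

theorem hasSum_wot_iff {T : ℕ → K →L[ℂ] K} {S : K →L[ℂ] K} :
    HasSum (fun a => ContinuousLinearMapWOT.ofCLM (T a)) (ContinuousLinearMapWOT.ofCLM S) ↔
      ∀ f g, HasSum (fun a => ⟪f, T a g⟫_ℂ) ⟪f, S g⟫_ℂ := by
  have e : ∀ (s : Finset ℕ) (f g : K),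
      ⟪f, (∑ a ∈ s, ContinuousLinearMapWOT.ofCLM (T a)) g⟫_ℂ = ∑ a ∈ s, ⟪f, T a g⟫_ℂ := by
    intro s f g
    induction s using Finset.cons_induction with
    | empty => simp
    | cons a s ha ih =>
      rw [Finset.sum_cons, Finset.sum_cons, ContinuousLinearMapWOT.add_apply, inner_add_right, ih]
      rfl
  rw [HasSum, ContinuousLinearMapWOT.tendsto_iff_forall_inner_apply_tendsto]
  simp only [e]
  exact ⟨fun h f g => h g f, fun h g f => h f g⟩

theorem weakSum_eq {T : ℕ → K →L[ℂ] K} {S : K →L[ℂ] K}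
    (h : ∀ f g, HasSum (fun a => ⟪f, T a g⟫_ℂ) ⟪f, S g⟫_ℂ) : weakSum T = S := by
  rw [weakSum, (hasSum_wot_iff.2 h).tsum_eq]

theorem hasSum_inner_weakSum {T : ℕ → K →L[ℂ] K}
    (h : Summable fun a => ContinuousLinearMapWOT.ofCLM (T a)) (f g : K) :
    HasSum (fun a => ⟪f, T a g⟫_ℂ) ⟪f, weakSum T g⟫_ℂ :=
  hasSum_wot_iff.1 h.hasSum f g

theorem ext_inner_apply {S T : K →L[ℂ] K} (h : ∀ f g, ⟪f, S g⟫_ℂ = ⟪f, T g⟫_ℂ) : S = T := by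
  ext g
  exact ext_inner_left ℂ fun f => h f g

/-- A square-summable column of operators, as an operator into a Hilbert sum. -/
theorem exists_column (T : ℕ → K →L[ℂ] K) (C : ℝ)
    (hs : ∀ f, Summable fun a => ‖T a f‖ ^ 2) (hC : ∀ f, ∑' a, ‖T a f‖ ^ 2 ≤ C ^ 2 * ‖f‖ ^ 2) :
    ∃ V : K →L[ℂ] lp (fun _ : ℕ => K) 2, ∀ f a, V f a = T a f := by
  have hm : ∀ f, Memℓp (fun a => T a f) 2 := fun f =>
    (memℓp_gen_iff (by norm_num)).2 (by simpa using hs f)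
  refine ⟨LinearMap.mkContinuous
    { toFun := fun f => (⟨fun a => T a f, hm f⟩ : lp (fun _ : ℕ => K) 2)
      map_add' := fun f g => by ext a; exact map_add (T a) f g
      map_smul' := fun c f => by ext a; exact map_smul (T a) c f } |C| (fun f => ?_), fun f a => rfl⟩
  refine le_of_sq_le_sq ?_ (by positivity)
  rw [mul_pow, sq_abs]
  refine le_trans (le_of_eq ?_) (hC f)
  have := lp.norm_rpow_eq_tsum (p := 2) (by norm_num)
    (⟨fun a => T a f, hm f⟩ : lp (fun _ : ℕ => K) 2)
  simpa using this

theorem re_inner_apply_le (V : K →L[ℂ] K) (f : K) :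
    RCLike.re ⟪f, V f⟫_ℂ ≤ ‖V‖ * ‖f‖ ^ 2 := by
  refine (RCLike.re_le_norm _).trans ((norm_inner_le_norm _ _).trans ?_)
  have := V.le_opNorm f
  nlinarith [norm_nonneg f]

/-- The operators `L a` such that `∑ₐ L_a* L_a` converges weakly to a bounded operator. -/
def IsKraus (L : ℕ → K →L[ℂ] K) : Prop :=
  Summable fun a => ContinuousLinearMapWOT.ofCLM (star (L a) * L a)

/-- The completely positive map `A ↦ ∑ₐ L_a* A L_a`. -/
noncomputable def krausMap (L : ℕ → K →L[ℂ] K) (A : K →L[ℂ] K) : K →L[ℂ] K :=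
  weakSum fun a => star (L a) * A * L a

theorem inner_star_mul_mul (B A C : K →L[ℂ] K) (f g : K) :
    ⟪f, (star B * A * C) g⟫_ℂ = ⟪B f, A (C g)⟫_ℂ := by
  rw [ContinuousLinearMap.star_eq_adjoint]
  exact ContinuousLinearMap.adjoint_inner_right B _ _

variable {L : ℕ → K →L[ℂ] K}

theorem IsKraus.hasSum_norm_sq (hL : IsKraus L) (f : K) :
    HasSum (fun a => ‖L a f‖ ^ 2) (RCLike.re ⟪f, krausMap L 1 f⟫_ℂ) := by
  have h := hasSum_inner_weakSum hL f f
  have h1 := RCLike.hasSum_re ℂ h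
  have e : krausMap L 1 = weakSum fun a => star (L a) * L a := by simp [krausMap]
  rw [e]
  convert h1 using 2 with a
  have := inner_star_mul_mul (L a) 1 (L a) f f
  rw [mul_one] at this
  rw [this, one_apply_eq_self, inner_self_eq_norm_sq]

/-- Weak convergence of `∑ L_a* L_a` makes `f ↦ (L_a f)_a` a bounded column `V` into a Hilbert sum,
and likewise `W` for `A L_a`. Then `∑ L_a* A L_a` is `V* W`, so the weak sum really converges for
every bounded `A`. -/
theorem IsKraus.hasSum_inner (hL : IsKraus L) (A : K →L[ℂ] K) (f g : K) :
    HasSum (fun a => ⟪L a f, A (L a g)⟫_ℂ) ⟪f, krausMap L A g⟫_ℂ := by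
  have hle : ∀ f, ∑' a, ‖L a f‖ ^ 2 ≤ ‖krausMap L 1‖ * ‖f‖ ^ 2 := fun f => by
    rw [(hL.hasSum_norm_sq f).tsum_eq]
    exact re_inner_apply_le _ f
  have hsq : ∀ x : ℝ, 0 ≤ x → Real.sqrt x ^ 2 = x := fun x hx => Real.sq_sqrt hx
  obtain ⟨V, hV⟩ := exists_column L (Real.sqrt ‖krausMap L 1‖)
    (fun f => (hL.hasSum_norm_sq f).summable)
    (fun f => by rw [hsq _ (norm_nonneg _)]; exact hle f)
  have hb : ∀ f a, ‖(A * L a) f‖ ^ 2 ≤ ‖A‖ ^ 2 * ‖L a f‖ ^ 2 := fun f a => by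
    rw [← mul_pow]
    gcongr
    exact A.le_opNorm _
  have hsum : ∀ f, Summable fun a => ‖(A * L a) f‖ ^ 2 := fun f =>
    Summable.of_nonneg_of_le (fun a => by positivity) (hb f)
      ((hL.hasSum_norm_sq f).summable.mul_left _)
  obtain ⟨W, hW⟩ := exists_column (fun a => A * L a) (‖A‖ * Real.sqrt ‖krausMap L 1‖) hsum
    (fun f => by
      refine ((hsum f).tsum_le_tsum (hb f) ((hL.hasSum_norm_sq f).summable.mul_left _)).trans ?_
      rw [tsum_mul_left, mul_pow, hsq _ (norm_nonneg _), mul_assoc]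
      gcongr
      exact hle f)
  have key : ∀ f g, HasSum (fun a => ⟪L a f, A (L a g)⟫_ℂ)
      ⟪f, ((ContinuousLinearMap.adjoint V).comp W) g⟫_ℂ := by
    intro f g
    rw [ContinuousLinearMap.comp_apply, ContinuousLinearMap.adjoint_inner_right]
    have := lp.hasSum_inner (𝕜 := ℂ) (V f) (W g)
    simp only [hV, hW] at this
    exact this
  have e : krausMap L A = (ContinuousLinearMap.adjoint V).comp W :=
    weakSum_eq fun f g => by simpa only [inner_star_mul_mul] using key f g
  rw [e]
  exact key f g

theorem IsKraus.krausMap_eq (hL : IsKraus L) {A B : K →L[ℂ] K}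
    (h : ∀ f g, HasSum (fun a => ⟪L a f, A (L a g)⟫_ℂ) ⟪f, B g⟫_ℂ) : krausMap L A = B :=
  ext_inner_apply fun f g => (hL.hasSum_inner A f g).unique (h f g)

theorem IsKraus.krausMap_add (hL : IsKraus L) (A B : K →L[ℂ] K) :
    krausMap L (A + B) = krausMap L A + krausMap L B :=
  hL.krausMap_eq fun f g => by
    simpa [inner_add_right] using (hL.hasSum_inner A f g).add (hL.hasSum_inner B f g)

theorem IsKraus.krausMap_smul (hL : IsKraus L) (c : ℂ) (A : K →L[ℂ] K) :
    krausMap L (c • A) = c • krausMap L A :=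
  hL.krausMap_eq fun f g => by
    simpa [inner_smul_right] using (hL.hasSum_inner A f g).mul_left c

theorem IsKraus.krausMap_star (hL : IsKraus L) (A : K →L[ℂ] K) :
    krausMap L (star A) = star (krausMap L A) :=
  hL.krausMap_eq fun f g => by
    have := (hL.hasSum_inner A g f).star
    simp only [ContinuousLinearMap.star_eq_adjoint, ContinuousLinearMap.adjoint_inner_right]
    simpa only [RCLike.star_def, inner_conj_symm] using this

theorem IsKraus.krausMap_mul (hL : IsKraus L) (A : K →L[ℂ] K) {B : K →L[ℂ] K}
    (hB : ∀ a, Commute B (L a)) : krausMap L (A * B) = krausMap L A * B :=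
  hL.krausMap_eq fun f g => by
    have e : ∀ a, B (L a g) = L a (B g) := fun a => congr($((hB a).eq) g)
    simpa only [mul_apply_eq_comp, e] using hL.hasSum_inner A f (B g)

theorem IsKraus.mul_krausMap (hL : IsKraus L) (A : K →L[ℂ] K) {B : K →L[ℂ] K}
    (hB : ∀ a, Commute B (star (L a))) : krausMap L (B * A) = B * krausMap L A := by
  have h := hL.krausMap_mul (star A) (B := star B) fun a => by
    have := (hB a).star_star
    rwa [_root_.star_star] at this
  rw [← star_mul, hL.krausMap_star, hL.krausMap_star, ← star_mul] at h
  exact star_injective h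

/-- Testing with the multiple of `T g` that has the norm of `g` turns the arithmetic mean into `‖g‖
^ 2`. Bounds by sums of squares are what Kraus sums provide. -/
theorem opNorm_le_of_inner_le {T : K →L[ℂ] K} {C : ℝ} (hC : 0 ≤ C)
    (h : ∀ f g, ‖⟪f, T g⟫_ℂ‖ ≤ C * ((‖f‖ ^ 2 + ‖g‖ ^ 2) / 2)) : ‖T‖ ≤ C := by
  refine ContinuousLinearMap.opNorm_le_bound _ hC fun g => ?_
  rcases eq_or_ne (T g) 0 with h0 | h0
  · rw [h0, norm_zero]; positivity
  have hT : 0 < ‖T g‖ := norm_pos_iff.2 h0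
  have h1 := h (((‖g‖ / ‖T g‖ : ℝ) : ℂ) • T g) g
  rw [inner_smul_left, norm_mul, norm_smul, inner_self_eq_norm_sq_to_K] at h1
  simp only [Complex.conj_ofReal, Complex.norm_real, norm_pow, norm_div, norm_norm,
    Complex.coe_algebraMap] at h1
  have e1 : ‖g‖ / ‖T g‖ * ‖T g‖ ^ 2 = ‖g‖ * ‖T g‖ := by field_simp
  have e2 : ‖g‖ / ‖T g‖ * ‖T g‖ = ‖g‖ := by field_simp
  rw [e2] at h1
  have h2 : ‖g‖ * ‖T g‖ ≤ C * ‖g‖ ^ 2 := by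
    rw [← e1]
    refine (le_of_eq ?_).trans (h1.trans (le_of_eq (by ring)))
    simp
  rcases (norm_nonneg g).eq_or_lt with hg | hg
  · have : g = 0 := norm_eq_zero.1 hg.symm
    exact absurd (by rw [this, map_zero]) h0
  · nlinarith

theorem IsKraus.norm_krausMap_le (hL : IsKraus L) (A : K →L[ℂ] K) :
    ‖krausMap L A‖ ≤ ‖krausMap L 1‖ * ‖A‖ := by
  refine opNorm_le_of_inner_le (by positivity) fun f g => ?_
  refine ((hL.hasSum_inner A f g).norm_le_of_bounded
    (((hL.hasSum_norm_sq f).add (hL.hasSum_norm_sq g)).mul_left (‖A‖ / 2)) fun a => ?_).trans ?_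
  · refine (norm_inner_le_norm _ _).trans ?_
    have h1 := A.le_opNorm (L a g)
    have h2 := mul_le_mul_of_nonneg_left h1 (norm_nonneg (L a f))
    have h3 := mul_nonneg (norm_nonneg A) (sq_nonneg (‖L a f‖ - ‖L a g‖))
    nlinarith
  · have h1 := re_inner_apply_le (krausMap L 1) f
    have h2 := re_inner_apply_le (krausMap L 1) g
    calc ‖A‖ / 2 * _ ≤ ‖A‖ / 2 * (‖krausMap L 1‖ * ‖f‖ ^ 2 + ‖krausMap L 1‖ * ‖g‖ ^ 2) := by
          gcongr
      _ = _ := by ring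

/-- Euler steps of a map in Lindblad form are contractions up to second order. -/
theorem norm_lindblad_step_le {L : ℕ → K →L[ℂ] K} {G V A X : K →L[ℂ] K}
    (hV : ∀ f, HasSum (fun a => ‖L a f‖ ^ 2) (RCLike.re ⟪f, V f⟫_ℂ))
    (hX : ∀ f g, HasSum (fun a => ⟪L a f, A (L a g)⟫_ℂ) ⟪f, X g⟫_ℂ)
    (hG : G + star G = -V) {h : ℝ} (hh : 0 < h) :
    ‖A + h • (G * A + A * star G + X)‖ ≤ (1 + h ^ 2 * (2 * ‖G‖ ^ 2)) * ‖A‖ := by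
  set D : K →L[ℂ] K := 1 + h • star G with hD
  -- This is the quadratic form of `D* D + h V = 1 + h² G G*`; the first-order terms cancel because
  -- `G + G* = -V`.
  have hDn : ∀ f, ‖D f‖ ^ 2 + h * RCLike.re ⟪f, V f⟫_ℂ ≤ (1 + h ^ 2 * ‖G‖ ^ 2) * ‖f‖ ^ 2 := by
    intro f
    have e1 : D f = f + h • star G f := by simp [hD]
    have e2 : RCLike.re ⟪f, V f⟫_ℂ = - (2 * RCLike.re ⟪f, star G f⟫_ℂ) := by
      have e : RCLike.re ⟪f, G f⟫_ℂ = RCLike.re ⟪f, star G f⟫_ℂ := by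
        rw [← ContinuousLinearMap.adjoint_inner_left G, ContinuousLinearMap.star_eq_adjoint,
          inner_re_symm]
      rw [show V = -(G + star G) by rw [hG, neg_neg], neg_apply, add_apply, inner_neg_right,
        inner_add_right, map_neg, map_add, e]
      ring
    have e3 : ‖D f‖ ^ 2 = ‖f‖ ^ 2 + 2 * (h * RCLike.re ⟪f, star G f⟫_ℂ) +
        h ^ 2 * ‖star G f‖ ^ 2 := by
      rw [e1, @norm_add_sq ℂ, norm_smul, mul_pow, Real.norm_of_nonneg hh.le, ← Complex.coe_smul,
        inner_smul_right]
      simp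
    have e4 : ‖star G f‖ ^ 2 ≤ ‖G‖ ^ 2 * ‖f‖ ^ 2 := by
      rw [← mul_pow, ← norm_star G]
      gcongr
      exact (star G).le_opNorm f
    rw [e3, e2]
    nlinarith [mul_le_mul_of_nonneg_left e4 (sq_nonneg h)]
  -- The map `A ↦ D* A D + h X` is completely positive in form, hence bounded by the size of its
  -- value at 1, which `hDn` estimates.
  have hmain : ‖star D * A * D + h • X‖ ≤ (1 + h ^ 2 * ‖G‖ ^ 2) * ‖A‖ := by
    refine opNorm_le_of_inner_le (by positivity) fun f g => ?_
    have h1 : ‖⟪f, X g⟫_ℂ‖ ≤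
        ‖A‖ / 2 * (RCLike.re ⟪f, V f⟫_ℂ + RCLike.re ⟪g, V g⟫_ℂ) := by
      refine (hX f g).norm_le_of_bounded (((hV f).add (hV g)).mul_left (‖A‖ / 2)) fun a => ?_
      refine (norm_inner_le_norm _ _).trans ?_
      have h1 := A.le_opNorm (L a g)
      have h2 := mul_le_mul_of_nonneg_left h1 (norm_nonneg (L a f))
      have h3 := mul_nonneg (norm_nonneg A) (sq_nonneg (‖L a f‖ - ‖L a g‖))
      nlinarith
    have h2 : ‖⟪D f, A (D g)⟫_ℂ‖ ≤ ‖A‖ / 2 * (‖D f‖ ^ 2 + ‖D g‖ ^ 2) := by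
      refine (norm_inner_le_norm _ _).trans ?_
      have h1 := A.le_opNorm (D g)
      have h2 := mul_le_mul_of_nonneg_left h1 (norm_nonneg (D f))
      have h3 := mul_nonneg (norm_nonneg A) (sq_nonneg (‖D f‖ - ‖D g‖))
      nlinarith
    have e : ⟪f, (star D * A * D + h • X) g⟫_ℂ = ⟪D f, A (D g)⟫_ℂ + h * ⟪f, X g⟫_ℂ := by
      rw [add_apply, inner_add_right, inner_star_mul_mul, ← Complex.coe_smul h X, smul_apply,
        inner_smul_right]
    rw [e]
    refine (norm_add_le _ _).trans ?_
    rw [norm_mul, Complex.norm_real, Real.norm_of_nonneg hh.le]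
    have h3 := hDn f
    have h4 := hDn g
    have h5 : 0 ≤ ‖A‖ / 2 := by positivity
    calc ‖⟪D f, A (D g)⟫_ℂ‖ + h * ‖⟪f, X g⟫_ℂ‖
        ≤ ‖A‖ / 2 * (‖D f‖ ^ 2 + ‖D g‖ ^ 2) +
          h * (‖A‖ / 2 * (RCLike.re ⟪f, V f⟫_ℂ + RCLike.re ⟪g, V g⟫_ℂ)) := by gcongr
      _ = ‖A‖ / 2 * ((‖D f‖ ^ 2 + h * RCLike.re ⟪f, V f⟫_ℂ) +
          (‖D g‖ ^ 2 + h * RCLike.re ⟪g, V g⟫_ℂ)) := by ring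
      _ ≤ ‖A‖ / 2 * ((1 + h ^ 2 * ‖G‖ ^ 2) * ‖f‖ ^ 2 + (1 + h ^ 2 * ‖G‖ ^ 2) * ‖g‖ ^ 2) := by
          gcongr
      _ = _ := by ring
  -- Replacing the Euler step by `D* A D + h X` costs only `h² G A G*`, which accounts for the
  -- second `‖G‖ ^ 2` in the constant.
  have e : A + h • (G * A + A * star G + X) =
      (star D * A * D + h • X) - (h ^ 2) • (G * A * star G) := by
    have : star D = 1 + h • G := by simp [hD, star_smul]
    rw [this, hD]
    simp only [add_mul, mul_add, smul_mul_assoc, mul_smul_comm, one_mul, mul_one, smul_add,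
      smul_smul, ← sq]
    abel
  rw [e]
  refine (norm_sub_le _ _).trans ?_
  have h6 : ‖(h ^ 2) • (G * A * star G)‖ ≤ h ^ 2 * (‖G‖ ^ 2 * ‖A‖) := by
    rw [norm_smul, Real.norm_of_nonneg (sq_nonneg h)]
    gcongr
    refine (norm_mul_le _ _).trans ?_
    rw [norm_star]
    nlinarith [norm_mul_le G A, norm_nonneg G]
  linarith

end Lindblad
-- Algebraic properties of Lindblad maps.
section LindbladMap

set_option linter.unusedSectionVars false

variable {K : Type*} [NormedAddCommGroup K] [InnerProductSpace ℂ K] [CompleteSpace K]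
  {L : ℕ → K →L[ℂ] K} {Φ : K →L[ℂ] K}

/-- The definition takes one weak sum of the whole dissipative expression; since its three pieces
converge separately, it can be split. -/
theorem IsKraus.lindbladMap_eq (hL : IsKraus L) (A : K →L[ℂ] K) :
    lindbladMap Φ L A = Complex.I • (Φ * A - A * Φ) +
      (krausMap L A - (1 / 2 : ℂ) • (krausMap L 1 * A + A * krausMap L 1)) := by
  rw [lindbladMap]
  congr 1
  refine weakSum_eq fun f g => ?_
  have h1 := hL.hasSum_inner A f g
  have h2 := hL.hasSum_inner 1 f (A g)
  have h3 := hL.hasSum_inner 1 (star A f) g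
  have h4 := h1.sub ((h2.add h3).mul_left (1 / 2 : ℂ))
  have e1 : ∀ a, ⟪f, (star (L a) * A * L a -
      (1 / 2 : ℂ) • (star (L a) * L a * A + A * (star (L a) * L a))) g⟫_ℂ =
      ⟪L a f, A (L a g)⟫_ℂ - (1 / 2 : ℂ) * (⟪L a f, (1 : K →L[ℂ] K) (L a (A g))⟫_ℂ +
        ⟪L a (star A f), (1 : K →L[ℂ] K) (L a g)⟫_ℂ) := by
    intro a
    rw [sub_apply, smul_apply, add_apply, inner_sub_right, inner_smul_right, inner_add_right,
      inner_star_mul_mul, show star (L a) * L a * A = star (L a) * 1 * (L a * A) by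
        rw [mul_one, mul_assoc], inner_star_mul_mul,
      show A * (star (L a) * L a) = star (L a * star A) * 1 * L a by
        rw [star_mul, star_star, mul_one, mul_assoc], inner_star_mul_mul]
    rfl
  have e2 : ⟪f, (krausMap L A - (1 / 2 : ℂ) • (krausMap L 1 * A + A * krausMap L 1)) g⟫_ℂ =
      ⟪f, krausMap L A g⟫_ℂ - (1 / 2 : ℂ) * (⟪f, krausMap L 1 (A g)⟫_ℂ +
        ⟪star A f, krausMap L 1 g⟫_ℂ) := by
    rw [sub_apply, smul_apply, add_apply, inner_sub_right, inner_smul_right, inner_add_right,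
      show A * krausMap L 1 = star (star A) * krausMap L 1 * 1 by rw [star_star, mul_one],
      inner_star_mul_mul]
    rfl
  simp only [e1, e2]
  exact h4

/-- The effective non-self-adjoint Hamiltonian. -/
noncomputable def drift (Φ : K →L[ℂ] K) (L : ℕ → K →L[ℂ] K) : K →L[ℂ] K :=
  Complex.I • Φ - (1 / 2 : ℂ) • krausMap L 1

theorem IsKraus.star_krausMap_one (hL : IsKraus L) : star (krausMap L 1) = krausMap L 1 := by
  rw [← hL.krausMap_star, star_one]

theorem IsKraus.star_drift (hL : IsKraus L) (hΦ : star Φ = Φ) :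
    star (drift Φ L) = -(Complex.I • Φ) - (1 / 2 : ℂ) • krausMap L 1 := by
  rw [drift, star_sub, star_smul, star_smul, hΦ, hL.star_krausMap_one]
  simp

theorem IsKraus.drift_add_star (hL : IsKraus L) (hΦ : star Φ = Φ) :
    drift Φ L + star (drift Φ L) = -krausMap L 1 := by
  rw [hL.star_drift hΦ, drift]
  module

theorem IsKraus.lindbladMap_eq_drift (hL : IsKraus L) (hΦ : star Φ = Φ) (A : K →L[ℂ] K) :
    lindbladMap Φ L A = drift Φ L * A + A * star (drift Φ L) + krausMap L A := by
  rw [hL.lindbladMap_eq, hL.star_drift hΦ, drift]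
  simp only [sub_mul, mul_sub, mul_neg, smul_mul_assoc, mul_smul_comm, smul_sub, smul_add]
  abel

theorem IsKraus.lindbladMap_add (hL : IsKraus L) (A B : K →L[ℂ] K) :
    lindbladMap Φ L (A + B) = lindbladMap Φ L A + lindbladMap Φ L B := by
  simp only [hL.lindbladMap_eq, hL.krausMap_add, mul_add, add_mul, smul_sub, smul_add]
  abel

theorem IsKraus.lindbladMap_smul (hL : IsKraus L) (c : ℂ) (A : K →L[ℂ] K) :
    lindbladMap Φ L (c • A) = c • lindbladMap Φ L A := by
  simp only [hL.lindbladMap_eq, hL.krausMap_smul, mul_smul_comm, smul_mul_assoc]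
  module

theorem IsKraus.lindbladMap_star (hL : IsKraus L) (hΦ : star Φ = Φ) (A : K →L[ℂ] K) :
    lindbladMap Φ L (star A) = star (lindbladMap Φ L A) := by
  simp only [hL.lindbladMap_eq_drift hΦ, hL.krausMap_star, star_add, star_mul, star_star]
  abel

theorem IsKraus.lindbladMap_one (hL : IsKraus L) : lindbladMap Φ L 1 = 0 := by
  rw [hL.lindbladMap_eq, mul_one, one_mul, mul_one, one_mul]
  module

/-- An operator commuting with every `L_a` and `L_a*` also commutes with `∑ L_a* L_a`. This
right-module property, with its left counterpart, is what makes `Ψ_Z` act as `Ψ_Z ⊗ id` on the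
quasi-local algebra. -/
theorem IsKraus.lindbladMap_mul (hL : IsKraus L) (A : K →L[ℂ] K) {B : K →L[ℂ] K}
    (hΦ : Commute B Φ) (hB : ∀ a, Commute B (L a)) (hB' : ∀ a, Commute B (star (L a))) :
    lindbladMap Φ L (A * B) = lindbladMap Φ L A * B := by
  have h : krausMap L 1 * B = B * krausMap L 1 := by
    rw [← hL.krausMap_mul 1 hB, one_mul, ← hL.mul_krausMap 1 hB', mul_one]
  rw [hL.lindbladMap_eq, hL.lindbladMap_eq, hL.krausMap_mul A hB]
  simp only [add_mul, sub_mul, smul_mul_assoc, mul_assoc, h, hΦ.eq]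

theorem IsKraus.mul_lindbladMap (hL : IsKraus L) (A : K →L[ℂ] K) {B : K →L[ℂ] K}
    (hΦ : Commute B Φ) (hB : ∀ a, Commute B (L a)) (hB' : ∀ a, Commute B (star (L a))) :
    lindbladMap Φ L (B * A) = B * lindbladMap Φ L A := by
  have h : krausMap L 1 * B = B * krausMap L 1 := by
    rw [← hL.krausMap_mul 1 hB, one_mul, ← hL.mul_krausMap 1 hB', mul_one]
  rw [hL.lindbladMap_eq, hL.lindbladMap_eq, hL.mul_krausMap A hB']
  simp only [mul_add, mul_sub, mul_smul_comm, ← mul_assoc, ← h, ← hΦ.eq]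

theorem IsKraus.exists_norm_lindbladMap_le (hL : IsKraus L) (Φ : K →L[ℂ] K) :
    ∃ C, ∀ A, ‖lindbladMap Φ L A‖ ≤ C * ‖A‖ := by
  refine ⟨2 * ‖Φ‖ + 2 * ‖krausMap L 1‖, fun A => ?_⟩
  rw [hL.lindbladMap_eq]
  have h1 := norm_mul_le Φ A
  have h2 := norm_mul_le A Φ
  have h3 := norm_mul_le (krausMap L 1) A
  have h4 := norm_mul_le A (krausMap L 1)
  have h5 := hL.norm_krausMap_le A
  have h6 : ‖Complex.I • (Φ * A - A * Φ)‖ ≤ ‖Φ * A‖ + ‖A * Φ‖ := by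
    rw [norm_smul, Complex.norm_I, one_mul]
    exact norm_sub_le _ _
  have h7 : ‖(1 / 2 : ℂ) • (krausMap L 1 * A + A * krausMap L 1)‖ ≤
      (1 / 2) * (‖krausMap L 1 * A‖ + ‖A * krausMap L 1‖) := by
    rw [norm_smul]
    gcongr
    · simp
    · exact norm_add_le _ _
  have h8 := norm_sub_le (krausMap L A) ((1 / 2 : ℂ) • (krausMap L 1 * A + A * krausMap L 1))
  refine (norm_add_le _ _).trans ?_
  nlinarith

/-- A map in Lindblad form, as a bounded operator. -/
noncomputable def IsKraus.lindbladCLM (hL : IsKraus L) (Φ : K →L[ℂ] K) :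
    (K →L[ℂ] K) →L[ℂ] (K →L[ℂ] K) :=
  LinearMap.mkContinuousOfExistsBound
    { toFun := lindbladMap Φ L
      map_add' := hL.lindbladMap_add
      map_smul' := hL.lindbladMap_smul } (hL.exists_norm_lindbladMap_le Φ)

end LindbladMap

/-! ### Matrix amplifications of Lindblad maps. -/

section Amplification

set_option linter.unusedSectionVars false

variable {K : Type*} [NormedAddCommGroup K] [InnerProductSpace ℂ K] [CompleteSpace K]
  {n : Type*} [Fintype n]

/-- A matrix of operators on `K`, as an operator on `K ⊗ ℂⁿ`. -/
noncomputable def matOpFun (M : Matrix n n (K →L[ℂ] K)) :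
    PiLp 2 (fun _ : n => K) →L[ℂ] PiLp 2 (fun _ : n => K) :=
  (PiLp.continuousLinearEquiv 2 ℂ fun _ : n => K).symm.toContinuousLinearMap ∘L
    (ContinuousLinearMap.pi fun i => ∑ j, (M i j) ∘L ContinuousLinearMap.proj j) ∘L
      (PiLp.continuousLinearEquiv 2 ℂ fun _ : n => K).toContinuousLinearMap

theorem matOpFun_apply (M : Matrix n n (K →L[ℂ] K)) (f : PiLp 2 fun _ : n => K) (i : n) :
    matOpFun M f i = ∑ j, M i j (f j) := by
  simp [matOpFun]

theorem inner_matOpFun (M : Matrix n n (K →L[ℂ] K)) (f g : PiLp 2 fun _ : n => K) :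
    ⟪f, matOpFun M g⟫_ℂ = ∑ i, ∑ j, ⟪f i, M i j (g j)⟫_ℂ := by
  simp [PiLp.inner_apply, matOpFun_apply, inner_sum]

theorem matOpFun_mul (M N : Matrix n n (K →L[ℂ] K)) :
    matOpFun (M * N) = matOpFun M * matOpFun N := by
  ext f i
  simp only [matOpFun_apply, mul_apply_eq_comp, Matrix.mul_apply, sum_apply, map_sum]
  exact Finset.sum_comm

theorem matOpFun_star (M : Matrix n n (K →L[ℂ] K)) : matOpFun Mᴴ = star (matOpFun M) := by
  refine ext_inner_apply fun f g => ?_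
  rw [ContinuousLinearMap.star_eq_adjoint, ContinuousLinearMap.adjoint_inner_right,
    inner_matOpFun, ← inner_conj_symm (matOpFun M f) g, inner_matOpFun]
  simp only [map_sum, inner_conj_symm, Matrix.conjTranspose_apply,
    ContinuousLinearMap.star_eq_adjoint, ContinuousLinearMap.adjoint_inner_right]
  exact Finset.sum_comm

variable (K n) in
/-- The faithful representation of matrices of operators on `K` on the space `K ⊗ ℂⁿ`. -/
noncomputable def matOp : CStarMatrix n n (K →L[ℂ] K) →⋆ₙₐ[ℂ]
    (PiLp 2 (fun _ : n => K) →L[ℂ] PiLp 2 (fun _ : n => K)) where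
  toFun M := matOpFun (CStarMatrix.ofMatrix.symm M)
  map_smul' c M := by ext f i; simp [matOpFun_apply, Finset.smul_sum]
  map_zero' := by ext f i; simp [matOpFun_apply]
  map_add' M N := by ext f i; simp [matOpFun_apply, Finset.sum_add_distrib]
  map_mul' M N := matOpFun_mul _ _
  map_star' M := matOpFun_star _

theorem matOp_apply (M : CStarMatrix n n (K →L[ℂ] K)) (f : PiLp 2 fun _ : n => K) (i : n) :
    matOp K n M f i = ∑ j, M i j (f j) := matOpFun_apply _ f i

theorem inner_matOp (M : CStarMatrix n n (K →L[ℂ] K)) (f g : PiLp 2 fun _ : n => K) :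
    ⟪f, matOp K n M g⟫_ℂ = ∑ i, ∑ j, ⟪f i, M i j (g j)⟫_ℂ := inner_matOpFun _ f g

/-- An injective star homomorphism of C⋆-algebras is isometric; vectors with a single nonzero
component detect every matrix entry. -/
theorem norm_matOp (M : CStarMatrix n n (K →L[ℂ] K)) : ‖matOp K n M‖ = ‖M‖ := by
  classical
  refine NonUnitalStarAlgHom.norm_map (matOp K n) (fun M N h => ?_) M
  refine CStarMatrix.ext fun i j => ContinuousLinearMap.ext fun v => ?_
  have := congr($h (WithLp.toLp 2 (Pi.single j v)) i)
  rw [matOp_apply, matOp_apply, Finset.sum_eq_single j, Finset.sum_eq_single j] at this <;>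
    simp_all

variable {L : ℕ → K →L[ℂ] K} {Φ : K →L[ℂ] K}

/-- The completely bounded form of the second-order contraction estimate for Euler steps. -/
theorem IsKraus.exists_norm_matrix_step_le (hL : IsKraus L) (hΦ : star Φ = Φ) :
    ∃ k, 0 ≤ k ∧ ∀ (M : CStarMatrix n n (K →L[ℂ] K)) (h : ℝ), 0 < h →
      ‖M + (h : ℂ) • M.map (lindbladMap Φ L)‖ ≤ (1 + h ^ 2 * k) * ‖M‖ := by
  classical
  -- `D B` is `B ⊗ 1`. Applying a Lindblad map entrywise gives the Lindblad map with drift `D (drift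
  -- Φ L)` and Kraus operators `D (L a)`, so the scalar estimate applies on `K ⊗ ℂⁿ`.
  let D : (K →L[ℂ] K) → CStarMatrix n n (K →L[ℂ] K) := fun B =>
    CStarMatrix.ofMatrix (Matrix.diagonal fun _ => B)
  have hDapp : ∀ B f i, matOp K n (D B) f i = B (f i) := by
    intro B f i
    rw [matOp_apply, Finset.sum_eq_single i] <;> simp +contextual [D, eq_comm]
  have hDstar : ∀ B, star (D B) = D (star B) := fun B => by
    simp only [D]
    exact Matrix.diagonal_conjTranspose _
  have hDadd : ∀ B C, D (B + C) = D B + D C := fun B C => (Matrix.diagonal_add _ _).symm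
  have hDneg : ∀ B, D (-B) = -D B := fun B => (Matrix.diagonal_neg _).symm
  refine ⟨2 * ‖matOp K n (D (drift Φ L))‖ ^ 2, by positivity, fun M h hh => ?_⟩
  have hV : ∀ f : PiLp 2 fun _ : n => K, HasSum (fun a => ‖matOp K n (D (L a)) f‖ ^ 2)
      (RCLike.re ⟪f, matOp K n (D (krausMap L 1)) f⟫_ℂ) := by
    intro f
    simp only [PiLp.inner_apply, hDapp, PiLp.norm_sq_eq_of_L2, map_sum]
    exact hasSum_sum fun i _ => hL.hasSum_norm_sq (f i)
  have hX : ∀ f g : PiLp 2 fun _ : n => K,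
      HasSum (fun a => ⟪matOp K n (D (L a)) f, matOp K n M (matOp K n (D (L a)) g)⟫_ℂ)
        ⟪f, matOp K n (M.map (krausMap L)) g⟫_ℂ := by
    intro f g
    simp only [inner_matOp, hDapp, CStarMatrix.map_apply]
    exact hasSum_sum fun i _ => hasSum_sum fun j _ => hL.hasSum_inner (M i j) (f i) (g j)
  have hG : matOp K n (D (drift Φ L)) + star (matOp K n (D (drift Φ L))) =
      -matOp K n (D (krausMap L 1)) := by
    rw [← map_star, hDstar, ← map_add, ← hDadd, hL.drift_add_star hΦ, hDneg, map_neg]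
  have := norm_lindblad_step_le hV hX hG hh
  rw [norm_matOp M] at this
  rw [← norm_matOp]
  refine (le_of_eq ?_).trans this
  congr 1
  rw [map_add, map_smul, ← map_star, hDstar, ← map_mul, ← map_mul, ← map_add, ← map_add,
    show ∀ T : PiLp 2 (fun _ : n => K) →L[ℂ] PiLp 2 (fun _ : n => K), (h : ℂ) • T = h • T from
      fun _ => rfl]
  congr 3
  refine CStarMatrix.ext fun i j => ?_
  rw [CStarMatrix.map_apply, hL.lindbladMap_eq_drift hΦ]
  simp only [CStarMatrix.add_apply, CStarMatrix.map_apply]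
  congr 2
  · exact (Matrix.diagonal_mul (fun _ => drift Φ L) (CStarMatrix.ofMatrix.symm M) i j).symm
  · exact (Matrix.mul_diagonal (fun _ => star (drift Φ L)) (CStarMatrix.ofMatrix.symm M) i j).symm

end Amplification
-- Matrix units off a set of sites, and their commutant.
section Shift

universe u w

variable {Γ : Type u} {ι : Γ → Type w}

open Classical in
/-- The configuration that is `σ` on `s` and `ρ` off `s`. -/
noncomputable def glue (s : Set Γ) (σ ρ : (y : Γ) → ι y) : (y : Γ) → ι y :=
  fun y => if y ∈ s then σ y else ρ y

theorem glue_of_mem {s : Set Γ} {y : Γ} (h : y ∈ s) (σ ρ : (y : Γ) → ι y) : glue s σ ρ y = σ y :=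
  if_pos h

theorem glue_of_notMem {s : Set Γ} {y : Γ} (h : y ∉ s) (σ ρ : (y : Γ) → ι y) :
    glue s σ ρ y = ρ y :=
  if_neg h

theorem glue_compl (s : Set Γ) (σ ρ : (y : Γ) → ι y) : glue sᶜ σ ρ = glue s ρ σ := by
  funext y
  by_cases h : y ∈ s <;> simp [glue, h]

@[simp]
theorem glue_self (s : Set Γ) (σ : (y : Γ) → ι y) : glue s σ σ = σ := by
  funext y
  by_cases h : y ∈ s <;> simp [glue, h]

@[simp]
theorem glue_glue_left (s : Set Γ) (σ ρ τ : (y : Γ) → ι y) :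
    glue s (glue s σ ρ) τ = glue s σ τ := by
  funext y
  by_cases h : y ∈ s <;> simp [glue, h]

@[simp]
theorem glue_glue_right (s : Set Γ) (σ ρ τ : (y : Γ) → ι y) :
    glue s σ (glue s ρ τ) = glue s σ τ := by
  funext y
  by_cases h : y ∈ s <;> simp [glue, h]

/-- Two configurations agree off `s`. -/
def AgreeOff (s : Set Γ) (σ ρ : (y : Γ) → ι y) : Prop := ∀ y, y ∉ s → σ y = ρ y

theorem agreeOff_iff_glue {s : Set Γ} {σ ρ : (y : Γ) → ι y} : AgreeOff s σ ρ ↔ glue s σ ρ = σ := by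
  constructor
  · intro h
    funext y
    by_cases hy : y ∈ s
    · rw [glue_of_mem hy]
    · rw [glue_of_notMem hy, h y hy]
  · intro h y hy
    rw [← h, glue_of_notMem hy]

theorem agreeOff_glue (s : Set Γ) (σ ρ : (y : Γ) → ι y) : AgreeOff s (glue s σ ρ) ρ :=
  fun _ hy => glue_of_notMem hy _ _

theorem AgreeOff.symm {s : Set Γ} {σ ρ : (y : Γ) → ι y} (h : AgreeOff s σ ρ) : AgreeOff s ρ σ :=
  fun y hy => (h y hy).symm

theorem AgreeOff.trans {s : Set Γ} {σ ρ τ : (y : Γ) → ι y} (h : AgreeOff s σ ρ)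
    (h' : AgreeOff s ρ τ) : AgreeOff s σ τ :=
  fun y hy => (h y hy).trans (h' y hy)

theorem agreeOff_refl (s : Set Γ) (σ : (y : Γ) → ι y) : AgreeOff s σ σ := fun _ _ => rfl

open Classical in
/-- The coordinates of the partial isometry `1 ⊗ |ρ⟩⟨ρ'|`, where the matrix unit acts off `s`. -/
noncomputable def shiftFun (s : Set Γ) (ρ ρ' : (y : Γ) → ι y) (f : Rep ι) (σ : (y : Γ) → ι y) : ℂ :=
  if AgreeOff s σ ρ then f (glue s σ ρ') else 0

/-- The nonzero coordinates are coordinates of `f`, each used once: a configuration that agrees with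
`ρ` off `s` is recovered from its part on `s`. -/
theorem tsum_shiftFun_le (s : Set Γ) (ρ ρ' : (y : Γ) → ι y) (f : Rep ι) :
    ∑' σ, ‖shiftFun s ρ ρ' f σ‖ₑ ^ 2 ≤ ‖f‖ₑ ^ 2 := by
  classical
  rw [enorm_sq_eq_tsum f]
  have h1 : ∑' σ, ‖shiftFun s ρ ρ' f σ‖ₑ ^ 2 =
      ∑' σ : {σ | AgreeOff s σ ρ}, ‖f (glue s σ.1 ρ')‖ₑ ^ 2 := by
    rw [tsum_subtype {σ | AgreeOff s σ ρ} (fun σ => ‖f (glue s σ ρ')‖ₑ ^ 2)]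
    refine tsum_congr fun σ => ?_
    by_cases h : AgreeOff s σ ρ <;> simp [shiftFun, h]
  rw [h1]
  refine ENNReal.tsum_comp_le_tsum_of_injective (f := fun σ : {σ | AgreeOff s σ ρ} => glue s σ.1 ρ')
    (fun σ τ h => ?_) (fun σ => ‖f σ‖ₑ ^ 2)
  apply Subtype.ext
  have h' : glue s (glue s σ.1 ρ') ρ = glue s (glue s τ.1 ρ') ρ := congrArg (fun ν => glue s ν ρ) h
  rwa [glue_glue_left, glue_glue_left, agreeOff_iff_glue.1 σ.2, agreeOff_iff_glue.1 τ.2] at h'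

theorem memlp_shiftFun (s : Set Γ) (ρ ρ' : (y : Γ) → ι y) (f : Rep ι) :
    Memℓp (shiftFun s ρ ρ' f) 2 :=
  (memlp_two_iff _).2 (ne_top_of_le_ne_top (by finiteness) (tsum_shiftFun_le s ρ ρ' f))

/-- The partial isometry `1 ⊗ |ρ⟩⟨ρ'|`, where the matrix unit acts off `s`. -/
noncomputable def shift (s : Set Γ) (ρ ρ' : (y : Γ) → ι y) : Rep ι →L[ℂ] Rep ι :=
  LinearMap.mkContinuous
    { toFun := fun f => ⟨shiftFun s ρ ρ' f, memlp_shiftFun s ρ ρ' f⟩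
      map_add' := fun f g => by
        ext σ
        change shiftFun s ρ ρ' (f + g) σ = shiftFun s ρ ρ' f σ + shiftFun s ρ ρ' g σ
        by_cases h : AgreeOff s σ ρ <;> simp [shiftFun, h]
      map_smul' := fun c f => by
        ext σ
        change shiftFun s ρ ρ' (c • f) σ = c • shiftFun s ρ ρ' f σ
        by_cases h : AgreeOff s σ ρ <;> simp [shiftFun, h] }
    1 (fun f => by
      have h := tsum_shiftFun_le s ρ ρ' f
      have h' := enorm_sq_eq_tsum (⟨shiftFun s ρ ρ' f, memlp_shiftFun s ρ ρ' f⟩ : Rep ι)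
      have h2 := h'.le.trans h
      rw [ENNReal.pow_le_pow_left_iff (by norm_num)] at h2
      have h3 := ENNReal.toReal_mono (by finiteness) h2
      simpa using h3)

open Classical in
theorem shift_apply (s : Set Γ) (ρ ρ' : (y : Γ) → ι y) (f : Rep ι) (σ : (y : Γ) → ι y) :
    shift s ρ ρ' f σ = if AgreeOff s σ ρ then f (glue s σ ρ') else 0 := rfl

theorem shift_apply_of_agreeOff {s : Set Γ} {ρ σ : (y : Γ) → ι y} (h : AgreeOff s σ ρ)
    (ρ' : (y : Γ) → ι y) (f : Rep ι) : shift s ρ ρ' f σ = f (glue s σ ρ') := if_pos h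

theorem shift_apply_of_not {s : Set Γ} {ρ σ : (y : Γ) → ι y} (h : ¬ AgreeOff s σ ρ)
    (ρ' : (y : Γ) → ι y) (f : Rep ι) : shift s ρ ρ' f σ = 0 := if_neg h

theorem norm_shift_apply_le (s : Set Γ) (ρ ρ' : (y : Γ) → ι y) (f : Rep ι) :
    ‖shift s ρ ρ' f‖ ≤ ‖f‖ := by
  have := (shift s ρ ρ').le_of_opNorm_le (LinearMap.mkContinuous_norm_le _ zero_le_one _) f
  simpa using this

theorem shift_mul_shift (s : Set Γ) (α β β' γ : (y : Γ) → ι y) (h : AgreeOff s β β') :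
    shift s α β * shift s β' γ = shift s α γ := by
  ext f σ
  rw [mul_apply_eq_comp]
  by_cases hσ : AgreeOff s σ α
  · rw [shift_apply_of_agreeOff hσ, shift_apply_of_agreeOff ((agreeOff_glue s σ β).trans h),
      shift_apply_of_agreeOff hσ, glue_glue_left]
  · rw [shift_apply_of_not hσ, shift_apply_of_not hσ]

theorem shift_mul_shift_of_not {s : Set Γ} {α β β' γ : (y : Γ) → ι y} (h : ¬ AgreeOff s β β') :
    shift s α β * shift s β' γ = 0 := by
  ext f σ
  rw [mul_apply_eq_comp]
  by_cases hσ : AgreeOff s σ α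
  · rw [shift_apply_of_agreeOff hσ, shift_apply_of_not fun h' =>
      h ((agreeOff_glue s σ β).symm.trans h')]
    rfl
  · rw [shift_apply_of_not hσ]
    rfl

/-- Either matrix unit is obtained from the other by a further contraction, so the norm depends on
the source block only. -/
theorem norm_shift_apply_eq (s : Set Γ) (α β : (y : Γ) → ι y) (f : Rep ι) :
    ‖shift s α β f‖ = ‖shift s β β f‖ := by
  apply le_antisymm
  · rw [← shift_mul_shift s α β β β (agreeOff_refl s β), mul_apply_eq_comp]
    exact norm_shift_apply_le _ _ _ _
  · rw [← shift_mul_shift s β α α β (agreeOff_refl s α), mul_apply_eq_comp]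
    exact norm_shift_apply_le _ _ _ _

open Classical in
/-- The product basis vector of a configuration. -/
noncomputable def ket (σ : (y : Γ) → ι y) : Rep ι := lp.single 2 σ 1

open Classical in
theorem ket_apply (σ τ : (y : Γ) → ι y) : ket σ τ = if τ = σ then (1 : ℂ) else 0 := by
  rw [ket, lp.single_apply, Pi.single_apply]

theorem ket_apply_self (σ : (y : Γ) → ι y) : ket σ σ = (1 : ℂ) := by simp [ket_apply]

theorem ket_apply_of_ne {σ τ : (y : Γ) → ι y} (h : τ ≠ σ) : ket σ τ = (0 : ℂ) := by
  simp [ket_apply, h]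

theorem hasSum_ket (f : Rep ι) : HasSum (fun σ => f σ • ket σ) f := by
  classical
  have := lp.hasSum_single (p := 2) (by norm_num) f
  convert this using 2 with σ
  ext τ
  rw [lp.coeFn_smul, Pi.smul_apply, lp.single_apply, Pi.single_apply, ket_apply]
  split_ifs with h <;> simp

theorem ext_ket {A B : Rep ι →L[ℂ] Rep ι} (h : ∀ σ τ, A (ket σ) τ = B (ket σ) τ) : A = B := by
  have h' : ∀ σ, A (ket σ) = B (ket σ) := fun σ => lp.ext (funext fun τ => h σ τ)
  ext1 f
  have h1 := A.hasSum (hasSum_ket f)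
  have h2 := B.hasSum (hasSum_ket f)
  simp only [map_smul, h'] at h1 h2
  exact h1.unique h2

theorem inner_ket_left (σ : (y : Γ) → ι y) (f : Rep ι) : ⟪ket σ, f⟫_ℂ = f σ := by
  classical
  rw [ket, lp.inner_single_left]
  simp

theorem star_apply_ket (A : Rep ι →L[ℂ] Rep ι) (σ τ : (y : Γ) → ι y) :
    star A (ket σ) τ = star (A (ket τ) σ) := by
  rw [← inner_ket_left, ← inner_ket_left σ, ContinuousLinearMap.star_eq_adjoint,
    ContinuousLinearMap.adjoint_inner_right, ← inner_conj_symm]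
  rfl

open Classical in
theorem shift_ket (s : Set Γ) (α β ν : (y : Γ) → ι y) :
    shift s α β (ket ν) = if AgreeOff s ν β then ket (glue s ν α) else 0 := by
  ext σ
  rw [shift_apply]
  by_cases h : AgreeOff s ν β
  · rw [if_pos h]
    by_cases hσ : AgreeOff s σ α
    · rw [if_pos hσ, ket_apply, ket_apply]
      congr 1
      refine propext ⟨fun e => ?_, fun e => ?_⟩
      · rw [← e, glue_glue_left, agreeOff_iff_glue.1 hσ]
      · rw [e, glue_glue_left, agreeOff_iff_glue.1 h]
    · rw [if_neg hσ, ket_apply_of_ne]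
      rintro rfl
      exact hσ (agreeOff_glue _ _ _)
  · rw [if_neg h]
    have : shift s α β (ket ν) σ = 0 := by
      rw [shift_apply]
      split_ifs with hσ
      · rw [ket_apply_of_ne]
        rintro rfl
        exact h (agreeOff_glue _ _ _)
      · rfl
    rw [shift_apply] at this
    exact this

theorem shift_ket_of_agreeOff {s : Set Γ} {β ν : (y : Γ) → ι y} (h : AgreeOff s ν β)
    (α : (y : Γ) → ι y) : shift s α β (ket ν) = ket (glue s ν α) := by
  rw [shift_ket, if_pos h]

theorem shift_ket_of_not {s : Set Γ} {β ν : (y : Γ) → ι y} (h : ¬ AgreeOff s ν β)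
    (α : (y : Γ) → ι y) : shift s α β (ket ν) = 0 := by
  rw [shift_ket, if_neg h]

theorem star_shift (s : Set Γ) (α β : (y : Γ) → ι y) : star (shift s α β) = shift s β α := by
  classical
  refine ext_ket fun σ τ => ?_
  rw [star_apply_ket, shift_apply, shift_apply, ket_apply, ket_apply]
  by_cases h1 : AgreeOff s σ α
  · by_cases h2 : AgreeOff s τ β
    · have : (glue s σ β = τ) ↔ (glue s τ α = σ) := by
        constructor
        · rintro rfl
          rw [glue_glue_left, agreeOff_iff_glue.1 h1]
        · rintro rfl
          rw [glue_glue_left, agreeOff_iff_glue.1 h2]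
      by_cases h3 : glue s σ β = τ
      · simp [h1, h2, h3, this.1 h3]
      · simp [h1, h2, h3, mt this.2 h3]
    · have : glue s σ β ≠ τ := by
        rintro rfl
        exact h2 (agreeOff_glue _ _ _)
      simp [h2, this]
  · by_cases h2 : AgreeOff s τ β
    · have : glue s τ α ≠ σ := by
        rintro rfl
        exact h1 (agreeOff_glue _ _ _)
      simp [h1, this]
    · simp [h1, h2]

/-- The operators that act on the sites in `s`: the commutant of the matrix units off `s`. -/
noncomputable def actingOn (ι : Γ → Type w) (s : Set Γ) : StarSubalgebra ℂ (Rep ι →L[ℂ] Rep ι) :=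
  StarSubalgebra.centralizer ℂ {S | ∃ ρ ρ', shift s ρ ρ' = S}

theorem mem_actingOn {s : Set Γ} {A : Rep ι →L[ℂ] Rep ι} :
    A ∈ actingOn ι s ↔ ∀ ρ ρ', Commute (shift s ρ ρ') A := by
  rw [actingOn, StarSubalgebra.mem_centralizer_iff]
  constructor
  · exact fun h ρ ρ' => (h _ ⟨ρ, ρ', rfl⟩).1
  · rintro h _ ⟨ρ, ρ', rfl⟩
    refine ⟨h ρ ρ', ?_⟩
    rw [star_shift]
    exact h ρ' ρ

theorem apply_shift_of_mem {s : Set Γ} {A : Rep ι →L[ℂ] Rep ι} (hA : A ∈ actingOn ι s)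
    (ρ ρ' : (y : Γ) → ι y) (f : Rep ι) : A (shift s ρ ρ' f) = shift s ρ ρ' (A f) :=
  congr($((mem_actingOn.1 hA ρ ρ').eq.symm) f)

theorem isClosed_actingOn (s : Set Γ) : IsClosed (actingOn ι s : Set (Rep ι →L[ℂ] Rep ι)) := by
  rw [actingOn, StarSubalgebra.coe_centralizer]
  exact Set.isClosed_centralizer _

/-- An operator acting on `s` maps basis vectors to vectors supported on configurations that agree
off `s`. -/
theorem apply_ket_eq_zero {s : Set Γ} {A : Rep ι →L[ℂ] Rep ι} (hA : A ∈ actingOn ι s)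
    {σ τ : (y : Γ) → ι y} (h : ¬ AgreeOff s σ τ) : A (ket τ) σ = 0 := by
  have := apply_shift_of_mem hA τ τ (ket τ)
  rw [shift_ket_of_agreeOff (agreeOff_refl s τ), glue_self] at this
  rw [this, shift_apply_of_not h]

/-- The matrix coefficients of an operator acting on `s` do not depend on the configuration off
`s`. -/
theorem apply_ket_glue {s : Set Γ} {A : Rep ι →L[ℂ] Rep ι} (hA : A ∈ actingOn ι s)
    {σ τ : (y : Γ) → ι y} (h : AgreeOff s σ τ) (ρ : (y : Γ) → ι y) :
    A (ket τ) σ = A (ket (glue s τ ρ)) (glue s σ ρ) := by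
  have h1 := apply_shift_of_mem hA τ ρ (ket (glue s τ ρ))
  rw [shift_ket_of_agreeOff (agreeOff_glue s τ ρ), glue_glue_left, glue_self] at h1
  rw [h1, shift_apply_of_agreeOff h]

/-- Operators acting on complementary sets of sites commute; a formula for their product. -/
theorem mul_apply_ket {s : Set Γ} {A B : Rep ι →L[ℂ] Rep ι} (hA : A ∈ actingOn ι s)
    (hB : B ∈ actingOn ι sᶜ) (σ τ : (y : Γ) → ι y) :
    (A * B) (ket τ) σ = B (ket τ) (glue s τ σ) * A (ket (glue s τ σ)) σ := by
  -- `B` does not change `τ` on `s`, and the projection fixes the configuration off `s` to be that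
  -- of `σ`; so a single basis vector remains.
  have h1 : shift s σ σ (B (ket τ)) = B (ket τ) (glue s τ σ) • ket (glue s τ σ) := by
    ext ν
    rw [lp.coeFn_smul, Pi.smul_apply]
    by_cases hν : AgreeOff s ν σ
    · rw [shift_apply_of_agreeOff hν, agreeOff_iff_glue.1 hν]
      by_cases hν' : AgreeOff sᶜ ν τ
      · have : ν = glue s τ σ := by
          funext y
          by_cases hy : y ∈ s
          · rw [glue_of_mem hy, hν' y (by simpa using hy)]
          · rw [glue_of_notMem hy, hν y hy]
        rw [← this, ket_apply_self, smul_eq_mul, mul_one]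
      · rw [apply_ket_eq_zero hB hν', ket_apply_of_ne, smul_zero]
        rintro rfl
        exact hν' fun y hy => glue_of_mem (by simpa using hy) _ _
    · rw [shift_apply_of_not hν, ket_apply_of_ne, smul_zero]
      rintro rfl
      exact hν (agreeOff_glue _ _ _)
  have h2 : A (B (ket τ)) σ = A (shift s σ σ (B (ket τ))) σ := by
    rw [apply_shift_of_mem hA, shift_apply_of_agreeOff (agreeOff_refl s σ), glue_self]
  rw [mul_apply_eq_comp, h2, h1, map_smul]
  rfl

/-- In either order only one intermediate configuration contributes. The two products of
coefficients agree, because a coefficient does not see the configuration off the sites where its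
operator acts. -/
theorem commute_of_mem_actingOn {s : Set Γ} {A B : Rep ι →L[ℂ] Rep ι} (hA : A ∈ actingOn ι s)
    (hB : B ∈ actingOn ι sᶜ) : Commute A B := by
  refine ext_ket fun τ σ => ?_
  have hA' : A ∈ actingOn ι sᶜᶜ := by rwa [compl_compl]
  rw [mul_apply_ket hA hB, mul_apply_ket hB hA', glue_compl, mul_comm]
  have e1 : A (ket τ) (glue s σ τ) = A (ket (glue s τ σ)) σ := by
    rw [apply_ket_glue hA (agreeOff_glue s σ τ) σ, glue_glue_left, glue_self]
  have e2 : B (ket τ) (glue s τ σ) = B (ket (glue s σ τ)) σ := by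
    have : AgreeOff sᶜ (glue s τ σ) τ := fun y hy => glue_of_mem (by simpa using hy) _ _
    rw [apply_ket_glue hB this σ, glue_compl, glue_compl, glue_glue_right, glue_self]
  rw [e1, e2]

/-- Compressing an operator acting off `s` to fixed configurations off `s` gives a multiple of a
matrix unit. -/
theorem shift_mul_mul_shift {s : Set Γ} {B : Rep ι →L[ℂ] Rep ι} (hB : B ∈ actingOn ι sᶜ)
    (ρ ρ' : (y : Γ) → ι y) :
    ∃ c : ℂ, shift s ρ ρ * B * shift s ρ' ρ' = c • shift s ρ ρ' := by
  -- The scalar is the coefficient of `B` from `ρ'` to `ρ` off `s`; its value does not depend on the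
  -- common configuration on `s`, here taken from `ρ'`.
  refine ⟨B (ket ρ') (glue s ρ' ρ), ext_ket fun ν σ => ?_⟩
  rw [mul_apply_eq_comp, mul_apply_eq_comp, smul_apply]
  by_cases hν : AgreeOff s ν ρ'
  · rw [shift_ket_of_agreeOff hν, shift_ket_of_agreeOff hν, agreeOff_iff_glue.1 hν,
      lp.coeFn_smul, Pi.smul_apply]
    by_cases hσ : AgreeOff s σ ρ
    · rw [shift_apply_of_agreeOff hσ, agreeOff_iff_glue.1 hσ]
      by_cases hσν : AgreeOff sᶜ σ ν
      · have e : σ = glue s ν ρ := by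
          funext y
          by_cases hy : y ∈ s
          · rw [glue_of_mem hy, hσν y (by simpa using hy)]
          · rw [glue_of_notMem hy, hσ y hy]
        have e3 : glue s ρ' ν = ρ' := by
          funext y
          by_cases hy : y ∈ s
          · rw [glue_of_mem hy]
          · rw [glue_of_notMem hy, hν y hy]
        have e4 : glue s ρ' σ = glue s ρ' ρ := by rw [e, glue_glue_right]
        rw [← e, ket_apply_self, smul_eq_mul, mul_one, apply_ket_glue hB hσν ρ', glue_compl,
          glue_compl, e3, e4]
      · rw [apply_ket_eq_zero hB hσν, ket_apply_of_ne, smul_zero]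
        rintro rfl
        exact hσν fun y hy => glue_of_mem (by simpa using hy) _ _
    · rw [shift_apply_of_not hσ, ket_apply_of_ne, smul_zero]
      rintro rfl
      exact hσ (agreeOff_glue _ _ _)
  · rw [shift_ket_of_not hν, shift_ket_of_not hν, map_zero, map_zero, smul_zero]

/-- The configurations that agree with `β` on `s`: labels for the configurations off `s`. -/
abbrev Boundary (s : Set Γ) (β : (y : Γ) → ι y) : Type _ := {ρ : (y : Γ) → ι y // glue s β ρ = ρ}

theorem Boundary.eq_of_agreeOff {s : Set Γ} {β : (y : Γ) → ι y} {ρ ρ' : Boundary s β}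
    (h : AgreeOff s ρ.1 ρ'.1) : ρ = ρ' := by
  apply Subtype.ext
  rw [← ρ.2, ← ρ'.2]
  funext y
  by_cases hy : y ∈ s
  · rw [glue_of_mem hy, glue_of_mem hy]
  · rw [glue_of_notMem hy, glue_of_notMem hy, h y hy]

/-- Every configuration `σ` lies in exactly one block, the one labelled `glue s β σ`; so this is
Parseval's identity for the block projections. -/
theorem tsum_enorm_shift_sq (s : Set Γ) (β : (y : Γ) → ι y) (f : Rep ι) :
    ∑' ρ : Boundary s β, ‖shift s ρ.1 ρ.1 f‖ₑ ^ 2 = ‖f‖ₑ ^ 2 := by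
  classical
  simp_rw [enorm_sq_eq_tsum]
  rw [ENNReal.tsum_comm]
  refine tsum_congr fun σ => ?_
  have hmem : glue s β (glue s β σ) = glue s β σ := glue_glue_right s β β σ
  have hag : AgreeOff s σ (glue s β σ) := (agreeOff_glue s β σ).symm
  rw [tsum_eq_single (⟨glue s β σ, hmem⟩ : Boundary s β)]
  · rw [shift_apply_of_agreeOff hag, agreeOff_iff_glue.1 hag]
  · intro ρ hρ
    rw [shift_apply_of_not]
    · simp
    · intro h
      exact hρ (Boundary.eq_of_agreeOff (h.symm.trans hag))

end Shift
-- Bounding a map by its cb-norm through block compressions.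
section Compression

universe u w

variable {Γ : Type u} {ι : Γ → Type w}

theorem sum_equivFin_symm {α N : Type*} [AddCommMonoid N] (F : Finset α) (φ : α → N) :
    ∑ k : Fin F.card, φ (F.equivFin.symm k).1 = ∑ ρ ∈ F, φ ρ := by
  rw [← Finset.sum_coe_sort F]
  exact F.equivFin.symm.sum_comp fun ρ : F => φ ρ.1

theorem enorm_piLp_sq {n E : Type*} [Fintype n] [NormedAddCommGroup E] (G : PiLp 2 fun _ : n => E) :
    ‖G‖ₑ ^ 2 = ∑ i, ‖G i‖ₑ ^ 2 := by
  simp_rw [← ofReal_norm, ← ENNReal.ofReal_pow (norm_nonneg _)]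
  rw [PiLp.norm_sq_eq_of_L2, ENNReal.ofReal_sum_of_nonneg fun _ _ => by positivity]

theorem enorm_shift_apply_eq (s : Set Γ) (α β : (y : Γ) → ι y) (f : Rep ι) :
    ‖shift s α β f‖ₑ = ‖shift s β β f‖ₑ := by
  rw [← ofReal_norm, ← ofReal_norm, norm_shift_apply_eq]

variable {s : Set Γ} {β : (y : Γ) → ι y} {n : Type*} [Fintype n]

theorem sum_enorm_shift_sq_le {r : n → Boundary s β} (hr : Function.Injective r) (f : Rep ι) :
    ∑ k, ‖shift s (r k).1 (r k).1 f‖ₑ ^ 2 ≤ ‖f‖ₑ ^ 2 := by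
  rw [← tsum_enorm_shift_sq s β f, ← tsum_fintype (L := .unconditional n)]
  exact ENNReal.tsum_comp_le_tsum_of_injective hr (fun ρ => ‖shift s ρ.1 ρ.1 f‖ₑ ^ 2)

theorem enorm_sum_sq_eq {r : n → Boundary s β} (hr : Function.Injective r) (w : n → Rep ι)
    (hw : ∀ k, shift s (r k).1 (r k).1 (w k) = w k) :
    ‖∑ k, w k‖ₑ ^ 2 = ∑ k, ‖w k‖ₑ ^ 2 := by
  classical
  have h0 : ∀ (ρ : Boundary s β) k, ρ ≠ r k → shift s ρ.1 ρ.1 (w k) = 0 := by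
    intro ρ k h
    rw [← hw, ← mul_apply_eq_comp, shift_mul_shift_of_not]
    · rfl
    · exact fun h' => h (Boundary.eq_of_agreeOff h')
  rw [← tsum_enorm_shift_sq s β, tsum_eq_sum (s := Finset.univ.image r), Finset.sum_image hr.injOn]
  · refine Finset.sum_congr rfl fun k _ => ?_
    rw [map_sum, Finset.sum_eq_single k, hw]
    · exact fun l _ hl => h0 _ _ fun h => hl (hr h.symm)
    · simp
  · intro ρ hρ
    rw [map_sum, Finset.sum_eq_zero]
    · simp
    · intro k _
      refine h0 _ _ ?_
      rintro rfl
      exact hρ (Finset.mem_image_of_mem _ (Finset.mem_univ k))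

/-- The matrix of compressions of `X` to finitely many configurations off `s` is bounded by `X`. -/
theorem norm_compression_le {r : n → Boundary s β} (hr : Function.Injective r)
    {M : CStarMatrix n n (Rep ι →L[ℂ] Rep ι)} (hM : ∀ k l, M k l ∈ actingOn ι s)
    {X : Rep ι →L[ℂ] Rep ι}
    (h : ∀ k l, shift s (r k).1 (r k).1 * X * shift s (r l).1 (r l).1 =
      M k l * shift s (r k).1 (r l).1) : ‖M‖ ≤ ‖X‖ := by
  rw [← norm_matOp]
  refine ContinuousLinearMap.opNorm_le_bound _ (norm_nonneg X) fun G => ?_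
  suffices hs : ‖matOp (Rep ι) n M G‖ₑ ^ 2 ≤ (‖X‖ₑ * ‖G‖ₑ) ^ 2 by
    rw [ENNReal.pow_le_pow_left_iff (by norm_num)] at hs
    have := ENNReal.toReal_mono (by finiteness) hs
    simpa [ENNReal.toReal_mul] using this
  -- `u ρ` moves the `ρ`-component of each `G l` into the block `r l` and adds the results up. On
  -- this vector `X` does what `M` does on the `ρ`-components of `G`.
  set u : Boundary s β → Rep ι := fun ρ => ∑ l, shift s (r l).1 ρ.1 (G l) with hu
  have h1 : ∀ (ρ : Boundary s β) k, shift s (r k).1 ρ.1 (matOp (Rep ι) n M G k) =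
      shift s (r k).1 (r k).1 (X (u ρ)) := by
    intro ρ k
    rw [matOp_apply, map_sum, hu, map_sum, map_sum]
    refine Finset.sum_congr rfl fun l _ => ?_
    rw [← apply_shift_of_mem (hM k l),
      ← shift_mul_shift s (r k).1 (r l).1 (r l).1 ρ.1 (agreeOff_refl _ _), mul_apply_eq_comp,
      ← mul_apply_eq_comp (M k l), ← h, mul_apply_eq_comp, mul_apply_eq_comp,
      ← mul_apply_eq_comp (shift s (r l).1 (r l).1), shift_mul_shift _ _ _ _ _ (agreeOff_refl _ _)]
  have h2 : ∀ ρ, ‖u ρ‖ₑ ^ 2 = ∑ l, ‖shift s ρ.1 ρ.1 (G l)‖ₑ ^ 2 := by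
    intro ρ
    rw [hu, enorm_sum_sq_eq hr]
    · exact Finset.sum_congr rfl fun l _ => by rw [enorm_shift_apply_eq]
    · intro l
      rw [← mul_apply_eq_comp, shift_mul_shift _ _ _ _ _ (agreeOff_refl _ _)]
  have hcomm : ∀ g : n → Boundary s β → ℝ≥0∞, ∑ k, ∑' ρ, g k ρ = ∑' ρ, ∑ k, g k ρ := fun g =>
    (Summable.tsum_finsetSum fun _ _ => ENNReal.summable).symm
  calc ‖matOp (Rep ι) n M G‖ₑ ^ 2
      = ∑ k, ∑' ρ : Boundary s β, ‖shift s ρ.1 ρ.1 (matOp (Rep ι) n M G k)‖ₑ ^ 2 := by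
        rw [enorm_piLp_sq]
        exact Finset.sum_congr rfl fun k _ => (tsum_enorm_shift_sq s β _).symm
    _ = ∑' ρ : Boundary s β, ∑ k, ‖shift s (r k).1 (r k).1 (X (u ρ))‖ₑ ^ 2 := by
        rw [hcomm]
        refine tsum_congr fun ρ => Finset.sum_congr rfl fun k _ => ?_
        rw [← h1, enorm_shift_apply_eq s (r k).1]
    _ ≤ ∑' ρ : Boundary s β, ‖X‖ₑ ^ 2 * ∑ l, ‖shift s ρ.1 ρ.1 (G l)‖ₑ ^ 2 := by
        refine ENNReal.tsum_le_tsum fun ρ => (sum_enorm_shift_sq_le hr _).trans ?_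
        rw [← h2, ← mul_pow]
        gcongr
        exact X.le_opENorm _
    _ = (‖X‖ₑ * ‖G‖ₑ) ^ 2 := by
        rw [ENNReal.tsum_mul_left, ← hcomm, mul_pow, enorm_piLp_sq]
        congr 1
        exact Finset.sum_congr rfl fun k _ => tsum_enorm_shift_sq s β _

/-- The counterpart of `norm_compression_le`: on a vector living in finitely many blocks, the
components of `Y g` in these blocks are those of `M` applied to the column of components of `g`, all
moved to the block of `β`. -/
theorem sum_enorm_apply_sq_le {r : n → Boundary s β} (hr : Function.Injective r)
    {M : CStarMatrix n n (Rep ι →L[ℂ] Rep ι)} (hM : ∀ k l, M k l ∈ actingOn ι s)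
    {Y : Rep ι →L[ℂ] Rep ι}
    (h : ∀ k l, shift s (r k).1 (r k).1 * Y * shift s (r l).1 (r l).1 =
      M k l * shift s (r k).1 (r l).1) {g : Rep ι}
    (hg : ∑ l, shift s (r l).1 (r l).1 g = g) :
    ∑ k, ‖shift s (r k).1 (r k).1 (Y g)‖ₑ ^ 2 ≤ (‖M‖ₑ * ‖g‖ₑ) ^ 2 := by
  set G : PiLp 2 fun _ : n => Rep ι := WithLp.toLp 2 fun l => shift s β (r l).1 g with hG
  have h1 : ∀ k, shift s (r k).1 (r k).1 (Y g) = shift s (r k).1 β (matOp (Rep ι) n M G k) := by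
    intro k
    conv_lhs => rw [← hg]
    rw [matOp_apply, map_sum, map_sum, map_sum]
    refine Finset.sum_congr rfl fun l _ => ?_
    have := congr($(h k l) g)
    simp only [mul_apply_eq_comp] at this
    rw [this, ← shift_mul_shift s (r k).1 β β (r l).1 (agreeOff_refl _ _), mul_apply_eq_comp,
      apply_shift_of_mem (hM k l)]
  calc ∑ k, ‖shift s (r k).1 (r k).1 (Y g)‖ₑ ^ 2
      ≤ ∑ k, ‖matOp (Rep ι) n M G k‖ₑ ^ 2 := by
        refine Finset.sum_le_sum fun k _ => ?_
        rw [h1]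
        gcongr
        exact enorm_le_iff_norm_le.2 (norm_shift_apply_le _ _ _ _)
    _ = ‖matOp (Rep ι) n M G‖ₑ ^ 2 := (enorm_piLp_sq _).symm
    _ ≤ (‖M‖ₑ * ‖G‖ₑ) ^ 2 := by
        gcongr
        refine ((matOp (Rep ι) n M).le_opENorm G).trans ?_
        rw [← ofReal_norm, norm_matOp, ofReal_norm]
    _ ≤ (‖M‖ₑ * ‖g‖ₑ) ^ 2 := by
        rw [mul_pow, mul_pow, enorm_piLp_sq]
        gcongr
        refine le_trans (le_of_eq ?_) (sum_enorm_shift_sq_le hr g)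
        exact Finset.sum_congr rfl fun l _ => by rw [hG, ← enorm_shift_apply_eq s β (r l).1]

/-- A map whose compressions to configurations off `s` are given by a completely bounded map on an
algebra acting on `s` is bounded by the cb-norm. -/
theorem norm_apply_le_of_compression (β : (y : Γ) → ι y) {S : StarSubalgebra ℂ (Rep ι →L[ℂ] Rep ι)}
    (hS : S ≤ actingOn ι s) {Ψ : (Rep ι →L[ℂ] Rep ι) → (Rep ι →L[ℂ] Rep ι)}
    (hΨ : ∀ A ∈ S, Ψ A ∈ S) {c : ℝ} (hc : 0 ≤ c)
    (hcb : ∀ (n : ℕ) (M : CStarMatrix (Fin n) (Fin n) (Rep ι →L[ℂ] Rep ι)),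
      (∀ i j, M i j ∈ S) → ‖M.map Ψ‖ ≤ c * ‖M‖) {X : Rep ι →L[ℂ] Rep ι}
    (hX : ∀ ρ ρ', ∃ A ∈ S, shift s ρ ρ * X * shift s ρ' ρ' = A * shift s ρ ρ' ∧
      shift s ρ ρ * Ψ X * shift s ρ' ρ' = Ψ A * shift s ρ ρ') : ‖Ψ X‖ ≤ c * ‖X‖ := by
  classical
  choose A hAS hAX hAΨ using hX
  have hfin : ∀ (F : Finset (Boundary s β)) (g : Rep ι), ∑ ρ ∈ F, shift s ρ.1 ρ.1 g = g →
      ∑ ρ ∈ F, ‖shift s ρ.1 ρ.1 (Ψ X g)‖ₑ ^ 2 ≤ ENNReal.ofReal (c * ‖X‖ * ‖g‖) ^ 2 := by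
    intro F g hg
    let r : Fin F.card → Boundary s β := fun k => (F.equivFin.symm k).1
    have hr : Function.Injective r := Subtype.val_injective.comp F.equivFin.symm.injective
    let M : CStarMatrix (Fin F.card) (Fin F.card) (Rep ι →L[ℂ] Rep ι) :=
      CStarMatrix.ofMatrix fun k l => A (r k).1 (r l).1
    have h1 : ‖M‖ ≤ ‖X‖ := norm_compression_le hr (fun k l => hS (hAS _ _)) fun k l => hAX _ _
    have h2 := sum_enorm_apply_sq_le hr (M := M.map Ψ) (fun k l => hS (hΨ _ (hAS _ _)))
      (fun k l => hAΨ _ _) ((sum_equivFin_symm F fun ρ => shift s ρ.1 ρ.1 g).trans hg)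
    refine (sum_equivFin_symm F fun ρ => ‖shift s ρ.1 ρ.1 (Ψ X g)‖ₑ ^ 2).ge.trans (h2.trans ?_)
    gcongr
    rw [← ofReal_norm, ← ofReal_norm, ← ENNReal.ofReal_mul (norm_nonneg _)]
    refine ENNReal.ofReal_le_ofReal ?_
    gcongr
    exact (hcb _ M fun k l => hAS _ _).trans (by gcongr)
  -- `Ψ X g` may spread over infinitely many blocks. Any finite set `F'` of them is tested after
  -- adjoining the blocks `F` of `g`, and the bound does not depend on `F'`.
  have hfin' : ∀ (F : Finset (Boundary s β)) (g : Rep ι), ∑ ρ ∈ F, shift s ρ.1 ρ.1 g = g →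
      ‖Ψ X g‖ ≤ c * ‖X‖ * ‖g‖ := by
    intro F g hg
    have h : ‖Ψ X g‖ₑ ^ 2 ≤ ENNReal.ofReal (c * ‖X‖ * ‖g‖) ^ 2 := by
      rw [← tsum_enorm_shift_sq s β, ENNReal.tsum_eq_iSup_sum]
      refine iSup_le fun F' => (Finset.sum_le_sum_of_subset
        (Finset.subset_union_left (s₁ := F') (s₂ := F))).trans (hfin (F' ∪ F) g ?_)
      rw [← hg, ← Finset.sum_subset (Finset.subset_union_right (s₁ := F') (s₂ := F)), hg, hg]
      intro ρ _ hρ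
      rw [map_sum]
      refine Finset.sum_eq_zero fun ρ' hρ' => ?_
      rw [← mul_apply_eq_comp, shift_mul_shift_of_not]
      · rfl
      · intro h
        rw [Boundary.eq_of_agreeOff h] at hρ
        exact hρ hρ'
    rw [ENNReal.pow_le_pow_left_iff (by norm_num), ← ofReal_norm] at h
    exact (ENNReal.ofReal_le_ofReal_iff (by positivity)).1 h
  refine ContinuousLinearMap.opNorm_le_bound _ (by positivity) fun g => ?_
  -- Finite combinations of basis vectors meet finitely many blocks, and they approximate every `g`.
  refine le_of_tendsto_of_tendsto (((Ψ X).continuous.tendsto _).comp (hasSum_ket g)).norm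
    ((tendsto_norm.comp (hasSum_ket g)).const_mul (c * ‖X‖)) (Eventually.of_forall fun T => ?_)
  let label : ((y : Γ) → ι y) → Boundary s β := fun σ => ⟨glue s β σ, glue_glue_right s β β σ⟩
  refine hfin' (T.image label) _ ?_
  simp only [map_sum, map_smul]
  rw [Finset.sum_comm]
  refine Finset.sum_congr rfl fun σ hσ => ?_
  have hag : AgreeOff s σ (glue s β σ) := (agreeOff_glue s β σ).symm
  rw [← Finset.smul_sum, Finset.sum_eq_single (label σ), shift_ket_of_agreeOff hag,
    agreeOff_iff_glue.1 hag]
  · intro ρ _ hρ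
    refine shift_ket_of_not (fun h => hρ ?_) _
    exact Boundary.eq_of_agreeOff (h.symm.trans hag)
  · exact fun h => absurd (Finset.mem_image_of_mem _ hσ) h

end Compression
-- Local algebras inside the commutants; density of products.
section SiteAlgebra

universe u v w

variable {Γ : Type u} {H : Γ → Type v} [∀ x, NormedAddCommGroup (H x)]
  [∀ x, InnerProductSpace ℂ (H x)] {ι : Γ → Type w} (b : ∀ x, HilbertBasis (ι x) ℂ (H x))

theorem siteOp_apply (x : Γ) (T : H x →L[ℂ] H x) (f : Rep ι) (σ : (y : Γ) → ι y) :
    siteOp b x T f σ = ⟪b x (σ x), T (slice b x f σ)⟫_ℂ := rfl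

open Classical in
theorem glue_update {s : Set Γ} {x : Γ} (hx : x ∈ s) (σ ρ : (y : Γ) → ι y) (i : ι x) :
    glue s (Function.update σ x i) ρ = Function.update (glue s σ ρ) x i := by
  funext y
  by_cases hy : y = x
  · subst hy
    rw [glue_of_mem hx, Function.update_self, Function.update_self]
  · rw [Function.update_of_ne hy]
    by_cases hs : y ∈ s
    · rw [glue_of_mem hs, glue_of_mem hs, Function.update_of_ne hy]
    · rw [glue_of_notMem hs, glue_of_notMem hs]

open Classical in
theorem agreeOff_update {s : Set Γ} {x : Γ} (hx : x ∈ s) (σ ρ : (y : Γ) → ι y) (i : ι x) :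
    AgreeOff s (Function.update σ x i) ρ ↔ AgreeOff s σ ρ := by
  refine forall₂_congr fun y hy => ?_
  rw [Function.update_of_ne]
  rintro rfl
  exact hy hx

theorem slice_shift_of_agreeOff {s : Set Γ} {x : Γ} (hx : x ∈ s) {σ ρ : (y : Γ) → ι y}
    (h : AgreeOff s σ ρ) (ρ' : (y : Γ) → ι y) (f : Rep ι) :
    slice b x (shift s ρ ρ' f) σ = slice b x f (glue s σ ρ') := by
  classical
  rw [slice, slice]
  congr 1
  ext i
  change shift s ρ ρ' f _ = f _
  rw [shift_apply_of_agreeOff ((agreeOff_update hx σ ρ i).2 h), glue_update hx]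

theorem slice_shift_of_not {s : Set Γ} {x : Γ} (hx : x ∈ s) {σ ρ : (y : Γ) → ι y}
    (h : ¬ AgreeOff s σ ρ) (ρ' : (y : Γ) → ι y) (f : Rep ι) :
    slice b x (shift s ρ ρ' f) σ = 0 := by
  classical
  rw [slice, ← map_zero (b x).repr.symm]
  congr 1
  ext i
  change shift s ρ ρ' f _ = 0
  rw [shift_apply_of_not fun h' => h ((agreeOff_update hx σ ρ i).1 h')]

theorem siteOp_mem_actingOn {s : Set Γ} {x : Γ} (hx : x ∈ s) (T : H x →L[ℂ] H x) :
    siteOp b x T ∈ actingOn ι s := by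
  refine mem_actingOn.2 fun ρ ρ' => ?_
  change _ * _ = _ * _
  ext f σ
  rw [mul_apply_eq_comp, mul_apply_eq_comp]
  by_cases h : AgreeOff s σ ρ
  · rw [shift_apply_of_agreeOff h, siteOp_apply, siteOp_apply, slice_shift_of_agreeOff b hx h,
      glue_of_mem hx]
  · rw [shift_apply_of_not h, siteOp_apply, slice_shift_of_not b hx h, map_zero, inner_zero_right]

/-- The star algebra generated by the one-site observables at the sites in `s`. -/
noncomputable def siteAlgebra (s : Set Γ) : StarSubalgebra ℂ (Rep ι →L[ℂ] Rep ι) :=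
  StarAlgebra.adjoin ℂ {S | ∃ x ∈ s, ∃ T : H x →L[ℂ] H x, siteOp b x T = S}

theorem siteAlgebra_le_actingOn (s : Set Γ) : siteAlgebra b s ≤ actingOn ι s := by
  refine StarAlgebra.adjoin_le ?_
  rintro _ ⟨x, hx, T, rfl⟩
  exact siteOp_mem_actingOn b hx T

variable {b} in
theorem siteAlgebra_mono {s t : Set Γ} (h : s ⊆ t) : siteAlgebra b s ≤ siteAlgebra b t := by
  refine StarAlgebra.adjoin_mono ?_
  rintro _ ⟨x, hx, T, rfl⟩
  exact ⟨x, h hx, T, rfl⟩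

theorem siteAlgebra_le_localAlgebra (X : Finset Γ) : siteAlgebra b ↑X ≤ localAlgebra b X :=
  StarSubalgebra.le_topologicalClosure _

theorem localAlgebra_le_actingOn (X : Finset Γ) : localAlgebra b X ≤ actingOn ι (X : Set Γ) :=
  StarSubalgebra.topologicalClosure_minimal (siteAlgebra_le_actingOn b _) (isClosed_actingOn _)

theorem isClosed_localAlgebra (X : Finset Γ) :
    IsClosed (localAlgebra b X : Set (Rep ι →L[ℂ] Rep ι)) :=
  StarSubalgebra.isClosed_topologicalClosure _

theorem isClosed_quasiLocalAlgebra :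
    IsClosed (quasiLocalAlgebra b : Set (Rep ι →L[ℂ] Rep ι)) :=
  StarSubalgebra.isClosed_topologicalClosure _

variable {b} in
theorem localAlgebra_mono {X Y : Finset Γ} (h : X ⊆ Y) : localAlgebra b X ≤ localAlgebra b Y :=
  StarSubalgebra.topologicalClosure_mono (siteAlgebra_mono (by exact_mod_cast h))

theorem localAlgebra_le_quasiLocalAlgebra (X : Finset Γ) :
    localAlgebra b X ≤ quasiLocalAlgebra b :=
  (le_iSup (localAlgebra b) X).trans (StarSubalgebra.le_topologicalClosure _)

variable {b} in
theorem commute_of_mem_localAlgebra {X Y : Finset Γ} (h : Disjoint X Y)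
    {A B : Rep ι →L[ℂ] Rep ι} (hA : A ∈ localAlgebra b X) (hB : B ∈ localAlgebra b Y) :
    Commute A B := by
  refine commute_of_mem_actingOn (localAlgebra_le_actingOn b X hA) ?_
  refine StarSubalgebra.topologicalClosure_minimal ((siteAlgebra_mono ?_).trans
    (siteAlgebra_le_actingOn b _)) (isClosed_actingOn _) hB
  exact Set.subset_compl_iff_disjoint_left.2 (by exact_mod_cast h)

theorem mem_closure_iUnion_localAlgebra {A : Rep ι →L[ℂ] Rep ι} (hA : A ∈ quasiLocalAlgebra b) :
    A ∈ closure (⋃ X, (localAlgebra b X : Set (Rep ι →L[ℂ] Rep ι))) := by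
  classical
  have hd : Directed (· ≤ ·) (localAlgebra b) := fun X Y =>
    ⟨X ∪ Y, localAlgebra_mono Finset.subset_union_left, localAlgebra_mono Finset.subset_union_right⟩
  rw [← StarSubalgebra.coe_iSup_of_directed hd]
  exact hA

theorem quasiLocalAlgebra_le :
    quasiLocalAlgebra b ≤ (siteAlgebra b Set.univ).topologicalClosure := by
  refine StarSubalgebra.topologicalClosure_minimal (iSup_le fun X => ?_)
    (StarSubalgebra.isClosed_topologicalClosure _)
  exact StarSubalgebra.topologicalClosure_mono (siteAlgebra_mono (Set.subset_univ _))

theorem siteAlgebra_le_quasiLocalAlgebra (s : Set Γ) : siteAlgebra b s ≤ quasiLocalAlgebra b := by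
  refine StarAlgebra.adjoin_le ?_
  rintro _ ⟨x, hx, T, rfl⟩
  exact localAlgebra_le_quasiLocalAlgebra b {x} (siteAlgebra_le_localAlgebra b {x}
    (StarAlgebra.subset_adjoin ℂ _ ⟨x, by simp, T, rfl⟩))

/-- The sums of products of observables on `s` and observables off `s` are dense. -/
theorem mem_closure_of_mul_of_add (s : Set Γ) {p : (Rep ι →L[ℂ] Rep ι) → Prop}
    (hmul : ∀ A ∈ siteAlgebra b s, ∀ B ∈ siteAlgebra b sᶜ, p (A * B))
    (hadd : ∀ A ∈ siteAlgebra b Set.univ, ∀ B ∈ siteAlgebra b Set.univ, p A → p B → p (A + B))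
    {A : Rep ι →L[ℂ] Rep ι} (hA : A ∈ quasiLocalAlgebra b) :
    A ∈ closure {B | B ∈ quasiLocalAlgebra b ∧ p B} := by
  have hcomm : ∀ A ∈ siteAlgebra b s, ∀ B ∈ siteAlgebra b sᶜ, Commute A B := fun A hA B hB =>
    commute_of_mem_actingOn (siteAlgebra_le_actingOn b _ hA) (siteAlgebra_le_actingOn b _ hB)
  -- Multiplication is an algebra homomorphism on the algebraic tensor product because the two
  -- factors commute. Its range is an algebra containing all one-site observables, so each element
  -- of `siteAlgebra b Set.univ` is a sum of products, and `p` spreads by induction on tensors.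
  let φ : TensorProduct ℂ (siteAlgebra b s) (siteAlgebra b sᶜ) →ₐ[ℂ] (Rep ι →L[ℂ] Rep ι) :=
    Algebra.TensorProduct.lift (siteAlgebra b s).toSubalgebra.val
      (siteAlgebra b sᶜ).toSubalgebra.val
      fun A B => hcomm A A.2 B B.2
  have hφt : ∀ A B, φ (TensorProduct.tmul ℂ A B) = A.1 * B.1 := fun A B =>
    Algebra.TensorProduct.lift_tmul ..
  have hφ : ∀ z, φ z ∈ siteAlgebra b Set.univ ∧ p (φ z) := by
    intro z
    induction z with
    | zero =>
      refine ⟨by rw [map_zero]; exact zero_mem _, ?_⟩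
      have := hmul 0 (zero_mem _) 0 (zero_mem _)
      rwa [mul_zero, ← map_zero φ] at this
    | tmul A B =>
      rw [hφt]
      exact ⟨mul_mem (siteAlgebra_mono (Set.subset_univ _) A.2)
        (siteAlgebra_mono (Set.subset_univ _) B.2), hmul A A.2 B B.2⟩
    | add z w hz hw =>
      rw [map_add]
      exact ⟨add_mem hz.1 hw.1, hadd _ hz.1 _ hw.1 hz.2 hw.2⟩
  have hrange : ∀ B ∈ siteAlgebra b Set.univ, ∃ z, φ z = B := by
    have hl : ∀ A ∈ siteAlgebra b s, A ∈ φ.range := fun A hA =>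
      ⟨TensorProduct.tmul ℂ ⟨A, hA⟩ 1, by
        change φ (TensorProduct.tmul ℂ ⟨A, hA⟩ 1) = A
        rw [hφt]; exact mul_one A⟩
    have hr : ∀ A ∈ siteAlgebra b sᶜ, A ∈ φ.range := fun A hA =>
      ⟨TensorProduct.tmul ℂ 1 ⟨A, hA⟩, by
        change φ (TensorProduct.tmul ℂ 1 ⟨A, hA⟩) = A
        rw [hφt]; exact one_mul A⟩
    have hgen : ∀ (x : Γ) (T : H x →L[ℂ] H x),
        siteOp b x T ∈ siteAlgebra b s ∨ siteOp b x T ∈ siteAlgebra b sᶜ := by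
      intro x T
      by_cases hx : x ∈ s
      · exact Or.inl (StarAlgebra.subset_adjoin ℂ _ ⟨x, hx, T, rfl⟩)
      · exact Or.inr (StarAlgebra.subset_adjoin ℂ _ ⟨x, hx, T, rfl⟩)
    suffices (siteAlgebra b Set.univ).toSubalgebra ≤ φ.range from fun B hB => this hB
    rw [siteAlgebra, StarAlgebra.adjoin_toSubalgebra]
    refine Algebra.adjoin_le (Set.union_subset ?_ ?_)
    · rintro _ ⟨x, -, T, rfl⟩
      exact (hgen x T).elim (hl _) (hr _)
    · rintro S ⟨x, -, T, hS⟩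
      rw [← star_star S, ← hS]
      exact (hgen x T).elim (fun h => hl _ (star_mem h)) (fun h => hr _ (star_mem h))
  refine closure_mono ?_ (quasiLocalAlgebra_le b hA)
  intro B hB
  obtain ⟨z, rfl⟩ := hrange B hB
  exact ⟨siteAlgebra_le_quasiLocalAlgebra b _ hB, (hφ z).2⟩

theorem quasiLocalAlgebra_le_actingOn : quasiLocalAlgebra b ≤ actingOn ι Set.univ :=
  (quasiLocalAlgebra_le b).trans (StarSubalgebra.topologicalClosure_minimal
    (siteAlgebra_le_actingOn b _) (isClosed_actingOn _))

variable {b} in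
/-- Elements of the local algebra of the empty set are central. -/
theorem commute_of_mem_localAlgebra_empty {A B : Rep ι →L[ℂ] Rep ι} (hA : A ∈ localAlgebra b ∅)
    (hB : B ∈ quasiLocalAlgebra b) : Commute A B := by
  refine commute_of_mem_actingOn (localAlgebra_le_actingOn b ∅ hA) ?_
  rw [Finset.coe_empty, Set.compl_empty]
  exact quasiLocalAlgebra_le_actingOn b hB

end SiteAlgebra
-- Homogeneous form of the cb-norm bound.
section CbNorm

variable {K : Type*} [NormedAddCommGroup K] [InnerProductSpace ℂ K] [CompleteSpace K]

/-- Scaling to the unit ball. Finiteness is essential, since `ENNReal.toReal` sends `∞` to 0. -/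
theorem norm_map_le_cbNorm (S : StarSubalgebra ℂ (K →L[ℂ] K))
    (Ψ : (K →L[ℂ] K) →ₗ[ℂ] (K →L[ℂ] K)) (h : cbNorm S Ψ ≠ ∞) {n : ℕ}
    (M : CStarMatrix (Fin n) (Fin n) (K →L[ℂ] K)) (hM : ∀ i j, M i j ∈ S) :
    ‖M.map Ψ‖ ≤ (cbNorm S Ψ).toReal * ‖M‖ := by
  have key : ∀ M : CStarMatrix (Fin n) (Fin n) (K →L[ℂ] K), (∀ i j, M i j ∈ S) → ‖M‖ ≤ 1 →
      ‖M.map Ψ‖ ≤ (cbNorm S Ψ).toReal := by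
    intro M hM h1
    have : ‖M.map Ψ‖ₑ ≤ cbNorm S Ψ :=
      le_iSup_of_le n (le_iSup_of_le M (le_iSup_of_le hM (le_iSup_of_le h1 le_rfl)))
    simpa using ENNReal.toReal_mono h this
  have hsmul : ∀ c : ℂ, (c • M).map Ψ = c • M.map Ψ := by
    intro c
    ext i j : 2
    simp
  rcases eq_or_ne M 0 with rfl | h0
  · have : (0 : CStarMatrix (Fin n) (Fin n) (K →L[ℂ] K)).map Ψ = 0 := by
      simpa using hsmul 0
    rw [this]
    simp
  have hpos : 0 < ‖M‖ := norm_pos_iff.2 h0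
  have := key (((‖M‖⁻¹ : ℝ) : ℂ) • M) (fun i j => S.smul_mem (hM i j) _) (by
    rw [norm_smul, Complex.norm_real, norm_inv, norm_norm, inv_mul_cancel₀ hpos.ne'])
  rwa [hsmul, norm_smul, Complex.norm_real, norm_inv, norm_norm, inv_mul_le_iff₀ hpos,
    mul_comm] at this

end CbNorm

/-! ### The maps `Ψ_Z` on the quasi-local algebra. -/

section Localisation

universe u v w

variable {Γ : Type u} {H : Γ → Type v} [∀ x, NormedAddCommGroup (H x)]
  [∀ x, InnerProductSpace ℂ (H x)] {ι : Γ → Type w} {b : ∀ x, HilbertBasis (ι x) ℂ (H x)}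

theorem nonempty_configuration (b : ∀ x, HilbertBasis (ι x) ℂ (H x)) [∀ x, Nontrivial (H x)] :
    Nonempty ((x : Γ) → ι x) := by
  refine Classical.nonempty_pi.2 fun x => ?_
  by_contra h
  rw [not_nonempty_iff] at h
  obtain ⟨v, hv⟩ := exists_ne (0 : H x)
  exact hv (by simpa using ((b x).hasSum_repr v).unique hasSum_empty)

/-- Two continuous linear maps on the quasi-local observables agree if they agree on products of
observables on `s` and observables off `s`. -/
theorem eq_of_eq_on_mul (s : Set Γ) {E : Type*} [NormedAddCommGroup E] [NormedSpace ℂ E]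
    {f g : (Rep ι →L[ℂ] Rep ι) →L[ℂ] E}
    (h : ∀ A ∈ siteAlgebra b s, ∀ B ∈ siteAlgebra b sᶜ, f (A * B) = g (A * B))
    {A : Rep ι →L[ℂ] Rep ι} (hA : A ∈ quasiLocalAlgebra b) : f A = g A := by
  have := mem_closure_of_mul_of_add b s (p := fun A => f A = g A) h
    (fun A _ B _ hA hB => by rw [map_add, map_add, hA, hB]) hA
  have hc : IsClosed {A | f A = g A} := isClosed_eq f.continuous g.continuous
  exact hc.closure_subset_iff.2 (fun B hB => hB.2) this

namespace Interaction

variable (D : Interaction b)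

/-- The map `Ψ_Z(t)`, as a bounded operator. -/
noncomputable def psiCLM (t : ℝ) (Z : Finset Γ) :
    (Rep ι →L[ℂ] Rep ι) →L[ℂ] (Rep ι →L[ℂ] Rep ι) :=
  IsKraus.lindbladCLM (D.L_summable t Z) (D.Φ t Z)

theorem psiCLM_apply (t : ℝ) (Z : Finset Γ) (A : Rep ι →L[ℂ] Rep ι) :
    D.psiCLM t Z A = D.psi t Z A := rfl

theorem psi_mem_localAlgebra (t : ℝ) {Z : Finset Γ} {A : Rep ι →L[ℂ] Rep ι}
    (hA : A ∈ localAlgebra b Z) : D.psi t Z A ∈ localAlgebra b Z :=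
  D.map_mem t Z A hA

theorem psi_star (t : ℝ) (Z : Finset Γ) (A : Rep ι →L[ℂ] Rep ι) :
    D.psi t Z (star A) = star (D.psi t Z A) :=
  IsKraus.lindbladMap_star (D.L_summable t Z) (D.Φ_star t Z) A

theorem psi_one (t : ℝ) (Z : Finset Γ) : D.psi t Z 1 = 0 :=
  IsKraus.lindbladMap_one (D.L_summable t Z)

theorem psi_mul (t : ℝ) {Z : Finset Γ} (A : Rep ι →L[ℂ] Rep ι) {B : Rep ι →L[ℂ] Rep ι}
    (hB : ∀ C ∈ localAlgebra b Z, Commute C B) : D.psi t Z (A * B) = D.psi t Z A * B :=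
  IsKraus.lindbladMap_mul (D.L_summable t Z) A (hB _ (D.Φ_mem t Z)).symm
    (fun a => (hB _ (D.L_mem t Z a)).symm) (fun a => (hB _ (star_mem (D.L_mem t Z a))).symm)

theorem psi_mul_left (t : ℝ) {Z : Finset Γ} (A : Rep ι →L[ℂ] Rep ι) {B : Rep ι →L[ℂ] Rep ι}
    (hB : ∀ C ∈ localAlgebra b Z, Commute C B) : D.psi t Z (B * A) = B * D.psi t Z A :=
  IsKraus.mul_lindbladMap (D.L_summable t Z) A (hB _ (D.Φ_mem t Z)).symm
    (fun a => (hB _ (D.L_mem t Z a)).symm) (fun a => (hB _ (star_mem (D.L_mem t Z a))).symm)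

theorem psi_eq_zero_of_commute (t : ℝ) {Z : Finset Γ} {B : Rep ι →L[ℂ] Rep ι}
    (hB : ∀ C ∈ localAlgebra b Z, Commute C B) : D.psi t Z B = 0 := by
  have := D.psi_mul t 1 hB
  rwa [one_mul, psi_one, zero_mul] at this

theorem psi_eq_zero (t : ℝ) {X Z : Finset Γ} (h : Disjoint X Z) {A : Rep ι →L[ℂ] Rep ι}
    (hA : A ∈ localAlgebra b X) : D.psi t Z A = 0 :=
  D.psi_eq_zero_of_commute t fun _ hC => commute_of_mem_localAlgebra h.symm hC hA

theorem psi_empty (t : ℝ) {A : Rep ι →L[ℂ] Rep ι} (hA : A ∈ quasiLocalAlgebra b) :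
    D.psi t ∅ A = 0 :=
  D.psi_eq_zero_of_commute t fun _ hC => commute_of_mem_localAlgebra_empty hC hA

theorem commute_of_mem_siteAlgebra_compl {Z : Finset Γ} {B C : Rep ι →L[ℂ] Rep ι}
    (hB : B ∈ siteAlgebra b (Z : Set Γ)ᶜ) (hC : C ∈ localAlgebra b Z) : Commute C B :=
  commute_of_mem_actingOn (localAlgebra_le_actingOn b Z hC) (siteAlgebra_le_actingOn b _ hB)

theorem psi_mul_of_mem_siteAlgebra (t : ℝ) {Z : Finset Γ} (A : Rep ι →L[ℂ] Rep ι)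
    {B : Rep ι →L[ℂ] Rep ι} (hB : B ∈ siteAlgebra b (Z : Set Γ)ᶜ) :
    D.psi t Z (A * B) = D.psi t Z A * B :=
  D.psi_mul t A fun _ hC => commute_of_mem_siteAlgebra_compl hB hC

/-- On a product of `A` on `Z` and `B` off `Z` the value is `Ψ_Z(A) B`, with `Ψ_Z(A)` in `𝒜_Z` by
hypothesis; sums and limits of such products give everything. -/
theorem psi_mem (t : ℝ) (Z : Finset Γ) {A : Rep ι →L[ℂ] Rep ι} (hA : A ∈ quasiLocalAlgebra b) :
    D.psi t Z A ∈ quasiLocalAlgebra b := by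
  have := mem_closure_of_mul_of_add b (Z : Set Γ)
    (p := fun A => D.psiCLM t Z A ∈ quasiLocalAlgebra b)
    (fun A hA B hB => by
      rw [psiCLM_apply, D.psi_mul_of_mem_siteAlgebra t A hB]
      exact mul_mem (localAlgebra_le_quasiLocalAlgebra b Z
        (D.psi_mem_localAlgebra t (siteAlgebra_le_localAlgebra b Z hA)))
        (siteAlgebra_le_quasiLocalAlgebra b _ hB))
    (fun A _ B _ hA hB => by
      rw [map_add]
      exact add_mem hA hB) hA
  have hc : IsClosed {A | D.psiCLM t Z A ∈ quasiLocalAlgebra b} :=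
    (isClosed_quasiLocalAlgebra b).preimage (D.psiCLM t Z).continuous
  exact hc.closure_subset_iff.2 (fun B hB => hB.2) this

/-- On a product of `A` on `Z` and `B` off `Z`, both orders give `Ψ_Z(A) Ψ_Y(B)`. -/
theorem psi_comm (r t : ℝ) {Y Z : Finset Γ} (h : Disjoint Y Z) {A : Rep ι →L[ℂ] Rep ι}
    (hA : A ∈ quasiLocalAlgebra b) : D.psi r Z (D.psi t Y A) = D.psi t Y (D.psi r Z A) := by
  refine eq_of_eq_on_mul (b := b) (Z : Set Γ) (f := (D.psiCLM r Z).comp (D.psiCLM t Y))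
    (g := (D.psiCLM t Y).comp (D.psiCLM r Z)) (fun A hA B hB => ?_) hA
  have hA' := siteAlgebra_le_localAlgebra b Z hA
  have hY : ∀ A ∈ localAlgebra b Z, ∀ C ∈ localAlgebra b Y, Commute C A := fun A hA C hC =>
    commute_of_mem_localAlgebra h hC hA
  change D.psi r Z (D.psi t Y (A * B)) = D.psi t Y (D.psi r Z (A * B))
  rw [D.psi_mul_of_mem_siteAlgebra r A hB, D.psi_mul_left t B (hY _ (D.psi_mem_localAlgebra r hA')),
    D.psi_mul_left t B (hY A hA'), D.psi_mul]
  -- It remains to see that `Ψ_Y(B)` commutes with `𝒜_Z`: an element `C` of `𝒜_Z` commutes with `B`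
  -- and passes through `Ψ_Y` on either side.
  intro C hC
  have h1 := D.psi_mul_left t B (hY C hC)
  rw [(commute_of_mem_siteAlgebra_compl hB hC).eq, D.psi_mul t B (hY C hC)] at h1
  exact h1.symm

/-- The bound of `Ψ_Z` on `𝒜_Z` alone would not suffice here: compressions of a quasi-local
observable form matrices over `𝒜_Z` of any size. Their entries exist for sums of products, and
density does the rest. -/
theorem norm_psi_le [∀ x, Nontrivial (H x)] (t : ℝ) (Z : Finset Γ)
    (hcb : cbNorm (localAlgebra b Z) (D.psi t Z) ≠ ∞) {A : Rep ι →L[ℂ] Rep ι}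
    (hA : A ∈ quasiLocalAlgebra b) :
    ‖D.psi t Z A‖ ≤ (cbNorm (localAlgebra b Z) (D.psi t Z)).toReal * ‖A‖ := by
  obtain ⟨β⟩ := nonempty_configuration b
  have := mem_closure_of_mul_of_add b (Z : Set Γ)
    (p := fun X => ∀ ρ ρ', ∃ A ∈ localAlgebra b Z,
      shift (Z : Set Γ) ρ ρ * X * shift (Z : Set Γ) ρ' ρ' = A * shift (Z : Set Γ) ρ ρ' ∧
      shift (Z : Set Γ) ρ ρ * D.psi t Z X * shift (Z : Set Γ) ρ' ρ' =
        D.psi t Z A * shift (Z : Set Γ) ρ ρ')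
    (fun A hA B hB ρ ρ' => ?_) (fun A _ B _ hA hB ρ ρ' => ?_) hA
  · have hc : IsClosed {A | ‖D.psiCLM t Z A‖ ≤
        (cbNorm (localAlgebra b Z) (D.psi t Z)).toReal * ‖A‖} :=
      isClosed_le (D.psiCLM t Z).continuous.norm (continuous_const.mul continuous_norm)
    refine hc.closure_subset_iff.2 (fun X hX => ?_) this
    exact norm_apply_le_of_compression β (localAlgebra_le_actingOn b Z) (D.map_mem t Z)
      ENNReal.toReal_nonneg
      (fun n M hM => norm_map_le_cbNorm (localAlgebra b Z) (D.psiCLM t Z).toLinearMap hcb M hM) hX.2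
  · have hA' := siteAlgebra_le_localAlgebra b Z hA
    obtain ⟨c, hc⟩ := shift_mul_mul_shift (siteAlgebra_le_actingOn b _ hB) ρ ρ'
    -- Compression turns the factor `B` into a scalar times a matrix unit, so the entry belonging to
    -- `A * B` is `c • A`.
    have key : ∀ A ∈ localAlgebra b Z, shift (Z : Set Γ) ρ ρ * (A * B) * shift (Z : Set Γ) ρ' ρ' =
        (c • A) * shift (Z : Set Γ) ρ ρ' := by
      intro A hA
      rw [← mul_assoc, (mem_actingOn.1 (localAlgebra_le_actingOn b Z hA) ρ ρ).eq, mul_assoc,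
        mul_assoc, ← mul_assoc _ B, hc, mul_smul_comm, smul_mul_assoc]
    refine ⟨c • A, (localAlgebra b Z).smul_mem hA' c, key A hA', ?_⟩
    rw [D.psi_mul_of_mem_siteAlgebra t A hB, key _ (D.psi_mem_localAlgebra t hA'), ← psiCLM_apply,
      ← psiCLM_apply, map_smul]
  · obtain ⟨A', hA', h1, h2⟩ := hA ρ ρ'
    obtain ⟨B', hB', h3, h4⟩ := hB ρ ρ'
    refine ⟨A' + B', add_mem hA' hB', ?_, ?_⟩
    · rw [mul_add, add_mul, add_mul, h1, h3]
    · rw [← psiCLM_apply, ← psiCLM_apply, map_add, map_add, mul_add, add_mul, add_mul,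
        psiCLM_apply, psiCLM_apply, h2, h4, psiCLM_apply, psiCLM_apply]

end Interaction

end Localisation
-- Decay functions and summable weights.
section Decay

variable {Γ : Type*} [MetricSpace Γ] {F : ℝ≥0 → ℝ≥0}

/-- The decay function `F_μ(d(x, y))`. -/
noncomputable def decay (F : ℝ≥0 → ℝ≥0) (μ : ℝ) (x y : Γ) : ℝ :=
  Real.exp (-μ * dist x y) * F (nndist x y)

theorem decay_nonneg (F : ℝ≥0 → ℝ≥0) (μ : ℝ) (x y : Γ) : 0 ≤ decay F μ x y := by
  unfold decay
  positivity

theorem IsDecayFunction.decay_pos (hF : IsDecayFunction Γ F) (μ : ℝ) (x y : Γ) :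
    0 < decay F μ x y :=
  mul_pos (Real.exp_pos _) (by exact_mod_cast hF.pos _)

theorem decay_self (F : ℝ≥0 → ℝ≥0) (μ : ℝ) (x : Γ) : decay F μ x x = F 0 := by
  simp [decay]

theorem IsDecayFunction.summable_decay (hF : IsDecayFunction Γ F) {μ : ℝ} (hμ : 0 ≤ μ) (x : Γ) :
    Summable fun z => decay F μ z x := by
  have h : ∑' y : Γ, (F (nndist x y) : ℝ≥0∞) ≠ ∞ :=
    ((le_iSup (fun x : Γ => ∑' y : Γ, (F (nndist x y) : ℝ≥0∞)) x).trans_lt hF.sum_lt_top).ne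
  rw [ENNReal.tsum_coe_ne_top_iff_summable, ← NNReal.summable_coe] at h
  refine Summable.of_nonneg_of_le (fun z => decay_nonneg F μ z x) (fun z => ?_) h
  rw [decay, nndist_comm]
  refine mul_le_of_le_one_left (by positivity) (Real.exp_le_one_iff.2 ?_)
  rw [neg_mul]
  exact neg_nonpos.2 (by positivity)

/-- By the triangle inequality the exponential factors multiply to at most `exp (-μ d(x, y))`, so
the convolution constant of `F` also serves for `F_μ`. -/
theorem IsDecayFunction.exists_sum_decay_mul_decay_le (hF : IsDecayFunction Γ F) {μ : ℝ}
    (hμ : 0 ≤ μ) : ∃ C, 0 ≤ C ∧ ∀ (x y : Γ) (S : Finset Γ),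
      ∑ z ∈ S, decay F μ x z * decay F μ z y ≤ C * decay F μ x y := by
  set C := ⨆ (x : Γ) (y : Γ), ∑' z : Γ,
    (F (nndist x z) : ℝ≥0∞) * (F (nndist y z) : ℝ≥0∞) / (F (nndist x y) : ℝ≥0∞) with hC
  refine ⟨C.toReal, ENNReal.toReal_nonneg, fun x y S => ?_⟩
  have hF0 : (0 : ℝ) < F (nndist x y) := by exact_mod_cast hF.pos _
  have h1 : ∑ z ∈ S, (F (nndist x z) : ℝ≥0∞) * (F (nndist y z) : ℝ≥0∞) /
      (F (nndist x y) : ℝ≥0∞) ≤ C :=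
    (ENNReal.sum_le_tsum S).trans (le_iSup₂_of_le x y le_rfl)
  have h2 := ENNReal.toReal_mono hF.convolution_lt_top.ne h1
  rw [ENNReal.toReal_sum] at h2
  · simp only [ENNReal.toReal_div, ENNReal.toReal_mul, ENNReal.coe_toReal] at h2
    rw [← Finset.sum_div, div_le_iff₀ hF0] at h2
    calc ∑ z ∈ S, decay F μ x z * decay F μ z y
        ≤ ∑ z ∈ S, Real.exp (-μ * dist x y) * (F (nndist x z) * F (nndist y z) : ℝ) := by
          refine Finset.sum_le_sum fun z _ => ?_
          rw [decay, decay, mul_mul_mul_comm, ← Real.exp_add, nndist_comm z y]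
          gcongr
          have := dist_triangle x z y
          nlinarith
      _ = Real.exp (-μ * dist x y) * ∑ z ∈ S, (F (nndist x z) * F (nndist y z) : ℝ) := by
          rw [Finset.mul_sum]
      _ ≤ Real.exp (-μ * dist x y) * (C.toReal * F (nndist x y)) := by gcongr
      _ = C.toReal * decay F μ x y := by rw [decay]; ring
  · intro z _
    have : (F (nndist x y) : ℝ≥0∞) ≠ 0 := by exact_mod_cast (hF.pos _).ne'
    finiteness

/-- Summable weights that are almost invariant under interactions dominated by `decay F μ`. -/
theorem IsDecayFunction.exists_weight [DecidableEq Γ] (hF : IsDecayFunction Γ F) {μ : ℝ}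
    (hμ : 0 ≤ μ) {C : ℝ} (hC : 0 ≤ C) (X : Finset Γ) :
    ∃ (v : Γ → ℝ) (κ : ℝ), (∀ z, 0 < v z) ∧ Summable v ∧ (∀ x ∈ X, 1 ≤ v x) ∧ 0 ≤ κ ∧
      ∀ c : Finset Γ → ℝ, (∀ x y, ∀ S : Finset (Finset Γ),
          ∑ Y ∈ S with x ∈ Y ∧ y ∈ Y, c Y ≤ C * decay F μ x y) →
        ∀ z, ∀ S : Finset (Finset Γ), ∑ Y ∈ S with z ∈ Y, c Y * ∑ y ∈ Y, v y ≤ κ * v z := by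
  rcases isEmpty_or_nonempty Γ with hΓ | ⟨⟨x₀⟩⟩
  · exact ⟨fun _ => 1, 0, fun _ => one_pos, Summable.of_finite, fun _ _ => le_rfl, le_rfl,
      fun _ _ z => hΓ.elim z⟩
  obtain ⟨C₁, hC₁, hconv⟩ := hF.exists_sum_decay_mul_decay_le hμ
  have hF0 : (0 : ℝ) < F 0 := by exact_mod_cast hF.pos 0
  -- The weight adds up copies of `F_μ` centred at the points of `X`; dividing by `F 0` makes it at
  -- least 1 on `X`. The extra centre `x₀` keeps it positive when `X` is empty.
  set v : Γ → ℝ := fun z => ∑ x ∈ insert x₀ X, decay F μ z x / F 0 with hv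
  have hvpos : ∀ z, 0 < v z := fun z =>
    Finset.sum_pos (fun x _ => div_pos (hF.decay_pos μ z x) hF0) (Finset.insert_nonempty _ _)
  refine ⟨v, C * C₁, hvpos, ?_, ?_, by positivity, fun c hc z S => ?_⟩
  · exact summable_sum fun x _ => (hF.summable_decay hμ x).div_const _
  · intro x hx
    refine le_trans (le_of_eq ?_) (Finset.single_le_sum (f := fun y => decay F μ x y / F 0)
      (fun y _ => div_nonneg (decay_nonneg _ _ _ _) hF0.le) (Finset.mem_insert_of_mem hx))
    rw [decay_self, div_self hF0.ne']
  -- `U` contains every `Y` in `S`, so the sums over `Y` and over `y` can be exchanged. The pair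
  -- bound then leaves a convolution of two decay functions.
  · set U : Finset Γ := S.sup id with hU
    have hsub : ∀ Y ∈ S, Y ⊆ U := fun Y hY => Finset.le_sup (f := id) hY
    calc ∑ Y ∈ S with z ∈ Y, c Y * ∑ y ∈ Y, v y
        = ∑ Y ∈ S with z ∈ Y, ∑ y ∈ U, if y ∈ Y then c Y * v y else 0 := by
          refine Finset.sum_congr rfl fun Y hY => ?_
          rw [Finset.mul_sum, ← Finset.sum_filter, Finset.filter_mem_eq_inter,
            Finset.inter_eq_right.2 (hsub Y (Finset.mem_filter.1 hY).1)]
      _ = ∑ y ∈ U, v y * ∑ Y ∈ S with z ∈ Y ∧ y ∈ Y, c Y := by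
          rw [Finset.sum_comm]
          refine Finset.sum_congr rfl fun y _ => ?_
          rw [← Finset.sum_filter, Finset.filter_filter, Finset.mul_sum]
          exact Finset.sum_congr rfl fun Y _ => mul_comm _ _
      _ ≤ ∑ y ∈ U, v y * (C * decay F μ z y) := by
          refine Finset.sum_le_sum fun y _ => ?_
          have := (hvpos y).le
          gcongr
          exact hc z y S
      _ = C * ∑ x ∈ insert x₀ X, (∑ y ∈ U, decay F μ z y * decay F μ y x) / F 0 := by
          simp_rw [hv, Finset.sum_mul, Finset.mul_sum, Finset.sum_div]
          rw [Finset.sum_comm]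
          refine Finset.sum_congr rfl fun x _ => ?_
          rw [Finset.mul_sum]
          exact Finset.sum_congr rfl fun y _ => by ring
      _ ≤ C * ∑ x ∈ insert x₀ X, C₁ * decay F μ z x / F 0 := by
          gcongr with x hx
          exact hconv z x U
      _ = C * C₁ * v z := by
          simp_rw [hv, mul_assoc, Finset.mul_sum, mul_div_assoc]

end Decay

/-! ### Consequences of the decay hypothesis for the generators. -/

section CbBound

universe u v w

variable {Γ : Type u} {H : Γ → Type v} [∀ x, NormedAddCommGroup (H x)]
  [∀ x, InnerProductSpace ℂ (H x)] {ι : Γ → Type w} {b : ∀ x, HilbertBasis (ι x) ℂ (H x)}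

namespace Interaction

variable (D : Interaction b)

open Classical in
/-- The bound of `Ψ_Z(t)` by its cb-norm; `Ψ_∅(t)` vanishes. -/
noncomputable def cbBound (t : ℝ) (Z : Finset Γ) : ℝ :=
  -- `decayNorm` sums over sets containing given points and so says nothing about the empty set.
  if Z = ∅ then 0 else (cbNorm (localAlgebra b Z) (D.psi t Z)).toReal

theorem cbBound_nonneg (t : ℝ) (Z : Finset Γ) : 0 ≤ D.cbBound t Z := by
  unfold cbBound
  split_ifs
  · exact le_rfl
  · exact ENNReal.toReal_nonneg

theorem generator_eq (t : ℝ) (Λ : Finset Γ) (A : Rep ι →L[ℂ] Rep ι) :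
    D.generator t Λ A = (∑ Z ∈ Λ.powerset, D.psiCLM t Z) A := by
  rw [_root_.sum_apply]
  rfl

theorem generator_mul (t : ℝ) (Λ : Finset Γ) (A : Rep ι →L[ℂ] Rep ι) {B : Rep ι →L[ℂ] Rep ι}
    (hB : B ∈ siteAlgebra b (Λ : Set Γ)ᶜ) :
    D.generator t Λ (A * B) = D.generator t Λ A * B := by
  rw [generator, generator, Finset.sum_mul]
  refine Finset.sum_congr rfl fun Z hZ => D.psi_mul_of_mem_siteAlgebra t A
    (siteAlgebra_mono (Set.compl_subset_compl.2 ?_) hB)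
  exact_mod_cast Finset.mem_powerset.1 hZ

variable [MetricSpace Γ] {F : ℝ≥0 → ℝ≥0} {μ T : ℝ}

variable {D} in
theorem tsum_cbNorm_le (hF : IsDecayFunction Γ F) (h : D.decayNorm F T μ < ∞) {s : ℝ}
    (hs : s ∈ Set.Icc 0 T) (x y : Γ) :
    ∑' Z : {Z : Finset Γ // x ∈ Z ∧ y ∈ Z}, cbNorm (localAlgebra b Z) (D.psi s Z) ≤
      ENNReal.ofReal ((D.decayNorm F T μ).toReal * decay F μ x y) := by
  have h1 : ∑' Z : {Z : Finset Γ // x ∈ Z ∧ y ∈ Z}, cbNorm (localAlgebra b Z) (D.psi s Z) /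
      ENNReal.ofReal (decay F μ x y) ≤ D.decayNorm F T μ :=
    le_iSup₂_of_le s hs (le_iSup₂_of_le x y le_rfl)
  have hpos : ENNReal.ofReal (decay F μ x y) ≠ 0 :=
    (ENNReal.ofReal_pos.2 (hF.decay_pos μ x y)).ne'
  simp_rw [div_eq_mul_inv] at h1
  rw [ENNReal.tsum_mul_right, ← div_eq_mul_inv,
    ENNReal.div_le_iff hpos ENNReal.ofReal_ne_top] at h1
  rwa [ENNReal.ofReal_mul ENNReal.toReal_nonneg, ENNReal.ofReal_toReal h.ne]

variable {D} in
theorem cbNorm_ne_top (hF : IsDecayFunction Γ F) (h : D.decayNorm F T μ < ∞) {s : ℝ}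
    (hs : s ∈ Set.Icc 0 T) {Z : Finset Γ} (hZ : Z.Nonempty) :
    cbNorm (localAlgebra b Z) (D.psi s Z) ≠ ∞ := by
  obtain ⟨x, hx⟩ := hZ
  refine ne_top_of_le_ne_top ENNReal.ofReal_ne_top
    (le_trans ?_ (tsum_cbNorm_le hF h hs x x))
  exact ENNReal.le_tsum (f := fun Z : {Z : Finset Γ // x ∈ Z ∧ x ∈ Z} =>
    cbNorm (localAlgebra b Z) (D.psi s Z)) ⟨Z, hx, hx⟩

variable {D} in
theorem sum_cbBound_le [DecidableEq Γ] (hF : IsDecayFunction Γ F) (h : D.decayNorm F T μ < ∞)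
    {s : ℝ} (hs : s ∈ Set.Icc 0 T) (x y : Γ) (S : Finset (Finset Γ)) :
    ∑ Y ∈ S with x ∈ Y ∧ y ∈ Y, D.cbBound s Y ≤
      (D.decayNorm F T μ).toReal * decay F μ x y := by
  have hne : ∀ Y ∈ S.filter fun Y => x ∈ Y ∧ y ∈ Y,
      cbNorm (localAlgebra b Y) (D.psi s Y) ≠ ∞ := fun Y hY =>
    cbNorm_ne_top hF h hs ⟨x, (Finset.mem_filter.1 hY).2.1⟩
  calc ∑ Y ∈ S with x ∈ Y ∧ y ∈ Y, D.cbBound s Y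
      ≤ ∑ Y ∈ S with x ∈ Y ∧ y ∈ Y, (cbNorm (localAlgebra b Y) (D.psi s Y)).toReal := by
        refine Finset.sum_le_sum fun Y _ => ?_
        unfold cbBound
        split_ifs
        · exact ENNReal.toReal_nonneg
        · exact le_rfl
    _ = (∑ Y ∈ S with x ∈ Y ∧ y ∈ Y, cbNorm (localAlgebra b Y) (D.psi s Y)).toReal :=
        (ENNReal.toReal_sum hne).symm
    _ ≤ (ENNReal.ofReal ((D.decayNorm F T μ).toReal * decay F μ x y)).toReal := by
        refine ENNReal.toReal_mono ENNReal.ofReal_ne_top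
          (le_trans ?_ (tsum_cbNorm_le hF h hs x y))
        rw [← Finset.sum_subtype_of_mem (p := fun Y => x ∈ Y ∧ y ∈ Y)
          (fun Y => cbNorm (localAlgebra b Y) (D.psi s Y)) fun Y hY => (Finset.mem_filter.1 hY).2]
        exact ENNReal.sum_le_tsum _
    _ = (D.decayNorm F T μ).toReal * decay F μ x y :=
        ENNReal.toReal_ofReal (mul_nonneg ENNReal.toReal_nonneg (decay_nonneg _ _ _ _))

variable {D} in
theorem exists_cbBound_le (hF : IsDecayFunction Γ F) (h : D.decayNorm F T μ < ∞) (Z : Finset Γ) :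
    ∃ C, ∀ t ∈ Set.Icc 0 T, D.cbBound t Z ≤ C := by
  classical
  rcases Z.eq_empty_or_nonempty with rfl | ⟨x, hx⟩
  · exact ⟨0, fun t _ => by simp [cbBound]⟩
  · refine ⟨(D.decayNorm F T μ).toReal * decay F μ x x, fun t ht => ?_⟩
    have := sum_cbBound_le hF h ht x x {Z}
    rwa [Finset.filter_true_of_mem (by simpa using hx), Finset.sum_singleton] at this

variable {D} in
theorem norm_psi_le_cbBound [∀ x, Nontrivial (H x)] (hF : IsDecayFunction Γ F)
    (h : D.decayNorm F T μ < ∞) {t : ℝ} (ht : t ∈ Set.Icc 0 T) (Z : Finset Γ)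
    {A : Rep ι →L[ℂ] Rep ι} (hA : A ∈ quasiLocalAlgebra b) :
    ‖D.psi t Z A‖ ≤ D.cbBound t Z * ‖A‖ := by
  unfold cbBound
  split_ifs with hZ
  · subst hZ
    rw [D.psi_empty t hA, norm_zero, zero_mul]
  · exact D.norm_psi_le t Z (cbNorm_ne_top hF h ht (Finset.nonempty_iff_ne_empty.2 hZ)) hA

variable {D} in
-- Norm continuity is assumed on `𝒜_Λ` only. On products the generator acts on the factor in `𝒜_Λ`;
-- the bound for bounded times carries continuity to the closure.
theorem continuousOn_generator [∀ x, Nontrivial (H x)] (hF : IsDecayFunction Γ F)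
    (h : ∀ T, D.decayNorm F T μ < ∞) (hcont : D.NormContinuous) (Λ : Finset Γ)
    {A : Rep ι →L[ℂ] Rep ι} (hA : A ∈ quasiLocalAlgebra b) :
    ContinuousOn (fun t => D.generator t Λ A) (Set.Ici 0) := by
  obtain ⟨𝓛, h𝓛, h𝓛'⟩ := hcont Λ
  have hdense := mem_closure_of_mul_of_add b (Λ : Set Γ)
    (p := fun A => Continuous fun t => D.generator t Λ A)
    (fun A hA B hB => by
      simp_rw [D.generator_mul _ Λ A hB, ← h𝓛' _ ⟨A, siteAlgebra_le_localAlgebra b Λ hA⟩]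
      fun_prop)
    (fun A _ B _ hA hB => by
      simp only [generator_eq, map_add] at hA hB ⊢
      exact hA.add hB) hA
  have hbound : ∀ T, ∃ C, 0 < C ∧ ∀ t ∈ Set.Icc 0 T, ∀ A ∈ quasiLocalAlgebra b,
      ‖D.generator t Λ A‖ ≤ C * ‖A‖ := by
    intro T
    choose C hC using fun Z => exists_cbBound_le hF (h T) Z
    refine ⟨∑ Z ∈ Λ.powerset, |C Z| + 1, by positivity, fun t ht A hA => ?_⟩
    refine (norm_sum_le _ _).trans (le_trans (Finset.sum_le_sum fun Z _ =>
      (norm_psi_le_cbBound hF (h T) ht Z hA).trans (c := |C Z| * ‖A‖) ?_) ?_)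
    · gcongr
      exact (hC Z t ht).trans (le_abs_self _)
    · rw [← Finset.sum_mul]
      gcongr
      linarith
  refine continuousOn_of_locally_uniform_approx_of_continuousWithinAt fun t ht u hu => ?_
  obtain ⟨ε, hε, hεu⟩ := Metric.mem_uniformity_dist.1 hu
  obtain ⟨C, hC0, hC⟩ := hbound (t + 1)
  obtain ⟨B, ⟨hB, hBc⟩, hAB⟩ := Metric.mem_closure_iff.1 hdense (ε / C) (by positivity)
  refine ⟨Set.Ici 0 ∩ Set.Iio (t + 1), ?_, fun t => D.generator t Λ B,
    hBc.continuousWithinAt, fun r hr => hεu ?_⟩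
  · exact inter_mem self_mem_nhdsWithin (nhdsWithin_le_nhds (Iio_mem_nhds (by linarith)))
  · change dist (D.generator r Λ A) (D.generator r Λ B) < ε
    rw [dist_eq_norm, generator_eq, generator_eq, ← map_sub, ← generator_eq]
    refine (hC r ⟨hr.1, hr.2.le⟩ _ (sub_mem hA hB)).trans_lt ?_
    rw [dist_eq_norm, lt_div_iff₀ hC0] at hAB
    linarith

end Interaction

end CbBound
-- The lattice model as an instance of the abstract dynamics.
section QuasiLocalDynamics

universe u v w

variable {Γ : Type u} {H : Γ → Type v} [∀ x, NormedAddCommGroup (H x)]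
  [∀ x, InnerProductSpace ℂ (H x)] {ι : Γ → Type w} {b : ∀ x, HilbertBasis (ι x) ℂ (H x)}

instance : CompleteSpace (quasiLocalAlgebra b) :=
  (isClosed_quasiLocalAlgebra b).completeSpace_coe

theorem hasDerivWithinAt_coe_iff {S : StarSubalgebra ℂ (Rep ι →L[ℂ] Rep ι)} {f : ℝ → S} {f' : S}
    {s : Set ℝ} {t : ℝ} :
    HasDerivWithinAt (fun r => (f r : Rep ι →L[ℂ] Rep ι)) (f' : Rep ι →L[ℂ] Rep ι) s t ↔
      HasDerivWithinAt f f' s t := by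
  rw [hasDerivWithinAt_iff_isLittleO, hasDerivWithinAt_iff_isLittleO,
    ← Asymptotics.isLittleO_norm_left,
    ← Asymptotics.isLittleO_norm_left (f' := fun x' => f x' - f t - (x' - t) • f')]
  rfl

namespace Interaction

variable (D : Interaction b)

/-- The map `Ψ_Z(t)` on the quasi-local algebra. -/
noncomputable def quasiLocalPsi (t : ℝ) (Z : Finset Γ) :
    quasiLocalAlgebra b →L[ℂ] quasiLocalAlgebra b :=
  LinearMap.mkContinuous
    { toFun := fun A => ⟨D.psiCLM t Z A, D.psi_mem t Z A.2⟩
      map_add' := fun A B => Subtype.ext (map_add (D.psiCLM t Z) A.1 B.1)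
      map_smul' := fun c A => Subtype.ext (map_smul (D.psiCLM t Z) c A.1) }
    ‖D.psiCLM t Z‖ fun A => (D.psiCLM t Z).le_opNorm A

theorem coe_sum_quasiLocalPsi (t : ℝ) (Λ : Finset Γ) (A : quasiLocalAlgebra b) :
    (((∑ Z ∈ Λ.powerset, D.quasiLocalPsi t Z) A : quasiLocalAlgebra b) : Rep ι →L[ℂ] Rep ι) =
      D.generator t Λ A := by
  rw [_root_.sum_apply, generator, AddSubmonoidClass.coe_finsetSum]
  rfl

theorem isFiniteVolumeDynamics_iff [DecidableEq Γ] {Λ : Finset Γ}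
    {g : ℝ → ℝ → quasiLocalAlgebra b →L[ℂ] quasiLocalAlgebra b} :
    D.IsFiniteVolumeDynamics Λ g ↔ IsLocalGenerator.IsPropagator D.quasiLocalPsi Λ g := by
  constructor
  · intro h
    refine ⟨h.initial, fun s hs A t hst => ?_⟩
    rw [← hasDerivWithinAt_coe_iff, coe_sum_quasiLocalPsi]
    exact h.hasDeriv s t hs hst A
  · intro h
    refine ⟨h.initial, fun s t hs hst A => ?_⟩
    have := h.isSolution s hs A t hst
    rw [← hasDerivWithinAt_coe_iff, coe_sum_quasiLocalPsi] at this
    exact this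


open IsLocalGenerator

variable {D} in
theorem isSolution_one [DecidableEq Γ] (Λ : Finset Γ) (s : ℝ) :
    IsSolution D.quasiLocalPsi Λ s fun _ => 1 := by
  intro t _
  have h : (∑ Z ∈ Λ.powerset, D.quasiLocalPsi t Z) 1 = 0 := by
    rw [_root_.sum_apply]
    exact Finset.sum_eq_zero fun Z _ => Subtype.ext (D.psi_one t Z)
  rw [h]
  exact hasDerivWithinAt_const _ _ _

variable {D} in
theorem isSolution_star [DecidableEq Γ] {Λ : Finset Γ} {s : ℝ} {x : ℝ → quasiLocalAlgebra b}
    (hx : IsSolution D.quasiLocalPsi Λ s x) :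
    IsSolution D.quasiLocalPsi Λ s fun t => star (x t) := by
  intro t ht
  have h : (∑ Z ∈ Λ.powerset, D.quasiLocalPsi t Z) (star (x t)) =
      star ((∑ Z ∈ Λ.powerset, D.quasiLocalPsi t Z) (x t)) := by
    rw [_root_.sum_apply, _root_.sum_apply, star_sum]
    exact Finset.sum_congr rfl fun Z _ => Subtype.ext (D.psi_star t Z (x t))
  rw [h]
  exact (hx t ht).star

/-- Solutions of the differential equation in the local algebra. -/
theorem exists_isSolution_localAlgebra [DecidableEq Γ] (hcont : D.NormContinuous) (Λ : Finset Γ)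
    {s : ℝ} (hs : 0 ≤ s) {A : quasiLocalAlgebra b}
    (hA : (A : Rep ι →L[ℂ] Rep ι) ∈ localAlgebra b Λ) :
    ∃ x : ℝ → quasiLocalAlgebra b, x s = A ∧ IsSolution D.quasiLocalPsi Λ s x ∧
      ∀ t, (x t : Rep ι →L[ℂ] Rep ι) ∈ localAlgebra b Λ := by
  obtain ⟨𝓛, h𝓛, h𝓛'⟩ := hcont Λ
  have : CompleteSpace (localAlgebra b Λ) := (isClosed_localAlgebra b Λ).completeSpace_coe
  -- The equation is solved inside the Banach space `𝒜_Λ`; uniqueness in `𝒜_Γ` will identify this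
  -- solution with the propagator and give invariance. Freezing negative times lets compactness of
  -- `[0, T]` bound the generator.
  obtain ⟨x, hxs, hx⟩ := exists_hasDerivAt_linear (E := localAlgebra b Λ)
    (L := fun t => (𝓛 (max t 0)).restrictScalars ℝ)
    (fun a => by
      change Continuous fun t => 𝓛 (max t 0) a
      fun_prop)
    (fun T => by
      obtain ⟨C, hC⟩ := (isCompact_Icc (a := (0 : ℝ)) (b := max T 0)).exists_bound_of_continuousOn
        (f := 𝓛) h𝓛.continuousOn
      refine ⟨C, fun t ht => ?_⟩
      rw [ContinuousLinearMap.norm_restrictScalars]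
      exact hC _ ⟨le_max_right _ _, max_le_max_right _ ht⟩) s ⟨A, hA⟩
  refine ⟨fun t => ⟨x t, localAlgebra_le_quasiLocalAlgebra b Λ (x t).2⟩, Subtype.ext ?_,
    fun t ht => ?_, fun t => (x t).2⟩
  · change (x s : Rep ι →L[ℂ] Rep ι) = A
    rw [hxs]
  rw [← hasDerivWithinAt_coe_iff, coe_sum_quasiLocalPsi, ← h𝓛']
  have := (hx t).hasDerivWithinAt (s := Set.Ici s)
  rw [max_eq_left (hs.trans ht)] at this
  exact hasDerivWithinAt_coe_iff.2 this

variable [MetricSpace Γ] [∀ x, Nontrivial (H x)] {F : ℝ≥0 → ℝ≥0} {μ : ℝ}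

variable {D} in
theorem isLocalGenerator [DecidableEq Γ] (hF : IsDecayFunction Γ F) (hμ : 0 ≤ μ)
    (h : ∀ T, D.decayNorm F T μ < ∞) (hcont : D.NormContinuous) :
    IsLocalGenerator D.quasiLocalPsi D.cbBound
      fun X => {A | (A : Rep ι →L[ℂ] Rep ι) ∈ localAlgebra b X} where
  nonneg := D.cbBound_nonneg
  norm_le t Z A ht := norm_psi_le_cbBound hF (h t) ⟨ht, le_rfl⟩ Z A.2
  comm r t Y Z A hYZ := Subtype.ext (D.psi_comm r t hYZ A.2)
  vanish t X Z A hXZ hA := Subtype.ext (D.psi_eq_zero t hXZ hA)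
  dissipative t Z := by
    have hL : IsKraus (D.L t Z) := D.L_summable t Z
    refine ⟨2 * ‖drift (D.Φ t Z) (D.L t Z)‖ ^ 2, by positivity, fun A h hh => ?_⟩
    have := norm_lindblad_step_le hL.hasSum_norm_sq (hL.hasSum_inner (A : Rep ι →L[ℂ] Rep ι))
      (hL.drift_add_star (D.Φ_star t Z)) hh
    rw [← hL.lindbladMap_eq_drift (D.Φ_star t Z)] at this
    exact this
  continuousOn Λ A := by
    refine Topology.IsInducing.subtypeVal.continuousOn_iff.2 ?_
    refine (continuousOn_generator hF h hcont Λ A.2).congr fun t _ => ?_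
    exact D.coe_sum_quasiLocalPsi t Λ A
  dense A := by
    rw [closure_subtype]
    refine closure_mono ?_ (mem_closure_iUnion_localAlgebra b A.2)
    refine Set.iUnion_subset fun X B hB => ?_
    exact ⟨⟨B, localAlgebra_le_quasiLocalAlgebra b X hB⟩, Set.mem_iUnion.2 ⟨X, hB⟩, rfl⟩
  bounded T Z := exists_cbBound_le hF (h T) Z
  weight T X := by
    obtain ⟨v, κ, h1, h2, h3, h4, h5⟩ := hF.exists_weight hμ
      (ENNReal.toReal_nonneg (a := D.decayNorm F T μ)) X
    exact ⟨v, κ, h1, h2, h3, h4, fun t ht => h5 _ fun x y S => sum_cbBound_le hF (h T) ht x y S⟩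

end Interaction

end QuasiLocalDynamics
-- Complete positivity from complete contractivity.
section CompletePositivity

theorem continuous_ofMatrix_comp {A X : Type*} {n : Type*} [Fintype n] [TopologicalSpace X]
    [NonUnitalCStarAlgebra A] [PartialOrder A] [StarOrderedRing A] {f : X → n → n → A}
    (hf : ∀ i j, Continuous fun x => f x i j) :
    Continuous fun x => (CStarMatrix.ofMatrix (f x) : CStarMatrix n n A) :=
  continuous_pi fun i => continuous_pi fun j => hf i j

/-- A self-adjoint element `c` that is at least as close to `‖a* a‖` as `a* a` is positive. -/
theorem exists_eq_star_mul_self {B : Type*} [CStarAlgebra B] (a : B) {c : B}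
    (hc : IsSelfAdjoint c) (h : ‖c‖ ≤ ‖star a * a‖)
    (h' : ‖(‖star a * a‖ : ℂ) • (1 : B) - c‖ ≤ ‖(‖star a * a‖ : ℂ) • (1 : B) - star a * a‖) :
    ∃ d, c = star d * d := by
  have e : (‖star a * a‖ : ℂ) • (1 : B) = algebraMap ℝ B ‖star a * a‖ :=
    (Algebra.algebraMap_eq_smul_one _).symm
  rw [e] at h'
  let _ : PartialOrder B := CStarAlgebra.spectralOrder B
  have _ : StarOrderedRing B := CStarAlgebra.spectralOrderedRing B
  have hP0 : SpectrumRestricts (star a * a) ContinuousMap.realToNNReal :=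
    SpectrumRestricts.nnreal_of_nonneg (star_mul_self_nonneg a)
  -- A self-adjoint element of norm at most `t` is positive exactly when its distance to `t • 1` is
  -- at most `t`. With `t = ‖star a * a‖` this is applied to `star a * a`, and then backwards to
  -- `c`.
  have h2 := (SpectrumRestricts.nnreal_iff_nnnorm (.star_mul_self a)
    (t := ‖star a * a‖₊) le_rfl).1 hP0
  have hQ0 : SpectrumRestricts c ContinuousMap.realToNNReal :=
    (SpectrumRestricts.nnreal_iff_nnnorm hc (t := ‖star a * a‖₊) h).2 (h'.trans h2)
  have hQ : 0 ≤ c := nonneg_iff_isSelfAdjoint_and_quasispectrumRestricts.2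
    ⟨hc, (quasispectrumRestricts_iff_spectrumRestricts).2 hQ0⟩
  exact CStarAlgebra.nonneg_iff_eq_star_mul_self.1 hQ

/-- A unital completely contractive map that preserves adjoints is completely positive. -/
theorem isCompletelyPositive_of_contractive {A : Type*} [CStarAlgebra A] [PartialOrder A]
    [StarOrderedRing A] {γ : A →L[ℂ] A} (h1 : γ 1 = 1) (hstar : ∀ a, γ (star a) = star (γ a))
    (hc : ∀ (n : ℕ) (M : CStarMatrix (Fin n) (Fin n) A), ‖M.map γ‖ ≤ ‖M‖) :
    IsCompletelyPositive γ := by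
  intro n M
  set P : CStarMatrix (Fin n) (Fin n) A := star (CStarMatrix.ofMatrix M) * CStarMatrix.ofMatrix M
    with hP
  have hPsa : IsSelfAdjoint P := IsSelfAdjoint.star_mul_self _
  have hQsa : IsSelfAdjoint (P.map γ) := by
    refine CStarMatrix.ext fun i j => ?_
    rw [CStarMatrix.star_apply, CStarMatrix.map_apply, CStarMatrix.map_apply, ← hstar,
      CStarMatrix.star_apply_of_isSelfAdjoint hPsa]
  -- Contractivity is used twice, on `P` and on `‖P‖ • 1 - P`; unitality sends the latter to `‖P‖ •
  -- 1 - P.map γ`.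
  obtain ⟨N, hN⟩ := exists_eq_star_mul_self (CStarMatrix.ofMatrix M) hQsa (hc n P) (by
    refine le_trans (le_of_eq ?_)
      (hc n ((‖P‖ : ℂ) • (1 : CStarMatrix (Fin n) (Fin n) A) - P))
    congr 1
    refine CStarMatrix.ext fun i j => ?_
    rw [CStarMatrix.sub_apply, CStarMatrix.map_apply, CStarMatrix.map_apply,
      CStarMatrix.sub_apply, map_sub, CStarMatrix.smul_apply, map_smul,
      CStarMatrix.one_apply]
    split_ifs
    · rw [h1]
    · rw [map_zero])
  exact ⟨CStarMatrix.ofMatrix.symm N, hN⟩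

end CompletePositivity

/-! ### Complete contractivity of the finite-volume dynamics. -/

section MatrixContraction

universe u v w

variable {Γ : Type u} {H : Γ → Type v} [∀ x, NormedAddCommGroup (H x)]
  [∀ x, InnerProductSpace ℂ (H x)] {ι : Γ → Type w} {b : ∀ x, HilbertBasis (ι x) ℂ (H x)}
  {n : Type*} [Fintype n]

/-- Matrices of solutions contract with respect to a seminorm if their Euler steps do. -/
theorem seminorm_solution_le [DecidableEq Γ] {E : Type*} [NormedAddCommGroup E] [NormedSpace ℂ E]
    {Ψ : ℝ → Finset Γ → E →L[ℂ] E} (p : Seminorm ℝ (n → n → E)) (hp : Continuous p)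
    (hΨ : ∀ t Z, ∃ k, ∀ (M : n → n → E) (h : ℝ), 0 < h →
      p (M + h • fun i j => Ψ t Z (M i j)) ≤ (1 + h ^ 2 * k) * p M)
    {Λ : Finset Γ} {s : ℝ} {x : n → n → ℝ → E}
    (hx : ∀ i j, IsLocalGenerator.IsSolution Ψ Λ s (x i j)) {t : ℝ} (hst : s ≤ t) :
    p (fun i j => x i j t) ≤ p fun i j => x i j s := by
  obtain ⟨C, -, hC⟩ := Seminorm.bound_of_continuous_normedSpace p hp
  have := seminorm_le_gronwallBound p hC (κ := 0) (ε := 0) (s := s) (T := t)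
    (x := fun t i j => x i j t)
    (x' := fun t => ∑ Z ∈ Λ.powerset, fun i j => Ψ t Z (x i j t))
    (fun t ht => ?_) (fun t hst htT => ?_) t hst le_rfl
  · simpa [gronwallBound_K0] using this
  · refine hasDerivWithinAt_pi.2 fun i => hasDerivWithinAt_pi.2 fun j => ?_
    have := hx i j t ht
    rw [_root_.sum_apply] at this
    simpa only [Finset.sum_apply] using this
  · choose k hk using hΨ t
    refine ⟨Λ.powerset.card * ∑ Z ∈ Λ.powerset, k Z, fun h hh => ?_⟩
    simp only [mul_zero, add_zero]
    exact seminorm_add_smul_sum_le p Λ.powerset _ _ k (fun Z _ h hh => hk Z _ h hh) hh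

/-- The entrywise inclusion is an injective star homomorphism of C⋆-algebras, hence isometric; so
norms may be computed with matrices of operators. -/
theorem norm_map_coe [IsClosed (quasiLocalAlgebra b : Set (Rep ι →L[ℂ] Rep ι))]
    [PartialOrder (quasiLocalAlgebra b)] [StarOrderedRing (quasiLocalAlgebra b)]
    (M : CStarMatrix n n (quasiLocalAlgebra b)) :
    ‖M.map fun A => (A : Rep ι →L[ℂ] Rep ι)‖ = ‖M‖ := by
  let φ : quasiLocalAlgebra b →⋆ₙₐ[ℂ] (Rep ι →L[ℂ] Rep ι) := (quasiLocalAlgebra b).subtype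
  exact NonUnitalStarAlgHom.norm_map (CStarMatrix.mapₙₐ (n := n) φ)
    (CStarMatrix.map_injective Subtype.val_injective) M

set_option linter.unusedSectionVars false

/-- A matrix of quasi-local observables, as a matrix of operators. -/
def coeMatrix (M : n → n → quasiLocalAlgebra b) : CStarMatrix n n (Rep ι →L[ℂ] Rep ι) :=
  CStarMatrix.ofMatrix fun i j => (M i j : Rep ι →L[ℂ] Rep ι)

/-- Matrices of solutions are differentiated entrywise, in the product norm, while the contraction
concerns the C⋆-norm. Continuity makes the latter a seminorm to which the Grönwall estimate applies.
-/
theorem continuous_coeMatrix :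
    Continuous (coeMatrix : (n → n → quasiLocalAlgebra b) → CStarMatrix n n _) :=
  continuous_ofMatrix_comp fun i j => by fun_prop

theorem coeMatrix_add (M N : n → n → quasiLocalAlgebra b) :
    coeMatrix (M + N) = coeMatrix M + coeMatrix N := rfl

theorem coeMatrix_smul (c : ℝ) (M : n → n → quasiLocalAlgebra b) :
    coeMatrix (c • M) = (c : ℂ) • coeMatrix M := rfl

variable (b n) in
/-- The C⋆-norm of matrices of quasi-local observables. -/
noncomputable def matrixSeminorm : Seminorm ℝ (n → n → quasiLocalAlgebra b) :=
  Seminorm.of (fun M => ‖coeMatrix M‖) (fun M N => norm_add_le (coeMatrix M) (coeMatrix N))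
    fun c M => by rw [coeMatrix_smul, norm_smul, Complex.norm_real]

theorem matrixSeminorm_apply (M : n → n → quasiLocalAlgebra b) :
    matrixSeminorm b n M = ‖coeMatrix M‖ := rfl

theorem continuous_matrixSeminorm : Continuous (matrixSeminorm b n) :=
  (continuous_norm (E := CStarMatrix n n (Rep ι →L[ℂ] Rep ι))).comp continuous_coeMatrix

theorem Interaction.exists_matrixSeminorm_le (D : Interaction b) (t : ℝ) (Z : Finset Γ) :
    ∃ k, ∀ (M : n → n → quasiLocalAlgebra b) (h : ℝ), 0 < h →
      matrixSeminorm b n (M + h • fun i j => D.quasiLocalPsi t Z (M i j)) ≤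
        (1 + h ^ 2 * k) * matrixSeminorm b n M := by
  obtain ⟨k, -, hk⟩ := IsKraus.exists_norm_matrix_step_le (n := n) (D.L_summable t Z)
    (D.Φ_star t Z)
  refine ⟨k, fun M h hh => ?_⟩
  rw [matrixSeminorm_apply, matrixSeminorm_apply, coeMatrix_add, coeMatrix_smul]
  exact hk (coeMatrix M) h hh

/-- The finite-volume dynamics are completely contractive. -/
theorem Interaction.norm_matrix_solution_le [DecidableEq Γ] (D : Interaction b) {Λ : Finset Γ}
    {s : ℝ} {x : n → n → ℝ → quasiLocalAlgebra b}
    (hx : ∀ i j, IsLocalGenerator.IsSolution D.quasiLocalPsi Λ s (x i j)) {t : ℝ} (hst : s ≤ t) :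
    ‖coeMatrix fun i j => x i j t‖ ≤ ‖coeMatrix fun i j => x i j s‖ :=
  seminorm_solution_le (matrixSeminorm b n) continuous_matrixSeminorm D.exists_matrixSeminorm_le
    hx hst

end MatrixContraction
-- Unitality and complete positivity of the limit.
section Limit

universe u v w

variable {Γ : Type u} {H : Γ → Type v} [∀ x, NormedAddCommGroup (H x)]
  [∀ x, InnerProductSpace ℂ (H x)] {ι : Γ → Type w} {b : ∀ x, HilbertBasis (ι x) ℂ (H x)}

/-- Limits of the finite-volume dynamics are unital and completely positive. -/
theorem unital_and_isCompletelyPositive_of_tendsto [DecidableEq Γ] {D : Interaction b}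
    {c : ℝ → Finset Γ → ℝ} {𝒜 : Finset Γ → Set (quasiLocalAlgebra b)}
    (hΨ : IsLocalGenerator D.quasiLocalPsi c 𝒜)
    {U : Finset Γ → ℝ → ℝ → quasiLocalAlgebra b →L[ℂ] quasiLocalAlgebra b}
    (hU : ∀ Λ, IsLocalGenerator.IsPropagator D.quasiLocalPsi Λ (U Λ)) {s t : ℝ} (hs : 0 ≤ s)
    (hst : s ≤ t) {γ : quasiLocalAlgebra b →L[ℂ] quasiLocalAlgebra b}
    (hlim : ∀ A, Tendsto (fun Λ => U Λ t s A) atTop (𝓝 (γ A))) :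
    γ 1 = 1 ∧ IsCompletelyPositive γ := by
  -- The constant curve 1 and the adjoint of a solution are solutions, so uniqueness gives unitality
  -- and compatibility with adjoints in finite volume.
  have h1 : ∀ Λ, U Λ t s 1 = 1 := fun Λ =>
    IsLocalGenerator.IsSolution.unique hΨ ((hU Λ).isSolution s hs 1)
      (Interaction.isSolution_one Λ s) ((hU Λ).initial s hs 1) hst
  have hstar : ∀ Λ A, U Λ t s (star A) = star (U Λ t s A) := fun Λ A =>
    IsLocalGenerator.IsSolution.unique hΨ ((hU Λ).isSolution s hs (star A))
      (Interaction.isSolution_star ((hU Λ).isSolution s hs A))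
      (by simp only [(hU Λ).initial s hs]) hst
  have hγ1 : γ 1 = 1 := tendsto_nhds_unique (hlim 1) (by simp only [h1]; exact tendsto_const_nhds)
  refine ⟨hγ1, ?_⟩
  have _ : IsClosed (quasiLocalAlgebra b : Set (Rep ι →L[ℂ] Rep ι)) := isClosed_quasiLocalAlgebra b
  -- Complete positivity is formulated by elements `M* M` without reference to an order, so the
  -- spectral order may be chosen locally.
  let _ : PartialOrder (quasiLocalAlgebra b) := CStarAlgebra.spectralOrder _
  have _ : StarOrderedRing (quasiLocalAlgebra b) := CStarAlgebra.spectralOrderedRing _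
  refine isCompletelyPositive_of_contractive hγ1 (fun A => ?_) fun n M => ?_
  · refine tendsto_nhds_unique (hlim (star A)) ?_
    simp only [hstar]
    exact (continuous_star.tendsto _).comp (hlim A)
  · rw [← norm_map_coe, ← norm_map_coe]
    have hc : ∀ Λ, ‖coeMatrix fun i j => U Λ t s (M i j)‖ ≤ ‖coeMatrix fun i j => M i j‖ := by
      intro Λ
      have := D.norm_matrix_solution_le (x := fun i j t => U Λ t s (M i j))
        (fun i j => (hU Λ).isSolution s hs (M i j)) hst
      simpa only [(hU Λ).initial s hs] using this
    have hT : Tendsto (fun Λ => fun i j => U Λ t s (M i j)) atTop (𝓝 fun i j => γ (M i j)) :=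
      tendsto_pi_nhds.2 fun i => tendsto_pi_nhds.2 fun j => hlim (M i j)
    exact le_of_tendsto ((continuous_matrixSeminorm.tendsto _).comp hT) (Eventually.of_forall hc)

end Limit

end QuantumLattice

/-! ### The main theorem. -/

theorem theorem3p4p1 {Γ : Type*} [MetricSpace Γ] [Countable Γ]
    {H : Γ → Type*} [∀ x, NormedAddCommGroup (H x)] [∀ x, InnerProductSpace ℂ (H x)]
    [∀ x, CompleteSpace (H x)] [∀ x, Nontrivial (H x)]
    {ι : Γ → Type*} (b : ∀ x, HilbertBasis (ι x) ℂ (H x))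
    (F : ℝ≥0 → ℝ≥0) (hF : QuantumLattice.IsDecayFunction Γ F)
    (D : QuantumLattice.Interaction b)
    (hcont : D.NormContinuous) (hdecay : D.UniformDecay F) :
    -- the finite-volume dynamics exist, and leave the local algebras invariant
    (∀ Λ : Finset Γ,
      ∃ g : ℝ → ℝ → QuantumLattice.quasiLocalAlgebra b →L[ℂ] QuantumLattice.quasiLocalAlgebra b,
        D.IsFiniteVolumeDynamics Λ g ∧
        ∀ s t, 0 ≤ s → s ≤ t → ∀ A : QuantumLattice.quasiLocalAlgebra b,
          (A : QuantumLattice.Rep ι →L[ℂ] QuantumLattice.Rep ι) ∈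
              QuantumLattice.localAlgebra b Λ →
            (g t s A : QuantumLattice.Rep ι →L[ℂ] QuantumLattice.Rep ι) ∈
              QuantumLattice.localAlgebra b Λ) ∧
    -- the thermodynamic limit
    ∃ γ : ℝ → ℝ → QuantumLattice.quasiLocalAlgebra b →L[ℂ] QuantumLattice.quasiLocalAlgebra b,
      QuantumLattice.IsStronglyContinuousCocycle γ ∧
      (∀ s t, 0 ≤ s → s ≤ t →
        γ t s 1 = 1 ∧ QuantumLattice.IsCompletelyPositive (γ t s)) ∧
      ∀ Λ : ℕ → Finset Γ, Monotone Λ → (∀ x, ∃ n, x ∈ Λ n) →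
        ∀ g : ℕ → ℝ → ℝ →
            QuantumLattice.quasiLocalAlgebra b →L[ℂ] QuantumLattice.quasiLocalAlgebra b,
          (∀ n, D.IsFiniteVolumeDynamics (Λ n) (g n)) →
          ∀ s t, 0 ≤ s → s ≤ t → ∀ A : QuantumLattice.quasiLocalAlgebra b,
            Tendsto (fun n => g n t s A) atTop (𝓝 (γ t s A)) := by
  classical
  obtain ⟨μ, hμ, hdec⟩ := hdecay
  have hΨ := QuantumLattice.Interaction.isLocalGenerator hF hμ.le hdec hcont
  choose U hU using hΨ.exists_isPropagator
  obtain ⟨γ, hγ, hlim⟩ := QuantumLattice.IsLocalGenerator.exists_limit hΨ hU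
  refine ⟨fun Λ => ⟨U Λ, D.isFiniteVolumeDynamics_iff.2 (hU Λ), fun s t hs hst A hA => ?_⟩,
    γ, hγ, fun s t hs hst => ?_, fun Λ hΛ hΛ' g hg s t hs hst A => ?_⟩
  · obtain ⟨x, hxs, hx, hxΛ⟩ := D.exists_isSolution_localAlgebra hcont Λ hs hA
    rw [QuantumLattice.IsLocalGenerator.IsSolution.unique hΨ ((hU Λ).isSolution s hs A) hx
      (((hU Λ).initial s hs A).trans hxs.symm) hst]
    exact hxΛ t
  · exact QuantumLattice.unital_and_isCompletelyPositive_of_tendsto hΨ hU hs hst (hlim s t hs hst)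
  -- Convergence holds along the net of all finite sets, and an exhausting increasing sequence is
  -- cofinal in it. Uniqueness identifies the given dynamics with the propagators constructed here.
  · refine ((hlim s t hs hst A).comp (tendsto_atTop_finset_of_monotone hΛ hΛ')).congr fun n => ?_
    exact (hU (Λ n)).eq hΨ (D.isFiniteVolumeDynamics_iff.1 (hg n)) hs hst A
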